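/- Fourier transforms are taken in the sense of tempered distributions, $\langle\xi\rangle=(1+|\xi|^2)^{1/2}$, and for $p\in[1,\infty]$, $s\in\mathbb{R}$ the Fourier–Lebesgue space $\mathcal{F}L_p^s(\mathbb{R}^d)$ consists of the tempered distributions $f$ whose Fourier transform is a function with $\|f\|_{\mathcal{F}L_p^s}=\|\langle\cdot\rangle^s\widehat f\|_{L^p(\mathbb{R}^d)}<\infty$. For $f\colon[0,T]^2\to E$ with values in a normed space, $f\in C^\gamma([0,T]^2;E)$ means that $\|f_{s}\|_E$, $\|f_{t_1,s_2}-f_{s_1,s_2}\|_E/|t_1-s_1|^\gamma$, $\|f_{s_1,t_2}-f_{s_1,s_2}\|_E/|t_2-s_2|^\gamma$ and $\|\Box_{s,t}f\|_E/(|t_1-s_1|^\gamma|t_2-s_2|^\gamma)$ are bounded, where $\Box_{s,t}f=f_{t_1,t_2}-f_{t_1,s_2}-f_{s_1,t_2}+f_{s_1,s_2}$. On paths $f\colon[0,T]\to\mathbb{R}^d$, $\|f\|_{C^\gamma([0,T])}=\sup_t|f_t|+\sup_{s\neq t}|f_t-f_s|/|t-s|^\gamma$. $C_b^{1+\kappa'}(\mathbb{R}^d)$,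 $0<\kappa'<1$, is the space of bounded $C^1$ vector fields with bounded and $\kappa'$-Hölder continuous derivative, with its usual norm. Let $T>0$, let $w\in L^\infty([0,T])$ be a real weight and $z\in C([0,T];\mathbb{R}^d)$ a path, with two-parameter weighted self-intersection measure $$G_{t_1,t_2}(C)=\int_0^{t_2}\int_0^{t_1}w_{r_1}w_{r_2}\,\mathbf 1_C(z_{r_2}-z_{r_1})\,dr_1\,dr_2,\qquad (t_1,t_2)\in[0,T]^2,$$ and reflection $\overline G_{t_1,t_2}(C)=G_{t_1,t_2}(-C)$. For an $\mathbb{R}^d$-valued tempered distribution $b$ put $A^b(t_1,t_2,\theta)=(b*\overline G_{t_1,t_2})(\theta)$, where $f*g=\mathcal F^{-1}(\widehat f\,\widehat g)$. The equation $$u_t=u_0+\int_0^t\int_0^t w_s w_r\, b(u_s-u_r)\,dr\,ds+z_t,\qquad t\in[0,T],\tag{1}$$ with distributional $b$ is understood as follows: $u=\theta+z$ is a solution if $A^b\in C^\gamma([0,T]^2;C_b^{1+\kappa'}(\mathbb{R}^d))$ for some $\kappa'\in(0,1)$ with $\gamma(1+\kappa')>1$, $\theta\in C^\gamma([0,T];\mathbb{R}^d)$,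 and for all $t\in[0,T]$ $$\theta_t=u_0+\int_0^t\int_0^t A^b(dr,\theta_{r_2}-\theta_{r_1}),$$ where the nonlinear Young integral is the limit of the Riemann sums $\sum_{[u,v]}\Box_{u,v}A^b(\cdot,\theta_{u_2}-\theta_{u_1})$ over grid partitions of $[0,t]^2$ into rectangles $[u,v]=[u_1,v_1]\times[u_2,v_2]$ as the mesh tends to $0$. **Theorem.** Let $\gamma\in(1/2,1)$, $\delta,\kappa\in\mathbb{R}$ and $q,q'\in[1,\infty]$ satisfy $$\frac1q+\frac1{q'}=1\qquad\text{and}\qquad\delta+\kappa>1+\frac1\gamma .$$ Suppose that the $\mathbb{R}^d$-valued distribution $b$ belongs to $\mathcal{F}L_{q'}^{\delta}(\mathbb{R}^d)$ and that $G\in C^\gamma([0,T]^2;\mathcal{F}L_q^\kappa(\mathbb{R}^d))$. Then for every $u_0\in\mathbb{R}^d$ equation (1) has a unique solution $u$. Moreover, let $b_n\in\mathcal{F}L_{q'}^{\delta}(\mathbb{R}^d)$, $n\ge1$, be Lipschitz continuous vector fields with $b_n\to b$ in $\mathcal{F}L_{q'}^{\delta}(\mathbb{R}^d)$, and let $u_0^{(n)}\to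 u_0$ in $\mathbb{R}^d$. Then for every $n$ there is a unique continuous function $u_n\colon[0,T]\to\mathbb{R}^d$ with $$u_n(t)=u_0^{(n)}+\int_0^t\int_0^t w_s w_r\,b_n(u_n(s)-u_n(r))\,dr\,ds+z_t,\qquad t\in[0,T],$$ and there is a constant $C>0$, independent of $n$, such that for all $n$ $$\|u_n-u\|_{C^\gamma([0,T])}\le C\left(\|b_n-b\|_{\mathcal{F}L_{q'}^\delta}+|u_0^{(n)}-u_0|\right).$$ -/

import Mathlib

open Set Filter Topology MeasureTheory
open scoped NNReal ENNReal SchwartzMap FourierTransform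

namespace SelfInteraction

noncomputable section

/-! ### Vectors and tempered distributions -/

/-- `ℝ^d` with its Euclidean norm. -/
abbrev RSpace (d : ℕ) : Type := EuclideanSpace ℝ (Fin d)

/-- `ℂ^d` with its Hermitian norm. -/
abbrev CSpace (d : ℕ) : Type := EuclideanSpace ℂ (Fin d)

/-- The inclusion `ℝ^d ⊆ ℂ^d`. -/
def toComplex {d : ℕ} (x : RSpace d) : CSpace d := WithLp.toLp 2 fun i => ((x i : ℝ) : ℂ)

/-- The componentwise real part `ℂ^d → ℝ^d`. -/
def realPart {d : ℕ} (v : CSpace d) : RSpace d := WithLp.toLp 2 fun i => (v i).re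

/-- An `ℝ^d`-valued tempered distribution, as a `ℂ^d`-valued one that takes real values on
real-valued Schwartz functions. -/
def IsRealDistribution {d : ℕ} (f : 𝓢'(RSpace d, CSpace d)) : Prop :=
  ∀ φ : 𝓢(RSpace d, ℂ), (∀ x, (φ x).im = 0) → ∀ i, (f φ i).im = 0

/-- The tempered distribution `f` is the regular distribution given by the vector field `v`. -/
def IsGivenBy {d : ℕ} (f : 𝓢'(RSpace d, CSpace d)) (v : RSpace d → RSpace d) : Prop :=
  ∀ φ : 𝓢(RSpace d, ℂ), f φ = ∫ x, φ x • toComplex (v x)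

/-! ### Fourier-Lebesgue spaces -/

section FourierLebesgue

variable {d : ℕ} {F : Type*} [NormedAddCommGroup F] [NormedSpace ℂ F]

/-- The Fourier transform of the tempered distribution `f` is the function `g`. -/
def HasFourierFunction (f : 𝓢'(RSpace d, F)) (g : RSpace d → F) : Prop :=
  ∀ φ : 𝓢(RSpace d, ℂ), Integrable (fun ξ => φ ξ • g ξ) ∧ 𝓕 f φ = ∫ ξ, φ ξ • g ξ

open Classical in
/-- The function `f̂` (unique up to null sets), whenever the Fourier transform of `f` is a
function. -/
def fourierFunction (f : 𝓢'(RSpace d, F)) : RSpace d → F :=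
  if h : ∃ g, HasFourierFunction f g then h.choose else 0

/-- `⟨ξ⟩ = (1 + |ξ|²)^{1/2}`. -/
def japaneseBracket (ξ : RSpace d) : ℝ := Real.sqrt (1 + ‖ξ‖ ^ 2)

open Classical in
/-- The norm `‖⟨·⟩^s f̂‖_{L^p}` of the Fourier-Lebesgue space of integrability `p` and regularity
`s`; it is `∞` exactly when `f` does not belong to that space. -/
def flNorm (p : ℝ≥0∞) (s : ℝ) (f : 𝓢'(RSpace d, F)) : ℝ≥0∞ :=
  if ∃ g, HasFourierFunction f g then
    eLpNorm (fun ξ => japaneseBracket ξ ^ s • fourierFunction f ξ) p volume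
  else ∞

/-- Membership in the Fourier-Lebesgue space of integrability `p` and regularity `s`. -/
def MemFL (p : ℝ≥0∞) (s : ℝ) (f : 𝓢'(RSpace d, F)) : Prop := flNorm p s f < ∞

end FourierLebesgue

/-- The convolution `f ∗ g = 𝓕⁻¹(f̂ ĝ)`, as the function
`θ ↦ ∫ exp(2πi⟨ξ, θ⟩) ĝ(ξ) f̂(ξ) dξ`; it is used where `f̂ ĝ` is integrable. -/
def convolution {d : ℕ} (f : 𝓢'(RSpace d, CSpace d)) (g : 𝓢'(RSpace d, ℂ)) :
    RSpace d → CSpace d :=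
  𝓕⁻ fun ξ => fourierFunction g ξ • fourierFunction f ξ

/-! ### The self-intersection measure -/

/-- The nearest point of `[0,T]`. It is the identity on `[0,T]` and serves only to read a path
`z`, given on `[0,T]`, as a function on `ℝ`. -/
def clamp (T r : ℝ) : ℝ := max 0 (min T r)

/-- The two-parameter weighted self-intersection measure
`G_{t₁,t₂}(C) = ∫_0^{t₂} ∫_0^{t₁} w_{r₁} w_{r₂} 1_C(z_{r₂} - z_{r₁}) dr₁ dr₂`, i.e. the image of the
signed measure `w_{r₁} w_{r₂} dr₁ dr₂` on `[0,t₁] × [0,t₂]` under `(r₁, r₂) ↦ z_{r₂} - z_{r₁}`. -/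
def selfIntersectionMeasure {d : ℕ} (T : ℝ) (w : ℝ → ℝ) (z : ℝ → RSpace d) (t₁ t₂ : ℝ) :
    SignedMeasure (RSpace d) :=
  ((volume.restrict (Ioc 0 t₁ ×ˢ Ioc 0 t₂)).withDensityᵥ fun r : ℝ × ℝ => w r.1 * w r.2).map
    fun r => z (clamp T r.2) - z (clamp T r.1)

theorem measurable_clamped {d : ℕ} {T : ℝ} (hT : 0 ≤ T) {z : ℝ → RSpace d}
    (hz : ContinuousOn z (Icc 0 T)) :
    Measurable fun r : ℝ × ℝ => z (clamp T r.2) - z (clamp T r.1) := by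
  have h : Continuous fun r => z (clamp T r) :=
    hz.comp_continuous (by unfold clamp; fun_prop)
      fun r => ⟨le_max_left _ _, max_le hT (min_le_left _ _)⟩
  exact ((h.comp continuous_snd).sub (h.comp continuous_fst)).measurable

theorem integrable_weight {T : ℝ} {w : ℝ → ℝ} (hw : MemLp w ∞ (volume.restrict (Icc 0 T)))
    {t₁ t₂ : ℝ} (h₁ : t₁ ∈ Icc 0 T) (h₂ : t₂ ∈ Icc 0 T) :
    Integrable (fun r : ℝ × ℝ => w r.1 * w r.2)
      (volume.restrict (Ioc 0 t₁ ×ˢ Ioc 0 t₂)) := by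
  have hi : ∀ t ∈ Icc 0 T, Integrable w (volume.restrict (Ioc 0 t)) := fun t ht =>
    (hw.integrable le_top).mono_measure
      (Measure.restrict_mono (Ioc_subset_Icc_self.trans (Icc_subset_Icc_right ht.2)) le_rfl)
  rw [Measure.volume_eq_prod, ← Measure.prod_restrict]
  exact (hi t₁ h₁).mul_prod (hi t₂ h₂)

/-- The defining formula of the self-intersection measure. -/
theorem selfIntersectionMeasure_apply {d : ℕ} {T : ℝ} {w : ℝ → ℝ}
    (hw : MemLp w ∞ (volume.restrict (Icc 0 T))) {z : ℝ → RSpace d}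
    (hz : ContinuousOn z (Icc 0 T)) {t₁ t₂ : ℝ} (h₁ : t₁ ∈ Icc 0 T) (h₂ : t₂ ∈ Icc 0 T)
    {C : Set (RSpace d)} (hC : MeasurableSet C) :
    selfIntersectionMeasure T w z t₁ t₂ C =
      ∫ r₂ in (0 : ℝ)..t₂, ∫ r₁ in (0 : ℝ)..t₁,
        w r₁ * w r₂ * C.indicator (fun _ => (1 : ℝ)) (z r₂ - z r₁) := by
  have hT : 0 ≤ T := h₁.1.trans h₁.2
  have hψ := measurable_clamped hT hz
  have hρ := integrable_weight hw h₁ h₂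
  have hcl : ∀ t ∈ Icc 0 T, ∀ r ∈ Ioc 0 t, clamp T r = r := fun t ht r hr => by
    unfold clamp
    rw [min_eq_right (hr.2.trans ht.2), max_eq_right hr.1.le]
  rw [selfIntersectionMeasure, VectorMeasure.map_apply _ hψ hC,
    withDensityᵥ_apply hρ (hψ hC), ← integral_indicator (hψ hC)]
  have hint := hρ.indicator (hψ hC)
  rw [Measure.volume_eq_prod, ← Measure.prod_restrict] at hint ⊢
  rw [integral_prod_symm _ hint, intervalIntegral.integral_of_le h₂.1]
  refine setIntegral_congr_fun measurableSet_Ioc fun r₂ hr₂ => ?_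
  rw [intervalIntegral.integral_of_le h₁.1]
  refine setIntegral_congr_fun measurableSet_Ioc fun r₁ hr₁ => ?_
  have e1 := hcl t₁ h₁ r₁ hr₁
  have e2 := hcl t₂ h₂ r₂ hr₂
  by_cases h : z r₂ - z r₁ ∈ C
  · simp [indicator, e1, e2, h]
  · simp [indicator, e1, e2, h]

/-- The reflection `C ↦ μ(-C)` of a signed measure. -/
def reflect {d : ℕ} (μ : SignedMeasure (RSpace d)) : SignedMeasure (RSpace d) :=
  μ.map fun x => -x

/-- A (finite) signed measure as a tempered distribution, `φ ↦ ∫ φ dμ⁺ - ∫ φ dμ⁻`. -/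
def toDistribution {d : ℕ} (μ : SignedMeasure (RSpace d)) : 𝓢'(RSpace d, ℂ) :=
  μ.toJordanDecomposition.posPart.toTemperedDistribution -
    μ.toJordanDecomposition.negPart.toTemperedDistribution

/-! ### Hölder spaces -/

/-- The `C^γ([0,T])` norm, supremum norm plus Hölder seminorm. -/
def holderNorm {d : ℕ} (T γ : ℝ) (f : ℝ → RSpace d) : ℝ≥0∞ :=
  (⨆ t ∈ Icc 0 T, ‖f t‖ₑ) +
    ⨆ s ∈ Icc 0 T, ⨆ t ∈ Icc 0 T, ⨆ _ : s ≠ t, ‖f t - f s‖ₑ / ENNReal.ofReal (|t - s| ^ γ)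

/-- The rectangular increment of `f` over `[s₁,t₁] × [s₂,t₂]`. -/
def box {V : Type*} [AddCommGroup V] (f : ℝ → ℝ → V) (s₁ s₂ t₁ t₂ : ℝ) : V :=
  f t₁ t₂ - f t₁ s₂ - f s₁ t₂ + f s₁ s₂

/-- Membership in the two-parameter space `C^γ([0,T]²; B)`, where `B` is the space of all `v` with
`N v < ∞`, normed by `N`: the functions that are bounded, `γ`-Hölder continuous in either
parameter and have rectangular increments of order `γ` in both parameters jointly. -/
def TwoParamHolder {V : Type*} [AddCommGroup V] (N : V → ℝ≥0∞) (T γ : ℝ) (f : ℝ → ℝ → V) : Prop :=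
  ∃ C : ℝ≥0, ∀ s₁ ∈ Icc 0 T, ∀ t₁ ∈ Icc 0 T, ∀ s₂ ∈ Icc 0 T, ∀ t₂ ∈ Icc 0 T,
    N (f s₁ s₂) ≤ C ∧
    N (f t₁ s₂ - f s₁ s₂) ≤ C * ENNReal.ofReal (|t₁ - s₁| ^ γ) ∧
    N (f s₁ t₂ - f s₁ s₂) ≤ C * ENNReal.ofReal (|t₂ - s₂| ^ γ) ∧
    N (box f s₁ s₂ t₁ t₂) ≤ C * ENNReal.ofReal (|t₁ - s₁| ^ γ * |t₂ - s₂| ^ γ)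

open Classical in
/-- The norm of the Hölder-Zygmund space `𝒞^{1+κ}(ℝ^d) = C_b^{1+κ}(ℝ^d)`, `0 < κ < 1`: bounded
`C¹` functions with bounded and `κ`-Hölder continuous derivative. -/
def spatialNorm {d : ℕ} (κ : ℝ) (f : RSpace d → RSpace d) : ℝ≥0∞ :=
  if ContDiff ℝ 1 f then
    (⨆ x, ‖f x‖ₑ) + (⨆ x, ‖fderiv ℝ f x‖ₑ) +
      ⨆ x, ⨆ y, ⨆ _ : x ≠ y, ‖fderiv ℝ f x - fderiv ℝ f y‖ₑ / ENNReal.ofReal (‖x - y‖ ^ κ)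
  else ∞

/-! ### Nonlinear Young integration -/

/-- `a 0 ≤ a 1 ≤ … ≤ a m` is a partition of `[0,t]`. -/
def IsPartition (t : ℝ) (m : ℕ) (a : ℕ → ℝ) : Prop :=
  a 0 = 0 ∧ a m = t ∧ ∀ i < m, a i ≤ a (i + 1)

/-- The Riemann sum `∑ □_{u,v} A(·, θ_{u₂} - θ_{u₁})` over the rectangles `[u,v]` of the grid that
is spanned by the points `a 0, …, a m` and `c 0, …, c n`. -/
def riemannSum {d : ℕ} (A : ℝ → ℝ → RSpace d → RSpace d) (θ : ℝ → RSpace d)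
    (m n : ℕ) (a c : ℕ → ℝ) : RSpace d :=
  ∑ i ∈ Finset.range m, ∑ j ∈ Finset.range n,
    box A (a i) (c j) (a (i + 1)) (c (j + 1)) (θ (c j) - θ (a i))

/-- The nonlinear Young integral `∫_0^{t₂} ∫_0^{t₁} A(dr, θ_{r₂} - θ_{r₁})` exists, as the limit of
the Riemann sums over the grid partitions of `[0,t₁] × [0,t₂]` as the mesh tends to `0`, and is
equal to `I`. -/
def HasYoungIntegral {d : ℕ} (A : ℝ → ℝ → RSpace d → RSpace d) (θ : ℝ → RSpace d)
    (t₁ t₂ : ℝ) (I : RSpace d) : Prop :=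
  ∀ ε > 0, ∃ η > 0, ∀ (m n : ℕ) (a c : ℕ → ℝ), IsPartition t₁ m a → IsPartition t₂ n c →
    (∀ i < m, a (i + 1) - a i < η) → (∀ j < n, c (j + 1) - c j < η) →
    ‖riemannSum A θ m n a c - I‖ < ε

/-! ### The self-interacting equation -/

/-- The two-parameter family of vector fields `A^b(t₁,t₂,θ) = (b ∗ Ḡ_{t₁,t₂})(θ)`, where `Ḡ` is the
reflected self-intersection measure (for an `ℝ^d`-valued `b` this convolution is
`ℝ^d`-valued). -/
def averagedField {d : ℕ} (T : ℝ) (w : ℝ → ℝ) (z : ℝ → RSpace d) (b : 𝓢'(RSpace d, CSpace d))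
    (t₁ t₂ : ℝ) (θ : RSpace d) : RSpace d :=
  realPart (convolution b (toDistribution (reflect (selfIntersectionMeasure T w z t₁ t₂))) θ)

/-- `u` is a solution on `[0,T]` of
`u_t = u₀ + ∫_0^t ∫_0^t w_s w_r b(u_s - u_r) dr ds + z_t` for a distributional drift `b`: the field
`A^b` is regular enough for nonlinear Young integration, `θ = u - z` is `γ`-Hölder continuous, and
`θ_t = u₀ + ∫_0^t ∫_0^t A^b(dr, θ_{r₂} - θ_{r₁})`. -/
structure IsSolution {d : ℕ} (T γ : ℝ) (w : ℝ → ℝ) (z : ℝ → RSpace d)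
    (b : 𝓢'(RSpace d, CSpace d)) (u₀ : RSpace d) (u : ℝ → RSpace d) : Prop where
  regular : ∃ κ : ℝ, 0 < κ ∧ κ < 1 ∧ 1 < γ * (1 + κ) ∧
    TwoParamHolder (spatialNorm κ) T γ (averagedField T w z b)
  holder : holderNorm T γ (u - z) < ∞
  equation : ∀ t ∈ Icc 0 T,
    HasYoungIntegral (averagedField T w z b) (u - z) t t (u t - z t - u₀)

/-- `u` is a continuous solution on `[0,T]`, in the classical sense, of
`u_t = u₀ + ∫_0^t ∫_0^t w_s w_r b(u_s - u_r) dr ds + z_t`, for a vector field `b`. -/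
structure IsClassicalSolution {d : ℕ} (T : ℝ) (w : ℝ → ℝ) (z : ℝ → RSpace d)
    (b : RSpace d → RSpace d) (u₀ : RSpace d) (u : ℝ → RSpace d) : Prop where
  continuousOn : ContinuousOn u (Icc 0 T)
  equation : ∀ t ∈ Icc 0 T,
    u t = u₀ + (∫ s in (0 : ℝ)..t, ∫ r in (0 : ℝ)..t, (w s * w r) • b (u s - u r)) + z t

end

end SelfInteraction

open SelfInteraction

namespace SelfInteraction

/-! ### Characters -/

section Characters

variable {d : ℕ}

/-! The two-parameter problem factorizes on the Fourier side. Let `h` be the Fourier transform of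
`b` and let f_t(ξ) = ∫_0^t w_r exp(2πi⟨ξ, z_r⟩) dr (`waveInt`). The reflected self-intersection
measure has Fourier transform conj(f_{t₁}) f_{t₂}, so a rectangular increment of G over a square on
the diagonal has Fourier transform |f_t - f_s|². Hölder's inequality with exponents q, q' then
converts the hypotheses on G and b into a one-parameter statement: t ↦ f_t is γ-Hölder with values
in L²(⟨ξ⟩^{1+2a} |h| dξ), for some a < 1 with γ(1+a) > 1. This is `IsDriver`, obtained in
`isDriver_of_flNorm_le`; the square of its constant is linear in the norm of b.

For a perturbed path z + θ the oscillatory integral is F_t = ∫_0^t exp(2πi⟨ξ, θ_r⟩) df_r, a Young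
integral with values in a weighted L² space. It exists classically for each ξ, so sewing only has to
supply bounds (`wnorm_sum_sub_le`, `wnorm_young_le`). A γ-Hölder path θ makes the amplitude
γa-Hölder at the price of ⟨ξ⟩^a, so F is controlled with weight exponent 1/2. The amplitude of a
difference of two such integrals costs one further power of ⟨ξ⟩, so the difference is controlled
with exponent -1/2. The interaction term is Re ∫ conj(F_t) F_t h dξ (`selfInt`), and Cauchy-Schwarz
pairs the exponents -1/2 and 1/2: this is exactly what makes the fixed point map Lipschitz
(`IsDriver.norm_selfInt_diff_sub_le`).

Paths are measured at a time scale τ, with Hölder constant τ^{-γ} on intervals of length at most τ.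
With n = T/τ windows the contraction factor is of order n τ^{2γ} = T τ^{2γ-1}, which is small
because γ > 1/2. The interaction has memory over all of [0,t], so estimates are propagated window by
window, which gives existence by Picard iteration (`IsDriver.exists_isFixedPath`) and stability
(`IsDriver.closeAtScale`). Uniqueness is stability with equal data, since every γ-Hölder path
belongs to the class at a small enough scale.

It remains to identify fixed points with solutions. Riemann sums of the nonlinear Young integral are
pairings of one-parameter Riemann sums, hence converge to the pairing of the limits
(`IsDriver.hasYoungIntegral`). For a Lipschitz drift the classical double integral equals the
Fourier-side expression (`integral_lipschitz_eq_selfInt`). -/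

theorem one_le_japaneseBracket (ξ : RSpace d) : 1 ≤ japaneseBracket ξ := by
  unfold japaneseBracket
  exact Real.one_le_sqrt.2 (by nlinarith [sq_nonneg ‖ξ‖])

theorem japaneseBracket_pos (ξ : RSpace d) : 0 < japaneseBracket ξ :=
  zero_lt_one.trans_le (one_le_japaneseBracket ξ)

theorem norm_le_japaneseBracket (ξ : RSpace d) : ‖ξ‖ ≤ japaneseBracket ξ :=
  Real.le_sqrt_of_sq_le (by linarith)

theorem continuous_japaneseBracket : Continuous (japaneseBracket : RSpace d → ℝ) := by
  unfold japaneseBracket; fun_prop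

theorem continuous_japaneseBracket_rpow (σ : ℝ) :
    Continuous fun ξ : RSpace d => japaneseBracket ξ ^ σ :=
  continuous_japaneseBracket.rpow_const fun ξ => Or.inl (japaneseBracket_pos ξ).ne'

/-- The plane wave `exp(2πi⟨ξ, x⟩)`. -/
noncomputable def wave (ξ x : RSpace d) : ℂ := Real.fourierChar (inner ℝ ξ x)

theorem wave_eq_exp (ξ x : RSpace d) :
    wave ξ x = Complex.exp (Complex.I * ((2 * Real.pi * inner ℝ ξ x : ℝ) : ℂ)) := by
  rw [wave, Real.fourierChar_apply, mul_comm]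

@[simp] theorem norm_wave (ξ x : RSpace d) : ‖wave ξ x‖ = 1 := Circle.norm_coe _

@[simp] theorem wave_zero (ξ : RSpace d) : wave ξ 0 = 1 := by simp [wave]

theorem wave_add (ξ x y : RSpace d) : wave ξ (x + y) = wave ξ x * wave ξ y := by
  simp [wave, inner_add_right, AddChar.map_add_eq_mul]

theorem wave_neg (ξ x : RSpace d) : wave ξ (-x) = starRingEnd ℂ (wave ξ x) := by
  simp [wave, AddChar.map_neg_eq_inv]

theorem wave_sub (ξ x y : RSpace d) :
    wave ξ (x - y) = wave ξ x * starRingEnd ℂ (wave ξ y) := by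
  rw [sub_eq_add_neg, wave_add, wave_neg]

theorem continuous_wave : Continuous fun p : RSpace d × RSpace d => wave p.1 p.2 := by
  unfold wave; fun_prop

theorem norm_wave_sub_one_le (ξ x : RSpace d) : ‖wave ξ x - 1‖ ≤ 2 * Real.pi * (‖ξ‖ * ‖x‖) := by
  rw [wave_eq_exp]
  refine Real.norm_exp_I_mul_ofReal_sub_one_le.trans ?_
  rw [Real.norm_eq_abs, abs_mul, abs_of_pos Real.two_pi_pos]
  gcongr
  exact abs_real_inner_le_norm ξ x

theorem norm_wave_sub_wave (ξ x y : RSpace d) : ‖wave ξ x - wave ξ y‖ = ‖wave ξ (x - y) - 1‖ := by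
  have h : wave ξ x - wave ξ y = (wave ξ (x - y) - 1) * wave ξ y := by
    rw [sub_mul, ← wave_add, sub_add_cancel, one_mul]
  rw [h, norm_mul, norm_wave, mul_one]

theorem norm_wave_sub_wave_le (ξ x y : RSpace d) :
    ‖wave ξ x - wave ξ y‖ ≤ 2 * Real.pi * (japaneseBracket ξ * ‖x - y‖) := by
  rw [norm_wave_sub_wave]
  refine (norm_wave_sub_one_le ξ _).trans ?_
  gcongr
  exact norm_le_japaneseBracket ξ

/-- Interpolation between the Lipschitz bound, used when ⟨ξ⟩‖x - y‖ ≤ 1, and the trivial bound 2. -/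
theorem norm_wave_sub_wave_le_rpow {a : ℝ} (ha : 0 ≤ a) (ha' : a ≤ 1) (ξ x y : RSpace d) :
    ‖wave ξ x - wave ξ y‖ ≤ 2 * Real.pi * (japaneseBracket ξ ^ a * ‖x - y‖ ^ a) := by
  have hJ := japaneseBracket_pos ξ
  rw [← Real.mul_rpow hJ.le (norm_nonneg _)]
  set v := japaneseBracket ξ * ‖x - y‖ with hv
  have hv0 : 0 ≤ v := by positivity
  rcases le_total v 1 with h | h
  · refine (norm_wave_sub_wave_le ξ x y).trans ?_
    gcongr
    rw [← hv]
    rcases hv0.eq_or_lt with h0 | h0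
    · rw [← h0]; positivity
    · simpa using Real.rpow_le_rpow_of_exponent_ge h0 h ha'
  · refine (norm_sub_le _ _).trans ?_
    rw [norm_wave, norm_wave]
    nlinarith [Real.one_le_rpow h ha, Real.pi_gt_three]

/-- Writing each wave difference as wave ξ y · (wave ξ (x - y) - 1) separates the movement of the
base point y, which is interpolated and costs ⟨ξ⟩^a, from the movement of x - y, which is estimated
linearly. Only the increment of y enters with the power a. -/
theorem norm_wave_double_sub_le {a : ℝ} (ha : 0 ≤ a) (ha' : a ≤ 1) (ξ x₀ y₀ x₁ y₁ : RSpace d) :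
    ‖(wave ξ x₁ - wave ξ y₁) - (wave ξ x₀ - wave ξ y₀)‖ ≤
      2 * Real.pi * japaneseBracket ξ ^ (1 + a) *
        (2 * Real.pi * ‖y₁ - y₀‖ ^ a * ‖x₁ - y₁‖ + ‖(x₁ - y₁) - (x₀ - y₀)‖) := by
  have hJ := japaneseBracket_pos ξ
  have e : (wave ξ x₁ - wave ξ y₁) - (wave ξ x₀ - wave ξ y₀) =
      (wave ξ y₁ - wave ξ y₀) * (wave ξ (x₁ - y₁) - wave ξ 0) +
        wave ξ y₀ * (wave ξ (x₁ - y₁) - wave ξ (x₀ - y₀)) := by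
    have h1 : wave ξ x₁ = wave ξ y₁ * wave ξ (x₁ - y₁) := by rw [← wave_add]; simp
    have h0 : wave ξ x₀ = wave ξ y₀ * wave ξ (x₀ - y₀) := by rw [← wave_add]; simp
    rw [h1, h0, wave_zero]; ring
  have hpow : japaneseBracket ξ ^ (1 + a) = japaneseBracket ξ * japaneseBracket ξ ^ a := by
    rw [Real.rpow_add hJ, Real.rpow_one]
  have hge : japaneseBracket ξ ≤ japaneseBracket ξ ^ (1 + a) := by
    simpa using Real.rpow_le_rpow_of_exponent_le (one_le_japaneseBracket ξ) (by linarith : 1 ≤ 1 + a)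
  rw [e]
  refine (norm_add_le _ _).trans ?_
  rw [norm_mul, norm_mul, norm_wave, one_mul]
  have b1 := norm_wave_sub_wave_le_rpow ha ha' ξ y₁ y₀
  have b2 := norm_wave_sub_wave_le ξ (x₁ - y₁) 0
  have b3 := norm_wave_sub_wave_le ξ (x₁ - y₁) (x₀ - y₀)
  rw [sub_zero] at b2
  calc _ ≤ (2 * Real.pi * (japaneseBracket ξ ^ a * ‖y₁ - y₀‖ ^ a)) *
        (2 * Real.pi * (japaneseBracket ξ * ‖x₁ - y₁‖)) +
        2 * Real.pi * (japaneseBracket ξ ^ (1 + a) * ‖(x₁ - y₁) - (x₀ - y₀)‖) := by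
          refine add_le_add (mul_le_mul b1 b2 (norm_nonneg _) (by positivity)) (b3.trans ?_)
          gcongr
    _ = _ := by rw [hpow]; ring

end Characters

/-! ### Weighted square norms -/

section WeightedNorm

variable {d : ℕ} {ν : Measure (RSpace d)}

/-- The norm `‖⟨·⟩^σ F‖_{L²(ν)}`. -/
noncomputable def wnorm (ν : Measure (RSpace d)) (σ : ℝ) (F : RSpace d → ℂ) : ℝ≥0∞ :=
  eLpNorm (fun ξ => japaneseBracket ξ ^ σ • F ξ) 2 ν

theorem continuous_weight_smul {F : RSpace d → ℂ} (hF : Continuous F) (σ : ℝ) :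
    Continuous fun ξ => japaneseBracket ξ ^ σ • F ξ :=
  (continuous_japaneseBracket_rpow σ).smul hF

theorem wnorm_add_le {F G : RSpace d → ℂ} (hF : Continuous F) (hG : Continuous G) (σ : ℝ) :
    wnorm ν σ (F + G) ≤ wnorm ν σ F + wnorm ν σ G := by
  have := eLpNorm_add_le (μ := ν) (p := 2)
    (continuous_weight_smul hF σ).aestronglyMeasurable
    (continuous_weight_smul hG σ).aestronglyMeasurable (by norm_num)
  simpa [wnorm, Pi.add_def, smul_add] using this

theorem wnorm_sub_le {F G : RSpace d → ℂ} (hF : Continuous F) (hG : Continuous G) (σ : ℝ) :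
    wnorm ν σ (F - G) ≤ wnorm ν σ F + wnorm ν σ G := by
  have := eLpNorm_sub_le (μ := ν) (p := 2)
    (continuous_weight_smul hF σ).aestronglyMeasurable
    (continuous_weight_smul hG σ).aestronglyMeasurable (by norm_num)
  simpa [wnorm, Pi.sub_def, smul_sub] using this

@[simp] theorem wnorm_zero (σ : ℝ) : wnorm ν σ 0 = 0 := by simp [wnorm]

theorem continuous_sum_fun {ι : Type*} {s : Finset ι} {F : ι → RSpace d → ℂ}
    (hF : ∀ i ∈ s, Continuous (F i)) : Continuous (∑ i ∈ s, F i) := by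
  have : (∑ i ∈ s, F i) = fun ξ => ∑ i ∈ s, F i ξ := by ext; simp
  rw [this]
  exact continuous_finsetSum _ hF

theorem wnorm_sum_le {ι : Type*} (s : Finset ι) {F : ι → RSpace d → ℂ}
    (hF : ∀ i ∈ s, Continuous (F i)) (σ : ℝ) :
    wnorm ν σ (∑ i ∈ s, F i) ≤ ∑ i ∈ s, wnorm ν σ (F i) := by
  classical
  induction s using Finset.induction_on with
  | empty => simp
  | insert i s hi ih =>
    rw [Finset.sum_insert hi, Finset.sum_insert hi]
    have hs : ∀ j ∈ s, Continuous (F j) := fun j hj => hF j (Finset.mem_insert_of_mem hj)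
    exact (wnorm_add_le (hF i (Finset.mem_insert_self i s)) (continuous_sum_fun hs) σ).trans
      (add_le_add le_rfl (ih hs))

/-- The accounting rule for weights: a multiplier of order ρ costs ρ units of the weight exponent.
-/
theorem wnorm_le_of_norm_le {F G : RSpace d → ℂ} {σ ρ c : ℝ}
    (h : ∀ ξ, ‖F ξ‖ ≤ c * japaneseBracket ξ ^ ρ * ‖G ξ‖) :
    wnorm ν σ F ≤ ENNReal.ofReal c * wnorm ν (σ + ρ) G := by
  refine eLpNorm_le_mul_eLpNorm_of_ae_le_mul (Eventually.of_forall fun ξ => ?_) 2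
  have hJ := japaneseBracket_pos ξ
  have hn : ∀ r : ℝ, ‖japaneseBracket ξ ^ r‖ = japaneseBracket ξ ^ r := fun r =>
    Real.norm_of_nonneg (Real.rpow_nonneg hJ.le r)
  rw [norm_smul, norm_smul, hn, hn, Real.rpow_add hJ]
  calc _ ≤ japaneseBracket ξ ^ σ * (c * japaneseBracket ξ ^ ρ * ‖G ξ‖) := by
        gcongr; exact h ξ
    _ = _ := by ring

theorem wnorm_mono {F : RSpace d → ℂ} {σ ρ : ℝ} (h : σ ≤ ρ) : wnorm ν σ F ≤ wnorm ν ρ F := by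
  have := wnorm_le_of_norm_le (ν := ν) (F := F) (G := F) (σ := σ) (ρ := ρ - σ) (c := 1) fun ξ => by
    rw [one_mul]
    exact le_mul_of_one_le_left (norm_nonneg _)
      (Real.one_le_rpow (one_le_japaneseBracket ξ) (by linarith))
  simpa using this

/-- Cauchy-Schwarz with opposite weights. -/
theorem lintegral_enorm_mul_le {F G : RSpace d → ℂ} (hF : Continuous F) (hG : Continuous G)
    (σ : ℝ) : ∫⁻ ξ, ‖F ξ‖ₑ * ‖G ξ‖ₑ ∂ν ≤ wnorm ν (-σ) F * wnorm ν σ G := by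
  have h := eLpNorm_smul_le_mul_eLpNorm (μ := ν) (p := 2) (q := 2) (r := 1)
    (continuous_weight_smul hG σ).aestronglyMeasurable
    (continuous_weight_smul hF (-σ)).aestronglyMeasurable
  rw [eLpNorm_one_eq_lintegral_enorm] at h
  refine le_trans (lintegral_mono fun ξ => ?_) h
  have hJ := japaneseBracket_pos ξ
  rw [← enorm_mul]
  apply le_of_eq
  congr 1
  simp only [Pi.smul_apply', smul_eq_mul, Complex.real_smul]
  have : ((japaneseBracket ξ ^ (-σ) : ℝ) : ℂ) * ((japaneseBracket ξ ^ σ : ℝ) : ℂ) = 1 := by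
    rw [← Complex.ofReal_mul, ← Real.rpow_add hJ]; simp
  linear_combination (-F ξ * G ξ) * this

/-- Fatou's lemma. Uniform bounds on Riemann sums pass to their pointwise limits without any
convergence in norm. -/
theorem wnorm_le_of_tendsto {F : ℕ → RSpace d → ℂ} {G : RSpace d → ℂ} {σ : ℝ} {c : ℝ≥0∞}
    (hF : ∀ n, Continuous (F n)) (hlim : ∀ ξ, Tendsto (fun n => F n ξ) atTop (𝓝 (G ξ)))
    (hc : ∀ᶠ n in atTop, wnorm ν σ (F n) ≤ c) : wnorm ν σ G ≤ c := by
  refine (Lp.eLpNorm_lim_le_liminf_eLpNorm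
    (fun n => (continuous_weight_smul (hF n) σ).aestronglyMeasurable) _
    (Eventually.of_forall fun ξ => (hlim ξ).const_smul _)).trans ?_
  exact liminf_le_of_frequently_le' hc.frequently

end WeightedNorm

/-! ### Discrete sewing -/

section Sewing

variable {d : ℕ} {ν : Measure (RSpace d)}

/-- The constant of the sewing lemma of exponent `β`. -/
noncomputable def sewConst (β : ℝ) : ℝ := 2 / (1 - 2 ^ (1 - β))

theorem sewConst_denom_pos {β : ℝ} (hβ : 1 < β) : 0 < 1 - (2 : ℝ) ^ (1 - β) :=
  sub_pos.2 (Real.rpow_lt_one_of_one_lt_of_neg (by norm_num) (by linarith))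

theorem sewConst_pos {β : ℝ} (hβ : 1 < β) : 0 < sewConst β :=
  div_pos two_pos (sewConst_denom_pos hβ)

/-- The recursion of the bisection: two defects on the whole interval plus two subintervals of at
most half the length. It determines `sewConst`. -/
theorem sewConst_eq {β : ℝ} (hβ : 1 < β) (x : ℝ) (hx : 0 ≤ x) :
    2 * x ^ β + 2 * (sewConst β * (x / 2) ^ β) = sewConst β * x ^ β := by
  have h := (sewConst_denom_pos hβ).ne'
  have e : (2 : ℝ) ^ (1 - β) = 2 / 2 ^ β := by
    rw [Real.rpow_sub two_pos, Real.rpow_one]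
  have h2 : (0 : ℝ) < 2 ^ β := by positivity
  rw [Real.div_rpow hx two_pos.le]
  unfold sewConst
  rw [e] at h ⊢
  have h3 : (2 : ℝ) ^ β - 2 ≠ 0 := fun h0 => h (by rw [sub_eq_zero.1 h0, div_self two_ne_zero, sub_self])
  field_simp
  ring

/-- Discrete sewing: Riemann sums of a two-point function with small defect stay close to its value
on the whole interval. -/
theorem wnorm_sum_sub_le {Ξ : ℝ → ℝ → RSpace d → ℂ} {σ β M p q : ℝ} (hβ : 1 < β) (hM : 0 ≤ M)
    (hcont : ∀ s ∈ Icc p q, ∀ t ∈ Icc p q, Continuous (Ξ s t)) (hdiag : ∀ s, Ξ s s = 0)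
    (hdef : ∀ s u t, p ≤ s → s ≤ u → u ≤ t → t ≤ q →
      wnorm ν σ (Ξ s u + Ξ u t - Ξ s t) ≤ ENNReal.ofReal (M * (t - s) ^ β))
    {c : ℕ → ℝ} (hc : Monotone c) (hp : p ≤ c 0) :
    ∀ (n i j : ℕ), j = i + n → c j ≤ q →
      wnorm ν σ (∑ k ∈ Finset.Ico i j, Ξ (c k) (c (k + 1)) - Ξ (c i) (c j)) ≤
        ENNReal.ofReal (sewConst β * M * (c j - c i) ^ β) := by
  have hC := sewConst_pos hβ
  have hmem : ∀ i, c i ≤ q → c i ∈ Icc p q := fun i hi => ⟨hp.trans (hc (Nat.zero_le _)), hi⟩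
  intro n
  induction n using Nat.strong_induction_on with
  | _ n ih =>
  intro i j hj hq
  rcases Nat.eq_zero_or_pos n with rfl | hn
  · obtain rfl : j = i := by omega
    simp [hdiag]
  -- the last index of the left half
  classical
  let k := Nat.findGreatest (fun k => c (i + k) - c i ≤ (c j - c i) / 2) (n - 1)
  have hij : c i ≤ c j := hc (by omega)
  have hkP : c (i + k) - c i ≤ (c j - c i) / 2 :=
    Nat.findGreatest_spec (P := fun k => c (i + k) - c i ≤ (c j - c i) / 2) (Nat.zero_le _)
      (by simp; linarith)
  have hkn : k ≤ n - 1 := Nat.findGreatest_le _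
  have hk' : c j - c (i + k + 1) ≤ (c j - c i) / 2 := by
    rcases eq_or_lt_of_le hkn with h | h
    · have : i + k + 1 = j := by omega
      rw [this]; linarith
    · have := Nat.findGreatest_is_greatest (P := fun k => c (i + k) - c i ≤ (c j - c i) / 2)
        (n := n - 1) (k := k + 1) (Nat.lt_succ_self _) (by omega)
      rw [← add_assoc] at this
      linarith [not_le.1 this]
  set l := i + k with hl
  have m1 : c i ≤ c l := hc (by omega)
  have m2 : c l ≤ c (l + 1) := hc (by omega)
  have m3 : c (l + 1) ≤ c j := hc (by omega)
  have hpi : p ≤ c i := hp.trans (hc (Nat.zero_le _))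
  -- The single cell from l to l + 1 containing the midpoint is split off, so that both remaining
  -- pieces have at most half the length. Joining the three pieces produces exactly two defects.
  have e : ∑ k ∈ Finset.Ico i j, Ξ (c k) (c (k + 1)) - Ξ (c i) (c j) =
      ((∑ k ∈ Finset.Ico i l, Ξ (c k) (c (k + 1)) - Ξ (c i) (c l)) +
        (∑ k ∈ Finset.Ico (l + 1) j, Ξ (c k) (c (k + 1)) - Ξ (c (l + 1)) (c j))) +
      ((Ξ (c i) (c l) + Ξ (c l) (c j) - Ξ (c i) (c j)) +
        (Ξ (c l) (c (l + 1)) + Ξ (c (l + 1)) (c j) - Ξ (c l) (c j))) := by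
    rw [← Finset.sum_Ico_consecutive _ (by omega : i ≤ l) (by omega : l ≤ j),
      Finset.sum_eq_sum_Ico_succ_bot (by omega : l < j)]
    abel
  have hle : ∀ k, k ≤ j → c k ∈ Icc p q := fun k hk => hmem k ((hc hk).trans hq)
  have c1 : ∀ a b, a ≤ b → b ≤ j →
      Continuous (∑ k ∈ Finset.Ico a b, Ξ (c k) (c (k + 1)) - Ξ (c a) (c b)) :=
    fun a b hab hb => (continuous_sum_fun fun k hk =>
      hcont _ (hle _ (by have := Finset.mem_Ico.1 hk; omega)) _
        (hle _ (by have := Finset.mem_Ico.1 hk; omega))).sub (hcont _ (hle _ (by omega)) _ (hle _ hb))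
  have c2 : ∀ x y z, x ≤ j → y ≤ j → z ≤ j →
      Continuous (Ξ (c x) (c y) + Ξ (c y) (c z) - Ξ (c x) (c z)) := fun x y z hx hy hz =>
    ((hcont _ (hle x hx) _ (hle y hy)).add (hcont _ (hle y hy) _ (hle z hz))).sub
      (hcont _ (hle x hx) _ (hle z hz))
  have d1 := c1 i l (by omega) (by omega)
  have d2 := c1 (l + 1) j (by omega) le_rfl
  have d3 := c2 i l j (by omega) (by omega) le_rfl
  have d4 := c2 l (l + 1) j (by omega) (by omega) le_rfl
  have b1 := ih k (by omega) i l hl (by linarith)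
  have b2 := ih (j - (l + 1)) (by omega) (l + 1) j (by omega) hq
  have b3 := hdef (c i) (c l) (c j) hpi m1 (m2.trans m3) hq
  have b4 := hdef (c l) (c (l + 1)) (c j) (hpi.trans m1) m2 m3 hq
  have hβ0 : 0 ≤ β := by linarith
  have hx : 0 ≤ c j - c i := by linarith
  rw [e]
  calc _ ≤ (wnorm ν σ (∑ k ∈ Finset.Ico i l, Ξ (c k) (c (k + 1)) - Ξ (c i) (c l)) +
        wnorm ν σ (∑ k ∈ Finset.Ico (l + 1) j, Ξ (c k) (c (k + 1)) - Ξ (c (l + 1)) (c j))) +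
      (wnorm ν σ (Ξ (c i) (c l) + Ξ (c l) (c j) - Ξ (c i) (c j)) +
        wnorm ν σ (Ξ (c l) (c (l + 1)) + Ξ (c (l + 1)) (c j) - Ξ (c l) (c j))) := by
        exact (wnorm_add_le (d1.add d2) (d3.add d4) σ).trans
          (add_le_add (wnorm_add_le d1 d2 σ) (wnorm_add_le d3 d4 σ))
    _ ≤ (ENNReal.ofReal (sewConst β * M * ((c j - c i) / 2) ^ β) +
          ENNReal.ofReal (sewConst β * M * ((c j - c i) / 2) ^ β)) +
        (ENNReal.ofReal (M * (c j - c i) ^ β) + ENNReal.ofReal (M * (c j - c i) ^ β)) := by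
        gcongr
        · refine b1.trans (ENNReal.ofReal_le_ofReal ?_)
          gcongr
        · refine b2.trans (ENNReal.ofReal_le_ofReal ?_)
          gcongr
        · refine b4.trans (ENNReal.ofReal_le_ofReal ?_)
          gcongr; linarith
    _ = ENNReal.ofReal (sewConst β * M * (c j - c i) ^ β) := by
        rw [← ENNReal.ofReal_add (by positivity) (by positivity),
          ← ENNReal.ofReal_add (by positivity) (by positivity),
          ← ENNReal.ofReal_add (by positivity) (by positivity)]
        congr 1
        linear_combination M * sewConst_eq hβ (c j - c i) hx

end Sewing

/-! ### Oscillatory integrals along paths -/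

section WaveInt

variable {d : ℕ} {T : ℝ} {w : ℝ → ℝ} {u z θ : ℝ → RSpace d}

/-- The oscillatory integral `∫_0^t w_r exp(2πi⟨ξ, u_r⟩) dr`. -/
noncomputable def waveInt (w : ℝ → ℝ) (u : ℝ → RSpace d) (t : ℝ) (ξ : RSpace d) : ℂ :=
  ∫ r in (0 : ℝ)..t, (w r : ℂ) * wave ξ (u r)

theorem continuousOn_wave (hu : ContinuousOn u (Icc 0 T)) (ξ : RSpace d) :
    ContinuousOn (fun r => wave ξ (u r)) (Icc 0 T) := by
  have h : Continuous fun x => wave ξ x := continuous_wave.comp (continuous_const.prodMk continuous_id)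
  exact h.comp_continuousOn hu

theorem intervalIntegrable_ofReal_of_mem (hw : IntervalIntegrable w volume 0 T) {s t : ℝ}
    (hs : s ∈ Icc 0 T) (ht : t ∈ Icc 0 T) :
    IntervalIntegrable (fun r => (w r : ℂ)) volume s t := by
  have hT : (0 : ℝ) ≤ T := hs.1.trans hs.2
  have hw' : IntervalIntegrable (fun r => (w r : ℂ)) volume 0 T :=
    ⟨hw.1.ofReal, hw.2.ofReal⟩
  refine hw'.mono_set ?_
  rw [uIcc_of_le hT]
  exact uIcc_subset_Icc hs ht

theorem intervalIntegrable_wave (hw : IntervalIntegrable w volume 0 T)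
    (hu : ContinuousOn u (Icc 0 T)) {s t : ℝ} (hs : s ∈ Icc 0 T) (ht : t ∈ Icc 0 T)
    (ξ : RSpace d) : IntervalIntegrable (fun r => (w r : ℂ) * wave ξ (u r)) volume s t :=
  (intervalIntegrable_ofReal_of_mem hw hs ht).mul_continuousOn
    ((continuousOn_wave hu ξ).mono (uIcc_subset_Icc hs ht))

theorem zero_mem_Icc_of_mem {t : ℝ} (ht : t ∈ Icc 0 T) : (0 : ℝ) ∈ Icc 0 T :=
  ⟨le_rfl, ht.1.trans ht.2⟩

theorem waveInt_sub (hw : IntervalIntegrable w volume 0 T)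
    (hu : ContinuousOn u (Icc 0 T)) {s t : ℝ} (hs : s ∈ Icc 0 T) (ht : t ∈ Icc 0 T)
    (ξ : RSpace d) :
    waveInt w u t ξ - waveInt w u s ξ = ∫ r in s..t, (w r : ℂ) * wave ξ (u r) :=
  intervalIntegral.integral_interval_sub_left
    (intervalIntegrable_wave hw hu (zero_mem_Icc_of_mem ht) ht ξ)
    (intervalIntegrable_wave hw hu (zero_mem_Icc_of_mem ht) hs ξ)

@[simp] theorem waveInt_zero : waveInt w u 0 = 0 := by
  ext ξ; simp [waveInt]

theorem continuous_waveInt (hw : IntervalIntegrable w volume 0 T)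
    (hu : ContinuousOn u (Icc 0 T)) {t : ℝ} (ht : t ∈ Icc 0 T) :
    Continuous (waveInt w u t) := by
  have h0 := zero_mem_Icc_of_mem ht
  refine intervalIntegral.continuous_of_dominated_interval (bound := fun r => ‖(w r : ℂ)‖)
    (fun ξ => ?_) (fun ξ => ?_) (intervalIntegrable_ofReal_of_mem hw h0 ht).norm ?_
  · exact (intervalIntegrable_wave hw hu h0 ht ξ).def'.aestronglyMeasurable
  · exact Eventually.of_forall fun r _ => by simp
  · exact Eventually.of_forall fun r _ =>
      continuous_const.mul (continuous_wave.comp (continuous_id.prodMk continuous_const))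

theorem wave_mul_waveInt_sub (ξ x : RSpace d) (hw : IntervalIntegrable w volume 0 T)
    (hu : ContinuousOn u (Icc 0 T)) {s t : ℝ} (hs : s ∈ Icc 0 T) (ht : t ∈ Icc 0 T) :
    wave ξ x * (waveInt w u t ξ - waveInt w u s ξ) =
      ∫ r in s..t, (w r : ℂ) * wave ξ (u r + x) := by
  rw [waveInt_sub hw hu hs ht, ← intervalIntegral.integral_const_mul]
  congr 1; ext r; rw [wave_add]; ring

/-- The `k`-th point of the uniform partition of `[p,q]` into `N` intervals. -/
noncomputable def gridPoint (p q : ℝ) (N k : ℕ) : ℝ := p + k * ((q - p) / N)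

theorem gridPoint_monotone {p q : ℝ} (h : p ≤ q) (N : ℕ) : Monotone (gridPoint p q N) := by
  intro i j hij
  have : 0 ≤ (q - p) / N := div_nonneg (by linarith) (Nat.cast_nonneg _)
  unfold gridPoint; gcongr

@[simp] theorem gridPoint_zero (p q : ℝ) (N : ℕ) : gridPoint p q N 0 = p := by simp [gridPoint]

theorem gridPoint_self (p q : ℝ) {N : ℕ} (hN : 0 < N) : gridPoint p q N N = q := by
  have : (N : ℝ) ≠ 0 := by positivity
  unfold gridPoint; field_simp; ring

theorem gridPoint_succ_sub (p q : ℝ) (N k : ℕ) :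
    gridPoint p q N (k + 1) - gridPoint p q N k = (q - p) / N := by
  unfold gridPoint; push_cast; ring

theorem gridPoint_mem {p q : ℝ} (h : p ≤ q) {N k : ℕ} (hk : k ≤ N) (hN : 0 < N) :
    gridPoint p q N k ∈ Icc p q :=
  ⟨by simpa using gridPoint_monotone h N (Nat.zero_le k),
    by simpa [gridPoint_self p q hN] using gridPoint_monotone h N hk⟩

/-- For fixed ξ this is an ordinary Riemann sum argument: `wave ξ ∘ θ` is uniformly continuous and
`w` is integrable. It identifies the Young integral of the waves along θ against `waveInt w z` with
the classical integral along z + θ, without any Hölder condition. -/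
theorem tendsto_riemann_wave (hw : IntervalIntegrable w volume 0 T)
    (hz : ContinuousOn z (Icc 0 T)) (hθ : ContinuousOn θ (Icc 0 T)) {p q : ℝ} (hpq : p ≤ q)
    (hp : p ∈ Icc 0 T) (hq : q ∈ Icc 0 T) (ξ : RSpace d) :
    Tendsto (fun N : ℕ => ∑ k ∈ Finset.range N, wave ξ (θ (gridPoint p q N k)) *
      (waveInt w z (gridPoint p q N (k + 1)) ξ - waveInt w z (gridPoint p q N k) ξ)) atTop
      (𝓝 (waveInt w (z + θ) q ξ - waveInt w (z + θ) p ξ)) := by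
  have hsub : Icc p q ⊆ Icc 0 T := Icc_subset_Icc hp.1 hq.2
  have hzθ : ContinuousOn (z + θ) (Icc 0 T) := hz.add hθ
  have huc : UniformContinuousOn (fun r => wave ξ (θ r)) (Icc 0 T) :=
    isCompact_Icc.uniformContinuousOn_of_continuous (continuousOn_wave hθ ξ)
  set I := ∫ r in p..q, ‖(w r : ℂ)‖ with hI
  have hwn := (intervalIntegrable_ofReal_of_mem hw hp hq).norm
  have hI0 : 0 ≤ I := intervalIntegral.integral_nonneg hpq fun r _ => norm_nonneg _
  rw [Metric.tendsto_atTop]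
  intro ε hε
  obtain ⟨δ, hδ, huc⟩ := Metric.uniformContinuousOn_iff.1 huc (ε / (I + 1)) (by positivity)
  obtain ⟨N₀, hN₀⟩ := exists_nat_gt ((q - p) / δ)
  refine ⟨N₀ + 1, fun N hN => ?_⟩
  have hNpos : 0 < N := by omega
  have hmesh : (q - p) / N < δ := by
    rw [div_lt_iff₀ (by positivity)]
    have h1 := (div_lt_iff₀ hδ).1 hN₀
    have : (N₀ : ℝ) ≤ N := by exact_mod_cast (by omega : N₀ ≤ N)
    nlinarith
  set c := gridPoint p q N with hcdef
  have hc := gridPoint_monotone hpq N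
  have hcm : ∀ k ≤ N, c k ∈ Icc p q := fun k hk => gridPoint_mem hpq hk hNpos
  have hint : ∀ k < N, IntervalIntegrable (fun r => (w r : ℂ) * wave ξ ((z + θ) r)) volume
      (c k) (c (k + 1)) := fun k hk =>
    intervalIntegrable_wave hw hzθ (hsub (hcm _ (by omega))) (hsub (hcm _ (by omega))) ξ
  have hintn : ∀ k < N, IntervalIntegrable (fun r => ‖(w r : ℂ)‖) volume
      (c k) (c (k + 1)) := fun k hk =>
    (intervalIntegrable_ofReal_of_mem hw (hsub (hcm _ (by omega))) (hsub (hcm _ (by omega)))).norm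
  have e1 : waveInt w (z + θ) q ξ - waveInt w (z + θ) p ξ =
      ∑ k ∈ Finset.range N, ∫ r in c k..c (k + 1), (w r : ℂ) * wave ξ ((z + θ) r) := by
    rw [intervalIntegral.sum_integral_adjacent_intervals hint, waveInt_sub hw hzθ hp hq]
    simp [hcdef, gridPoint_self p q hNpos]
  have e2 : I = ∑ k ∈ Finset.range N, ∫ r in c k..c (k + 1), ‖(w r : ℂ)‖ := by
    rw [intervalIntegral.sum_integral_adjacent_intervals hintn]
    simp [hcdef, gridPoint_self p q hNpos, hI]
  rw [dist_eq_norm, e1, ← Finset.sum_sub_distrib]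
  have hterm : ∀ k ∈ Finset.range N, ‖wave ξ (θ (c k)) *
      (waveInt w z (c (k + 1)) ξ - waveInt w z (c k) ξ) -
        ∫ r in c k..c (k + 1), (w r : ℂ) * wave ξ ((z + θ) r)‖ ≤
      ∫ r in c k..c (k + 1), ε / (I + 1) * ‖(w r : ℂ)‖ := by
    intro k hk
    have hk := Finset.mem_range.1 hk
    have hk0 := hcm k (by omega)
    have hk1 := hcm (k + 1) (by omega)
    have hkk : c k ≤ c (k + 1) := hc (Nat.le_succ k)
    have hz' : ContinuousOn (fun r => z r + θ (c k)) (Icc 0 T) := hz.add continuousOn_const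
    rw [wave_mul_waveInt_sub ξ _ hw hz (hsub hk0) (hsub hk1),
      ← intervalIntegral.integral_sub
        (intervalIntegrable_wave hw hz' (hsub hk0) (hsub hk1) ξ) (hint k hk)]
    refine intervalIntegral.norm_integral_le_of_norm_le hkk
      (Eventually.of_forall fun r hr => ?_) ((hintn k hk).const_mul _)
    have hr' : r ∈ Icc 0 T := hsub ⟨hk0.1.trans hr.1.le, hr.2.trans hk1.2⟩
    have hstep := gridPoint_succ_sub p q N k
    have hd := huc (c k) (hsub hk0) r hr' (by
      rw [Real.dist_eq, abs_sub_comm, abs_of_nonneg (by linarith [hr.1])]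
      have := hr.2
      rw [← hcdef] at hstep
      linarith)
    rw [dist_eq_norm] at hd
    have : (w r : ℂ) * wave ξ (z r + θ (c k)) - (w r : ℂ) * wave ξ ((z + θ) r) =
        (w r : ℂ) * (wave ξ (z r) * (wave ξ (θ (c k)) - wave ξ (θ r))) := by
      rw [Pi.add_apply, wave_add, wave_add]; ring
    rw [this, norm_mul, norm_mul, norm_wave, one_mul, mul_comm]
    gcongr
  refine (norm_sum_le _ _).trans_lt ((Finset.sum_le_sum hterm).trans_lt ?_)
  simp_rw [intervalIntegral.integral_const_mul]
  rw [← Finset.mul_sum, ← e2, div_mul_eq_mul_div, div_lt_iff₀ (by linarith)]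
  nlinarith

end WaveInt

/-! ### Sewing of amplitudes -/

section Young

variable {d : ℕ} {ν : Measure (RSpace d)}

/-- Estimates for the Young integral `F = ∫ P df`, where `f` is `γ`-Hölder continuous with values
in a weighted `L²` space and the amplitude `P` is bounded and Hölder continuous at scale `τ`. -/
theorem wnorm_young_remainder_le {f F P : ℝ → RSpace d → ℂ} {σ ρ a γ τ c m p q : ℝ} (hτ : 0 < τ)
    (ha : 0 ≤ a) (hγ : 0 ≤ γ) (hβ : 1 < γ * (1 + a)) (hc : 0 ≤ c) (hm : 0 ≤ m) (hpq : p ≤ q)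
    (hfc : ∀ t ∈ Icc p q, Continuous (f t)) (hPc : ∀ t ∈ Icc p q, Continuous (P t))
    (hf : ∀ s ∈ Icc p q, ∀ t ∈ Icc p q, s ≤ t →
      wnorm ν (σ + (ρ + a)) (f t - f s) ≤ ENNReal.ofReal (m * (t - s) ^ γ))
    (hP : ∀ s ∈ Icc p q, ∀ t ∈ Icc p q, s ≤ t → ∀ ξ,
      ‖P t ξ - P s ξ‖ ≤ c * ((t - s) / τ) ^ (γ * a) * japaneseBracket ξ ^ (ρ + a))
    (hlim : ∀ ξ, Tendsto (fun N : ℕ => ∑ k ∈ Finset.range N, P (gridPoint p q N k) ξ *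
      (f (gridPoint p q N (k + 1)) ξ - f (gridPoint p q N k) ξ)) atTop (𝓝 (F q ξ - F p ξ))) :
    wnorm ν σ (F q - F p - P p * (f q - f p)) ≤
      ENNReal.ofReal (sewConst (γ * (1 + a)) * (c * m / τ ^ (γ * a)) *
        (q - p) ^ (γ * (1 + a))) := by
  set Ξ : ℝ → ℝ → RSpace d → ℂ := fun s t => P s * (f t - f s) with hΞ
  have hpm : p ∈ Icc p q := ⟨le_rfl, hpq⟩
  have hqm : q ∈ Icc p q := ⟨hpq, le_rfl⟩
  have hΞc : ∀ s ∈ Icc p q, ∀ t ∈ Icc p q, Continuous (Ξ s t) := fun s hs t ht =>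
    (hPc s hs).mul ((hfc t ht).sub (hfc s hs))
  have hM : 0 ≤ c * m / τ ^ (γ * a) := by positivity
  have hdef : ∀ s u t, p ≤ s → s ≤ u → u ≤ t → t ≤ q →
      wnorm ν σ (Ξ s u + Ξ u t - Ξ s t) ≤
        ENNReal.ofReal (c * m / τ ^ (γ * a) * (t - s) ^ (γ * (1 + a))) := by
    intro s u t hps hsu hut htq
    have hs : s ∈ Icc p q := ⟨hps, by linarith⟩
    have hu : u ∈ Icc p q := ⟨by linarith, by linarith⟩
    have ht : t ∈ Icc p q := ⟨by linarith, htq⟩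
    -- The defect is a product of increments of orders γa and γ, which gives the exponent γ(1 + a) >
    -- 1 needed for sewing.
    have e : Ξ s u + Ξ u t - Ξ s t = (P u - P s) * (f t - f u) := by
      simp only [hΞ]; ring
    rw [e]
    have h1 : wnorm ν σ ((P u - P s) * (f t - f u)) ≤
        ENNReal.ofReal (c * ((u - s) / τ) ^ (γ * a)) * wnorm ν (σ + (ρ + a)) (f t - f u) :=
      wnorm_le_of_norm_le fun ξ => by
        simp only [Pi.mul_apply, Pi.sub_apply, norm_mul]
        gcongr
        exact hP s hs u hu hsu ξ
    refine (h1.trans (mul_le_mul_right (hf u hu t ht hut) _)).trans ?_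
    have hus : 0 ≤ (u - s) / τ := div_nonneg (by linarith) hτ.le
    have hts : 0 ≤ t - s := by linarith
    rw [← ENNReal.ofReal_mul (by positivity)]
    refine ENNReal.ofReal_le_ofReal ?_
    have hus' : 0 ≤ u - s := by linarith
    have htu' : 0 ≤ t - u := by linarith
    calc c * ((u - s) / τ) ^ (γ * a) * (m * (t - u) ^ γ)
        ≤ c * ((t - s) / τ) ^ (γ * a) * (m * (t - s) ^ γ) := by gcongr
      _ = _ := by
        rw [Real.div_rpow hts hτ.le]
        rcases hts.eq_or_lt with h0 | h0
        · have hg : γ ≠ 0 := by rintro rfl; norm_num at hβ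
          have hb : γ * (1 + a) ≠ 0 := by linarith
          rw [← h0, Real.zero_rpow hg, Real.zero_rpow hb]; ring
        · rw [mul_add, mul_one, Real.rpow_add h0]; ring
  have hbound : ∀ᶠ N : ℕ in atTop, wnorm ν σ
      (∑ k ∈ Finset.range N, Ξ (gridPoint p q N k) (gridPoint p q N (k + 1)) - Ξ p q) ≤
      ENNReal.ofReal (sewConst (γ * (1 + a)) * (c * m / τ ^ (γ * a)) *
        (q - p) ^ (γ * (1 + a))) := by
    filter_upwards [eventually_gt_atTop 0] with N hN
    have := wnorm_sum_sub_le (ν := ν) hβ hM hΞc (fun s => by simp [hΞ]) hdef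
      (gridPoint_monotone hpq N) (by simp) N 0 N (by simp) (by simp [gridPoint_self p q hN])
    simpa [gridPoint_self p q hN] using this
  have hmem : ∀ N k, k < N → gridPoint p q N k ∈ Icc p q ∧ gridPoint p q N (k + 1) ∈ Icc p q :=
    fun N k hk => ⟨gridPoint_mem hpq (by omega) (by omega), gridPoint_mem hpq (by omega) (by omega)⟩
  refine wnorm_le_of_tendsto (fun N => ?_) (fun ξ => ?_) hbound
  · exact (continuous_sum_fun fun k hk => hΞc _ (hmem N k (Finset.mem_range.1 hk)).1 _
      (hmem N k (Finset.mem_range.1 hk)).2).sub (hΞc _ hpm _ hqm)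
  · simpa [hΞ] using (hlim ξ).sub_const (P p ξ * (f q ξ - f p ξ))

/-- The amplitude has order ρ and its increments have order ρ + a, so regularity σ + ρ + a of f
leaves σ for F. The restriction q - p ≤ τ makes the sewing remainder no larger than the first-order
term, whence the constant 1 + `sewConst`. -/
theorem wnorm_young_le {f F P : ℝ → RSpace d → ℂ} {σ ρ a γ τ c m p q : ℝ} (hτ : 0 < τ)
    (ha : 0 ≤ a) (hγ : 0 ≤ γ) (hβ : 1 < γ * (1 + a)) (hc : 0 ≤ c) (hm : 0 ≤ m) (hpq : p ≤ q)
    (hqp : q - p ≤ τ)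
    (hfc : ∀ t ∈ Icc p q, Continuous (f t)) (hPc : ∀ t ∈ Icc p q, Continuous (P t))
    (hFc : ∀ t ∈ Icc p q, Continuous (F t))
    (hf : ∀ s ∈ Icc p q, ∀ t ∈ Icc p q, s ≤ t →
      wnorm ν (σ + (ρ + a)) (f t - f s) ≤ ENNReal.ofReal (m * (t - s) ^ γ))
    (hP0 : ∀ s ∈ Icc p q, ∀ ξ, ‖P s ξ‖ ≤ c * japaneseBracket ξ ^ ρ)
    (hP : ∀ s ∈ Icc p q, ∀ t ∈ Icc p q, s ≤ t → ∀ ξ,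
      ‖P t ξ - P s ξ‖ ≤ c * ((t - s) / τ) ^ (γ * a) * japaneseBracket ξ ^ (ρ + a))
    (hlim : ∀ ξ, Tendsto (fun N : ℕ => ∑ k ∈ Finset.range N, P (gridPoint p q N k) ξ *
      (f (gridPoint p q N (k + 1)) ξ - f (gridPoint p q N k) ξ)) atTop (𝓝 (F q ξ - F p ξ))) :
    wnorm ν σ (F q - F p) ≤
      ENNReal.ofReal (c * (1 + sewConst (γ * (1 + a))) * m * (q - p) ^ γ) := by
  have h1 := wnorm_young_remainder_le hτ ha hγ hβ hc hm hpq hfc hPc hf hP hlim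
  have hpm : p ∈ Icc p q := ⟨le_rfl, hpq⟩
  have hqm : q ∈ Icc p q := ⟨hpq, le_rfl⟩
  have hC := sewConst_pos hβ
  have hqp0 : 0 ≤ q - p := by linarith
  have h2 : wnorm ν σ (P p * (f q - f p)) ≤ ENNReal.ofReal (c * m * (q - p) ^ γ) := by
    have h3 : wnorm ν σ (P p * (f q - f p)) ≤ ENNReal.ofReal c * wnorm ν (σ + ρ) (f q - f p) :=
      wnorm_le_of_norm_le fun ξ => by
        simp only [Pi.mul_apply, Pi.sub_apply, norm_mul]
        gcongr
        exact hP0 p hpm ξ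
    refine h3.trans ?_
    rw [mul_assoc, ENNReal.ofReal_mul hc]
    gcongr
    exact (wnorm_mono (by linarith)).trans (hf p hpm q hqm hpq)
  have hcont : Continuous (P p * (f q - f p)) := (hPc p hpm).mul ((hfc q hqm).sub (hfc p hpm))
  calc wnorm ν σ (F q - F p) =
        wnorm ν σ ((F q - F p - P p * (f q - f p)) + P p * (f q - f p)) := by rw [sub_add_cancel]
    _ ≤ _ + _ := wnorm_add_le (((hFc q hqm).sub (hFc p hpm)).sub hcont) hcont σ
    _ ≤ _ := add_le_add h1 h2
    _ ≤ _ := by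
      rw [← ENNReal.ofReal_add (by positivity) (by positivity)]
      refine ENNReal.ofReal_le_ofReal ?_
      have h4 : (q - p) ^ (γ * (1 + a)) / τ ^ (γ * a) ≤ (q - p) ^ γ := by
        rcases hqp0.eq_or_lt with h0 | h0
        · rw [← h0, Real.zero_rpow (by linarith), zero_div]
          positivity
        · rw [mul_add, mul_one, Real.rpow_add h0, mul_div_assoc]
          refine mul_le_of_le_one_right (by positivity) ?_
          rw [div_le_one (by positivity)]
          gcongr
      calc _ = sewConst (γ * (1 + a)) * c * m * ((q - p) ^ (γ * (1 + a)) / τ ^ (γ * a)) +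
            c * m * (q - p) ^ γ := by ring
        _ ≤ sewConst (γ * (1 + a)) * c * m * (q - p) ^ γ + c * m * (q - p) ^ γ := by gcongr
        _ = _ := by ring

/-- A bound on increments at scale `τ` yields a bound for the values by concatenation. -/
theorem wnorm_le_of_increments {G : ℝ → RSpace d → ℂ} {σ A γ τ T : ℝ} (hτ : 0 < τ) (hA : 0 ≤ A)
    (hγ : 0 ≤ γ) (hG0 : G 0 = 0) (hGc : ∀ t ∈ Icc 0 T, Continuous (G t))
    (hG : ∀ s ∈ Icc 0 T, ∀ t ∈ Icc 0 T, s ≤ t → t - s ≤ τ →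
      wnorm ν σ (G t - G s) ≤ ENNReal.ofReal (A * (t - s) ^ γ)) (k : ℕ) :
    ∀ t ∈ Icc 0 T, t ≤ k * τ → wnorm ν σ (G t) ≤ ENNReal.ofReal (k * (A * τ ^ γ)) := by
  induction k with
  | zero =>
    intro t ht htk
    have : t = 0 := le_antisymm (by simpa using htk) ht.1
    simp [this, hG0]
  | succ k ih =>
    intro t ht htk
    push_cast at htk
    set s := max (t - τ) 0 with hs
    have hst : s ≤ t := max_le (by linarith) ht.1
    have hsm : s ∈ Icc 0 T := ⟨le_max_right _ _, hst.trans ht.2⟩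
    have hsk : s ≤ k * τ := max_le (by linarith) (by positivity)
    have hts : t - s ≤ τ := by linarith [le_max_left (t - τ) 0]
    have hts0 : 0 ≤ t - s := by linarith
    calc wnorm ν σ (G t) = wnorm ν σ (G s + (G t - G s)) := by rw [add_sub_cancel]
      _ ≤ _ + _ := wnorm_add_le (hGc s hsm) ((hGc t ht).sub (hGc s hsm)) σ
      _ ≤ ENNReal.ofReal (k * (A * τ ^ γ)) + ENNReal.ofReal (A * τ ^ γ) := by
        refine add_le_add (ih s hsm hsk) ((hG s hsm t ht hst hts).trans ?_)
        exact ENNReal.ofReal_le_ofReal (by gcongr)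
      _ = _ := by
        rw [← ENNReal.ofReal_add (by positivity) (by positivity)]
        congr 1; push_cast; ring

end Young

/-! ### Real parts and weighted pairings -/

section Pairing

variable {d : ℕ}

theorem realPart_add (v v' : CSpace d) : realPart (v + v') = realPart v + realPart v' := by
  ext i; simp [realPart]

theorem realPart_sub (v v' : CSpace d) : realPart (v - v') = realPart v - realPart v' := by
  ext i; simp [realPart]

@[simp] theorem realPart_zero : realPart (0 : CSpace d) = 0 := by
  ext i; simp [realPart]

@[simp] theorem realPart_toComplex (x : RSpace d) : realPart (toComplex x) = x := by
  ext i; simp [realPart, toComplex]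

theorem norm_realPart_le (v : CSpace d) : ‖realPart v‖ ≤ ‖v‖ := by
  rw [EuclideanSpace.norm_eq, EuclideanSpace.norm_eq]
  refine Real.sqrt_le_sqrt (Finset.sum_le_sum fun i _ => ?_)
  gcongr
  exact Complex.abs_re_le_norm (v i)

/-- The measure with density `|h|`. -/
noncomputable def absMeasure (h : RSpace d → CSpace d) : Measure (RSpace d) :=
  volume.withDensity fun ξ => ‖h ξ‖ₑ

/-- The pairing `Re ∫ conj(F) G h`. -/
noncomputable def pairing (h : RSpace d → CSpace d) (F G : RSpace d → ℂ) : RSpace d :=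
  realPart (∫ ξ, (starRingEnd ℂ (F ξ) * G ξ) • h ξ)

variable {h : RSpace d → CSpace d} {F G : RSpace d → ℂ}

/-- The modulus |h| is absorbed into the measure, and Cauchy-Schwarz distributes the weights σ and
-σ; one factor may therefore be less regular than the other. -/
theorem lintegral_pairing_le (hh : AEStronglyMeasurable h) (hF : Continuous F)
    (hG : Continuous G) (σ : ℝ) :
    ∫⁻ ξ, ‖(starRingEnd ℂ (F ξ) * G ξ) • h ξ‖ₑ ≤
      wnorm (absMeasure h) (-σ) F * wnorm (absMeasure h) σ G := by
  refine le_trans (le_of_eq ?_) (lintegral_enorm_mul_le hF hG σ)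
  refine Eq.trans (lintegral_congr fun ξ => ?_) (lintegral_withDensity_eq_lintegral_mul₀ hh.enorm
    (hF.enorm.measurable.mul hG.enorm.measurable).aemeasurable).symm
  simp only [Pi.mul_apply, enorm_smul, enorm_mul]
  rw [show ‖starRingEnd ℂ (F ξ)‖ₑ = ‖F ξ‖ₑ by simp [enorm_eq_nnnorm]]
  ring

theorem aestronglyMeasurable_pairing (hh : AEStronglyMeasurable h) (hF : Continuous F)
    (hG : Continuous G) : AEStronglyMeasurable fun ξ => (starRingEnd ℂ (F ξ) * G ξ) • h ξ :=
  ((Complex.continuous_conj.comp hF).mul hG).aestronglyMeasurable.smul hh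

theorem integrable_pairing (hh : AEStronglyMeasurable h) (hF : Continuous F)
    (hG : Continuous G) {σ : ℝ} (h1 : wnorm (absMeasure h) (-σ) F < ∞)
    (h2 : wnorm (absMeasure h) σ G < ∞) :
    Integrable fun ξ => (starRingEnd ℂ (F ξ) * G ξ) • h ξ :=
  ⟨aestronglyMeasurable_pairing hh hF hG,
    (lintegral_pairing_le hh hF hG σ).trans_lt (ENNReal.mul_lt_top h1 h2)⟩

theorem norm_pairing_le (hh : AEStronglyMeasurable h) (hF : Continuous F)
    (hG : Continuous G) {σ A B : ℝ} (hA : 0 ≤ A) (hB : 0 ≤ B)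
    (h1 : wnorm (absMeasure h) (-σ) F ≤ ENNReal.ofReal A)
    (h2 : wnorm (absMeasure h) σ G ≤ ENNReal.ofReal B) : ‖pairing h F G‖ ≤ A * B := by
  refine (norm_realPart_le _).trans ?_
  have := (enorm_integral_le_lintegral_enorm _).trans (lintegral_pairing_le hh hF hG σ)
  have h3 := this.trans (mul_le_mul' h1 h2)
  rw [← ENNReal.ofReal_mul hA, ← ofReal_norm,
    ENNReal.ofReal_le_ofReal_iff (mul_nonneg hA hB)] at h3
  exact h3

theorem pairing_add_left {F' : RSpace d → ℂ}
    (h1 : Integrable fun ξ => (starRingEnd ℂ (F ξ) * G ξ) • h ξ)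
    (h2 : Integrable fun ξ => (starRingEnd ℂ (F' ξ) * G ξ) • h ξ) :
    pairing h (F + F') G = pairing h F G + pairing h F' G := by
  rw [pairing, pairing, pairing, ← realPart_add, ← integral_add h1 h2]
  congr 2; ext1 ξ
  rw [← add_smul, Pi.add_apply, map_add, add_mul]

theorem pairing_add_right {G' : RSpace d → ℂ}
    (h1 : Integrable fun ξ => (starRingEnd ℂ (F ξ) * G ξ) • h ξ)
    (h2 : Integrable fun ξ => (starRingEnd ℂ (F ξ) * G' ξ) • h ξ) :
    pairing h F (G + G') = pairing h F G + pairing h F G' := by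
  rw [pairing, pairing, pairing, ← realPart_add, ← integral_add h1 h2]
  congr 2; ext1 ξ
  rw [← add_smul, Pi.add_apply, mul_add]

theorem pairing_sub_kernel {h' : RSpace d → CSpace d}
    (h1 : Integrable fun ξ => (starRingEnd ℂ (F ξ) * G ξ) • h ξ)
    (h2 : Integrable fun ξ => (starRingEnd ℂ (F ξ) * G ξ) • h' ξ) :
    pairing (h - h') F G = pairing h F G - pairing h' F G := by
  rw [pairing, pairing, pairing, ← realPart_sub, ← integral_sub h1 h2]
  congr 2; ext1 ξ
  rw [← smul_sub, Pi.sub_apply]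

theorem pairing_self_sub_self (hh : AEStronglyMeasurable h) {F₀ F₁ : RSpace d → ℂ} {σ : ℝ}
    (c0 : Continuous F₀) (c1 : Continuous F₁)
    (b0 : wnorm (absMeasure h) (-σ) F₀ < ∞) (b0' : wnorm (absMeasure h) σ F₀ < ∞)
    (b1 : wnorm (absMeasure h) (-σ) F₁ < ∞) (b1' : wnorm (absMeasure h) σ F₁ < ∞) :
    pairing h F₁ F₁ - pairing h F₀ F₀ = pairing h (F₁ - F₀) F₁ + pairing h F₀ (F₁ - F₀) := by
  have cs := c1.sub c0
  have bs : wnorm (absMeasure h) (-σ) (F₁ - F₀) < ∞ :=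
    (wnorm_sub_le c1 c0 _).trans_lt (ENNReal.add_lt_top.2 ⟨b1, b0⟩)
  have bs' : wnorm (absMeasure h) σ (F₁ - F₀) < ∞ :=
    (wnorm_sub_le c1 c0 _).trans_lt (ENNReal.add_lt_top.2 ⟨b1', b0'⟩)
  have e1 := pairing_add_left (integrable_pairing hh cs c1 bs b1')
    (integrable_pairing hh c0 c1 b0 b1')
  have e2 := pairing_add_right (integrable_pairing hh c0 cs b0 bs')
    (integrable_pairing hh c0 c0 b0 b0')
  rw [sub_add_cancel] at e1 e2
  rw [e1, e2]; abel

end Pairing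

/-! ### Estimates for Hölder perturbations of the driving path -/

section Driver

variable {d : ℕ}

/-- Increments over at most `τ` are bounded by `((t - s) / τ)^γ`. -/
def HolderAtScale (T γ τ : ℝ) (θ : ℝ → RSpace d) : Prop :=
  ∀ s ∈ Icc 0 T, ∀ t ∈ Icc 0 T, s ≤ t → t - s ≤ τ → ‖θ t - θ s‖ ≤ ((t - s) / τ) ^ γ

theorem HolderAtScale.continuousOn {T γ τ : ℝ} {θ : ℝ → RSpace d} (h : HolderAtScale T γ τ θ)
    (hτ : 0 < τ) (hγ : 0 < γ) : ContinuousOn θ (Icc 0 T) := by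
  intro s hs
  rw [ContinuousWithinAt, tendsto_iff_norm_sub_tendsto_zero]
  have hlim : Tendsto (fun t => (|t - s| / τ) ^ γ) (𝓝[Icc 0 T] s) (𝓝 0) := by
    have : Continuous fun t => (|t - s| / τ) ^ γ :=
      Continuous.rpow_const (by fun_prop) fun t => Or.inr hγ.le
    have h0 := this.tendsto s
    simp only [sub_self, abs_zero, zero_div, Real.zero_rpow hγ.ne'] at h0
    exact h0.mono_left nhdsWithin_le_nhds
  refine squeeze_zero' (Eventually.of_forall fun t => norm_nonneg _) ?_ hlim
  filter_upwards [self_mem_nhdsWithin,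
    mem_nhdsWithin_of_mem_nhds (Metric.ball_mem_nhds s hτ)] with t ht hts
  rw [Metric.mem_ball, Real.dist_eq] at hts
  rcases le_total s t with hst | hst
  · rw [abs_of_nonneg (by linarith)] at hts ⊢
    exact h s hs t ht hst hts.le
  · rw [abs_of_nonpos (by linarith)] at hts ⊢
    rw [norm_sub_rev, neg_sub] at *
    exact h t ht s hs hst (by linarith)

/-- Bounds on an `L²`-valued driving signal that make the fixed point equation well posed: the
oscillatory integrals along `z` are `γ`-Hölder continuous with values in `L²(⟨ξ⟩^{1 + 2 a} |h| dξ)`. -/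
structure IsDriver (T γ a m : ℝ) (w : ℝ → ℝ) (z : ℝ → RSpace d) (h : RSpace d → CSpace d) :
    Prop where
  meas : AEStronglyMeasurable h
  int : IntervalIntegrable w volume 0 T
  cont : ContinuousOn z (Icc 0 T)
  a_pos : 0 < a
  a_le : a ≤ 1
  γ_pos : 0 < γ
  β_gt : 1 < γ * (1 + a)
  m_nonneg : 0 ≤ m
  bound : ∀ s ∈ Icc 0 T, ∀ t ∈ Icc 0 T, s ≤ t →
    wnorm (absMeasure h) (1 / 2 + a) (waveInt w z t - waveInt w z s) ≤
      ENNReal.ofReal (m * (t - s) ^ γ)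

/-- The constant in the first order estimates. -/
noncomputable def youngConst (β : ℝ) : ℝ := 4 * Real.pi ^ 2 * (1 + sewConst β)

theorem youngConst_pos {β : ℝ} (hβ : 1 < β) : 0 < youngConst β := by
  have := sewConst_pos hβ
  unfold youngConst; positivity

variable {T γ a m τ : ℝ} {w : ℝ → ℝ} {z θ θ' : ℝ → RSpace d} {h : RSpace d → CSpace d}

theorem IsDriver.continuousOn_add (H : IsDriver T γ a m w z h) (hτ : 0 < τ)
    (hθ : HolderAtScale T γ τ θ) : ContinuousOn (z + θ) (Icc 0 T) :=
  H.cont.add (hθ.continuousOn hτ H.γ_pos)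

theorem HolderAtScale.norm_wave_sub_le (ha : 0 ≤ a) (ha' : a ≤ 1) (hτ : 0 < τ)
    (hθ : HolderAtScale T γ τ θ)
    {s t : ℝ} (hs : s ∈ Icc 0 T) (ht : t ∈ Icc 0 T) (hst : s ≤ t) (hts : t - s ≤ τ)
    (ξ : RSpace d) : ‖wave ξ (θ t) - wave ξ (θ s)‖ ≤
      4 * Real.pi ^ 2 * ((t - s) / τ) ^ (γ * a) * japaneseBracket ξ ^ a := by
  have h0 : 0 ≤ (t - s) / τ := div_nonneg (by linarith) hτ.le
  have hJ := japaneseBracket_pos ξ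
  have hπ := Real.pi_gt_three
  refine (norm_wave_sub_wave_le_rpow ha ha' ξ _ _).trans ?_
  have : ‖θ t - θ s‖ ^ a ≤ ((t - s) / τ) ^ (γ * a) := by
    rw [Real.rpow_mul h0]
    exact Real.rpow_le_rpow (norm_nonneg _) (hθ s hs t ht hst hts) ha
  calc _ ≤ 2 * Real.pi * (japaneseBracket ξ ^ a * ((t - s) / τ) ^ (γ * a)) := by gcongr
    _ ≤ 4 * Real.pi ^ 2 * (japaneseBracket ξ ^ a * ((t - s) / τ) ^ (γ * a)) := by
      gcongr ?_ * _
      nlinarith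
    _ = _ := by ring

/-- The amplitude is unimodular (ρ = 0), so regularity 1/2 + a of the driver leaves exponent 1/2.
This second-order version is what makes the Riemann sums converge. -/
theorem IsDriver.wnorm_remainder_le (H : IsDriver T γ a m w z h) (hτ : 0 < τ)
    (hθ : HolderAtScale T γ τ θ) {s t : ℝ} (hs : s ∈ Icc 0 T) (ht : t ∈ Icc 0 T) (hst : s ≤ t)
    (hts : t - s ≤ τ) :
    wnorm (absMeasure h) (1 / 2) (waveInt w (z + θ) t - waveInt w (z + θ) s -
        (fun ξ => wave ξ (θ s)) * (waveInt w z t - waveInt w z s)) ≤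
      ENNReal.ofReal (sewConst (γ * (1 + a)) * (4 * Real.pi ^ 2 * m / τ ^ (γ * a)) *
        (t - s) ^ (γ * (1 + a))) := by
  have hsub : Icc s t ⊆ Icc 0 T := Icc_subset_Icc hs.1 ht.2
  refine wnorm_young_remainder_le (f := waveInt w z) (F := waveInt w (z + θ))
    (P := fun r ξ => wave ξ (θ r)) (ρ := 0) hτ H.a_pos.le H.γ_pos.le H.β_gt (by positivity)
    H.m_nonneg hst
    (fun r hr => continuous_waveInt H.int H.cont (hsub hr))
    (fun r _ => continuous_wave.comp (continuous_id.prodMk continuous_const))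
    (fun p hp q hq hpq => by
      rw [zero_add]; exact H.bound p (hsub hp) q (hsub hq) hpq)
    (fun p hp q hq hpq ξ => ?_)
    (fun ξ => tendsto_riemann_wave H.int H.cont (hθ.continuousOn hτ H.γ_pos) hst hs ht ξ)
  rw [zero_add]
  exact hθ.norm_wave_sub_le H.a_pos.le H.a_le hτ (hsub hp) (hsub hq) hpq
    (by linarith [hp.1, hq.2]) ξ

theorem IsDriver.wnorm_sub_le (H : IsDriver T γ a m w z h) (hτ : 0 < τ)
    (hθ : HolderAtScale T γ τ θ) {s t : ℝ} (hs : s ∈ Icc 0 T) (ht : t ∈ Icc 0 T) (hst : s ≤ t)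
    (hts : t - s ≤ τ) :
    wnorm (absMeasure h) (1 / 2) (waveInt w (z + θ) t - waveInt w (z + θ) s) ≤
      ENNReal.ofReal (youngConst (γ * (1 + a)) * m * (t - s) ^ γ) := by
  have hsub : Icc s t ⊆ Icc 0 T := Icc_subset_Icc hs.1 ht.2
  refine wnorm_young_le (f := waveInt w z) (F := waveInt w (z + θ))
    (P := fun r ξ => wave ξ (θ r)) (ρ := 0) hτ H.a_pos.le H.γ_pos.le H.β_gt (by positivity)
    H.m_nonneg hst hts
    (fun r hr => continuous_waveInt H.int H.cont (hsub hr))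
    (fun r _ => continuous_wave.comp (continuous_id.prodMk continuous_const))
    (fun r hr => continuous_waveInt H.int (H.continuousOn_add hτ hθ) (hsub hr))
    (fun p hp q hq hpq => by
      rw [zero_add]; exact H.bound p (hsub hp) q (hsub hq) hpq)
    (fun p _ ξ => ?_) (fun p hp q hq hpq ξ => ?_)
    (fun ξ => tendsto_riemann_wave H.int H.cont (hθ.continuousOn hτ H.γ_pos) hst hs ht ξ)
  · have := Real.pi_gt_three
    simp only [norm_wave, Real.rpow_zero, mul_one]
    nlinarith
  · rw [zero_add]
    exact hθ.norm_wave_sub_le H.a_pos.le H.a_le hτ (hsub hp) (hsub hq) hpq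
      (by linarith [hp.1, hq.2]) ξ

/-- Concatenation over n windows of length τ. The bound is uniform over all θ that are Hölder at
scale τ. -/
theorem IsDriver.wnorm_le (H : IsDriver T γ a m w z h) (hτ : 0 < τ)
    (hθ : HolderAtScale T γ τ θ) {n : ℕ} (hn : T ≤ n * τ) {t : ℝ} (ht : t ∈ Icc 0 T) :
    wnorm (absMeasure h) (1 / 2) (waveInt w (z + θ) t) ≤
      ENNReal.ofReal (n * (youngConst (γ * (1 + a)) * m * τ ^ γ)) :=
  wnorm_le_of_increments hτ (mul_nonneg (youngConst_pos H.β_gt).le H.m_nonneg) H.γ_pos.le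
    waveInt_zero (fun _ ht => continuous_waveInt H.int (H.continuousOn_add hτ hθ) ht)
    (fun _ hs _ ht hst hts => H.wnorm_sub_le hτ hθ hs ht hst hts) n t ht (ht.2.trans hn)

/-- The differences of `θ` and `θ'` on `[0,S]` are bounded by `D`, and their increments over at
most `τ` by `Y ((t - s) / τ)^γ`. -/
structure CloseAtScale (S γ τ D Y : ℝ) (θ θ' : ℝ → RSpace d) : Prop where
  D_nonneg : 0 ≤ D
  Y_nonneg : 0 ≤ Y
  norm_le : ∀ t ∈ Icc 0 S, ‖θ t - θ' t‖ ≤ D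
  norm_sub_le : ∀ s ∈ Icc 0 S, ∀ t ∈ Icc 0 S, s ≤ t → t - s ≤ τ →
    ‖(θ t - θ' t) - (θ s - θ' s)‖ ≤ Y * ((t - s) / τ) ^ γ

variable {S D Y : ℝ}

theorem HolderAtScale.mono (hST : S ≤ T) (hθ : HolderAtScale T γ τ θ) : HolderAtScale S γ τ θ :=
  fun s hs t ht => hθ s (Icc_subset_Icc_right hST hs) t (Icc_subset_Icc_right hST ht)

/-- The increment of the amplitude of a difference costs ⟨ξ⟩^{1+a}. Within one window the exponent γ
of the increments of θ - θ' may be lowered to γa, so that both contributions have the same order in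
time. -/
theorem CloseAtScale.norm_wave_double_le (hc : CloseAtScale S γ τ D Y θ θ') (ha : 0 ≤ a)
    (ha' : a ≤ 1) (hγ : 0 < γ) (hτ : 0 < τ) (hθ' : HolderAtScale S γ τ θ') {p q : ℝ}
    (hp : p ∈ Icc 0 S) (hq : q ∈ Icc 0 S) (hpq : p ≤ q) (hqp : q - p ≤ τ) (ξ : RSpace d) :
    ‖(wave ξ (θ q) - wave ξ (θ' q)) - (wave ξ (θ p) - wave ξ (θ' p))‖ ≤
      4 * Real.pi ^ 2 * (D + Y) * ((q - p) / τ) ^ (γ * a) * japaneseBracket ξ ^ (1 + a) := by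
  have hD := hc.D_nonneg
  have hY := hc.Y_nonneg
  have hπ := Real.pi_gt_three
  have hJ : 0 ≤ japaneseBracket ξ ^ (1 + a) := Real.rpow_nonneg (japaneseBracket_pos ξ).le _
  have h0 : 0 ≤ (q - p) / τ := div_nonneg (by linarith) hτ.le
  have h1 : (q - p) / τ ≤ 1 := (div_le_one hτ).2 hqp
  refine (norm_wave_double_sub_le ha ha' ξ _ _ _ _).trans ?_
  have b1 : ‖θ' q - θ' p‖ ^ a ≤ ((q - p) / τ) ^ (γ * a) := by
    rw [Real.rpow_mul h0]
    exact Real.rpow_le_rpow (norm_nonneg _) (hθ' p hp q hq hpq hqp) ha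
  have b2 := hc.norm_le q hq
  have b3 : ‖(θ q - θ' q) - (θ p - θ' p)‖ ≤ Y * ((q - p) / τ) ^ (γ * a) := by
    refine (hc.norm_sub_le p hp q hq hpq hqp).trans (mul_le_mul_of_nonneg_left ?_ hY)
    rcases h0.eq_or_lt with h2 | h2
    · rw [← h2, Real.zero_rpow hγ.ne']
      exact Real.rpow_nonneg le_rfl _
    · exact Real.rpow_le_rpow_of_exponent_ge h2 h1 (mul_le_of_le_one_right hγ.le ha')
  have hx0 : 0 ≤ ((q - p) / τ) ^ (γ * a) := Real.rpow_nonneg h0 _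
  generalize ((q - p) / τ) ^ (γ * a) = x at *
  generalize japaneseBracket ξ ^ (1 + a) = j at *
  calc _ ≤ 2 * Real.pi * j * (2 * Real.pi * x * D + Y * x) := by gcongr
    _ = (2 * Real.pi * (2 * Real.pi * D + Y)) * (x * j) := by ring
    _ ≤ (4 * Real.pi ^ 2 * (D + Y)) * (x * j) := by
      refine mul_le_mul_of_nonneg_right ?_ (mul_nonneg hx0 hJ)
      nlinarith [mul_nonneg Real.pi_pos.le hD, mul_nonneg Real.pi_pos.le hY]
    _ = _ := by ring

/-- The amplitude wave ξ (θ r) - wave ξ (θ' r) has order ρ = 1, so the driver's regularity 1/2 + a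
leaves the exponent -1/2. This loss of one unit is what the pairing with exponent 1/2 compensates.
-/
theorem IsDriver.wnorm_diff_sub_le (H : IsDriver T γ a m w z h) (hτ : 0 < τ) (hST : S ≤ T)
    (hθ : HolderAtScale T γ τ θ) (hθ' : HolderAtScale T γ τ θ')
    (hc : CloseAtScale S γ τ D Y θ θ')
    {s t : ℝ} (hs : s ∈ Icc 0 S) (ht : t ∈ Icc 0 S) (hst : s ≤ t) (hts : t - s ≤ τ) :
    wnorm (absMeasure h) (-(1 / 2)) ((waveInt w (z + θ) t - waveInt w (z + θ') t) -
        (waveInt w (z + θ) s - waveInt w (z + θ') s)) ≤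
      ENNReal.ofReal (youngConst (γ * (1 + a)) * (D + Y) * m * (t - s) ^ γ) := by
  have hD := hc.D_nonneg
  have hY := hc.Y_nonneg
  have hsubS : Icc s t ⊆ Icc 0 S := Icc_subset_Icc hs.1 ht.2
  have hST' : Icc 0 S ⊆ Icc 0 T := Icc_subset_Icc le_rfl hST
  have hsub : Icc s t ⊆ Icc 0 T := hsubS.trans hST'
  have hcw : ∀ x : RSpace d, Continuous fun ξ => wave ξ x := fun x =>
    continuous_wave.comp (continuous_id.prodMk continuous_const)
  have hF := fun r (hr : r ∈ Icc s t) =>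
    continuous_waveInt H.int (H.continuousOn_add hτ hθ) (hsub hr)
  have hF' := fun r (hr : r ∈ Icc s t) =>
    continuous_waveInt H.int (H.continuousOn_add hτ hθ') (hsub hr)
  have hπ := Real.pi_gt_three
  have := wnorm_young_le (ν := absMeasure h) (f := waveInt w z)
    (F := fun r => waveInt w (z + θ) r - waveInt w (z + θ') r)
    (P := fun r ξ => wave ξ (θ r) - wave ξ (θ' r)) (ρ := 1) (σ := -(1 / 2)) (a := a) (γ := γ)
    (c := 4 * Real.pi ^ 2 * (D + Y)) (m := m) (p := s) (q := t)
    hτ H.a_pos.le H.γ_pos.le H.β_gt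
    (by positivity) H.m_nonneg hst hts
    (fun r hr => continuous_waveInt H.int H.cont (hsub hr))
    (fun r _ => (hcw _).sub (hcw _))
    (fun r hr => (hF r hr).sub (hF' r hr))
    (fun p hp q hq hpq => by
      rw [show -(1 / 2) + (1 + a) = 1 / 2 + a by ring]
      exact H.bound p (hsub hp) q (hsub hq) hpq)
    (fun p hp ξ => ?_) (fun p hp q hq hpq ξ => ?_) (fun ξ => ?_)
  · refine this.trans (le_of_eq ?_)
    unfold youngConst; congr 1; ring
  · have hJ := japaneseBracket_pos ξ
    rw [Real.rpow_one]
    refine (norm_wave_sub_wave_le ξ _ _).trans ?_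
    calc _ ≤ 2 * Real.pi * (japaneseBracket ξ * D) := by
          gcongr; exact hc.norm_le p (hsubS hp)
      _ = 2 * Real.pi * D * japaneseBracket ξ := by ring
      _ ≤ _ := by
        refine mul_le_mul_of_nonneg_right ?_ hJ.le
        nlinarith [mul_nonneg Real.pi_pos.le hD, mul_nonneg Real.pi_pos.le hY, sq_nonneg Real.pi,
          mul_nonneg (sq_nonneg Real.pi) hY]
  · exact hc.norm_wave_double_le H.a_pos.le H.a_le H.γ_pos hτ (hθ'.mono hST) (hsubS hp) (hsubS hq)
      hpq (by linarith [hp.1, hq.2]) ξ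
  · have := (tendsto_riemann_wave H.int H.cont (hθ.continuousOn hτ H.γ_pos) hst
      (hsub ⟨le_rfl, hst⟩) (hsub ⟨hst, le_rfl⟩) ξ).sub
      (tendsto_riemann_wave H.int H.cont (hθ'.continuousOn hτ H.γ_pos) hst
      (hsub ⟨le_rfl, hst⟩) (hsub ⟨hst, le_rfl⟩) ξ)
    refine (this.congr fun N => ?_).trans (le_of_eq ?_)
    · rw [← Finset.sum_sub_distrib]
      exact Finset.sum_congr rfl fun k _ => (sub_mul _ _ _).symm
    · simp only [Pi.sub_apply]
      congr 1; ring

theorem IsDriver.wnorm_diff_le (H : IsDriver T γ a m w z h) (hτ : 0 < τ) (hST : S ≤ T)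
    (hθ : HolderAtScale T γ τ θ) (hθ' : HolderAtScale T γ τ θ')
    (hc : CloseAtScale S γ τ D Y θ θ') {n : ℕ} (hn : T ≤ n * τ) {t : ℝ} (ht : t ∈ Icc 0 S) :
    wnorm (absMeasure h) (-(1 / 2)) (waveInt w (z + θ) t - waveInt w (z + θ') t) ≤
      ENNReal.ofReal (n * (youngConst (γ * (1 + a)) * (D + Y) * m * τ ^ γ)) := by
  have hST' : Icc 0 S ⊆ Icc 0 T := Icc_subset_Icc le_rfl hST
  refine wnorm_le_of_increments (G := fun t => waveInt w (z + θ) t - waveInt w (z + θ') t) hτ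
    (mul_nonneg (mul_nonneg (youngConst_pos H.β_gt).le (add_nonneg hc.D_nonneg hc.Y_nonneg))
      H.m_nonneg) H.γ_pos.le (by simp)
    (fun r hr => ?_) (fun _ hs _ ht hst hts => H.wnorm_diff_sub_le hτ hST hθ hθ' hc hs ht hst hts)
    n t ht (ht.2.trans (hST.trans hn))
  exact (continuous_waveInt H.int (H.continuousOn_add hτ hθ) (hST' hr)).sub
    (continuous_waveInt H.int (H.continuousOn_add hτ hθ') (hST' hr))

/-- The self-interaction `∫_0^t ∫_0^t w_{r₁} w_{r₂} b(u_{r₂} - u_{r₁}) dr` of a path `u`, in terms of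
the Fourier transform `h` of `b`. -/
noncomputable def selfInt (h : RSpace d → CSpace d) (w : ℝ → ℝ) (u : ℝ → RSpace d) (t : ℝ) :
    RSpace d :=
  pairing h (waveInt w u t) (waveInt w u t)

@[simp] theorem selfInt_zero (u : ℝ → RSpace d) : selfInt h w u 0 = 0 := by
  simp [selfInt, pairing]

theorem IsDriver.integrable_selfInt (H : IsDriver T γ a m w z h) (hτ : 0 < τ)
    (hθ : HolderAtScale T γ τ θ) {n : ℕ} (hn : T ≤ n * τ) {s t : ℝ} (hs : s ∈ Icc 0 T)
    (ht : t ∈ Icc 0 T) :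
    Integrable fun ξ => (starRingEnd ℂ (waveInt w (z + θ) s ξ) * waveInt w (z + θ) t ξ) • h ξ :=
  integrable_pairing H.meas (continuous_waveInt H.int (H.continuousOn_add hτ hθ) hs)
    (continuous_waveInt H.int (H.continuousOn_add hτ hθ) ht)
    ((wnorm_mono (by norm_num)).trans_lt
      ((H.wnorm_le hτ hθ hn hs).trans_lt ENNReal.ofReal_lt_top))
    ((H.wnorm_le hτ hθ hn ht).trans_lt ENNReal.ofReal_lt_top)

theorem IsDriver.norm_selfInt_sub_le (H : IsDriver T γ a m w z h) (hτ : 0 < τ)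
    (hθ : HolderAtScale T γ τ θ) {n : ℕ} (hn : T ≤ n * τ)
    {s t : ℝ} (hs : s ∈ Icc 0 T) (ht : t ∈ Icc 0 T) (hst : s ≤ t) (hts : t - s ≤ τ) :
    ‖selfInt h w (z + θ) t - selfInt h w (z + θ) s‖ ≤
      2 * n * youngConst (γ * (1 + a)) ^ 2 * m ^ 2 * τ ^ γ * (t - s) ^ γ := by
  have hK := youngConst_pos H.β_gt
  have hm := H.m_nonneg
  have hts0 : 0 ≤ t - s := by linarith
  have cs := continuous_waveInt H.int (H.continuousOn_add hτ hθ) hs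
  have ct := continuous_waveInt H.int (H.continuousOn_add hτ hθ) ht
  have bs := H.wnorm_le hτ hθ hn hs
  have bt := H.wnorm_le hτ hθ hn ht
  have bst := H.wnorm_sub_le hτ hθ hs ht hst hts
  have low : ∀ F : RSpace d → ℂ,
    wnorm (absMeasure h) (-(1 / 2)) F ≤ wnorm (absMeasure h) (1 / 2) F :=
    fun F => wnorm_mono (by norm_num)
  have e := pairing_self_sub_self H.meas cs ct
    ((low _).trans_lt (bs.trans_lt ENNReal.ofReal_lt_top)) (bs.trans_lt ENNReal.ofReal_lt_top)
    ((low _).trans_lt (bt.trans_lt ENNReal.ofReal_lt_top)) (bt.trans_lt ENNReal.ofReal_lt_top)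
  rw [selfInt, selfInt, e]
  have p1 := norm_pairing_le H.meas (ct.sub cs) ct (by positivity) (by positivity)
    ((low _).trans bst) bt
  have p2 := norm_pairing_le H.meas cs (ct.sub cs) (by positivity) (by positivity)
    ((low _).trans bs) bst
  refine (norm_add_le _ _).trans ((add_le_add p1 p2).trans (le_of_eq ?_))
  ring

theorem IsDriver.norm_selfInt_diff_sub_le (H : IsDriver T γ a m w z h) (hτ : 0 < τ) (hST : S ≤ T)
    (hθ : HolderAtScale T γ τ θ) (hθ' : HolderAtScale T γ τ θ')
    (hc : CloseAtScale S γ τ D Y θ θ') {n : ℕ} (hn : T ≤ n * τ)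
    {s t : ℝ} (hs : s ∈ Icc 0 S) (ht : t ∈ Icc 0 S) (hst : s ≤ t) (hts : t - s ≤ τ) :
    ‖(selfInt h w (z + θ) t - selfInt h w (z + θ') t) -
        (selfInt h w (z + θ) s - selfInt h w (z + θ') s)‖ ≤
      4 * n * youngConst (γ * (1 + a)) ^ 2 * m ^ 2 * τ ^ γ * (D + Y) * (t - s) ^ γ := by
  have hST' : Icc 0 S ⊆ Icc 0 T := Icc_subset_Icc le_rfl hST
  have hsT := hST' hs
  have htT := hST' ht
  have hK := youngConst_pos H.β_gt
  have hm := H.m_nonneg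
  have hD := hc.D_nonneg
  have hY := hc.Y_nonneg
  have hts0 : 0 ≤ t - s := by linarith
  have cs := continuous_waveInt H.int (H.continuousOn_add hτ hθ) hsT
  have ct := continuous_waveInt H.int (H.continuousOn_add hτ hθ) htT
  have cs' := continuous_waveInt H.int (H.continuousOn_add hτ hθ') hsT
  have ct' := continuous_waveInt H.int (H.continuousOn_add hτ hθ') htT
  have bt := H.wnorm_le hτ hθ hn htT
  have bs' := H.wnorm_le hτ hθ' hn hsT
  have bs := H.wnorm_le hτ hθ hn hsT
  have bt' := H.wnorm_le hτ hθ' hn htT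
  have bst := H.wnorm_sub_le hτ hθ hsT htT hst hts
  have bst' := H.wnorm_sub_le hτ hθ' hsT htT hst hts
  have gs := H.wnorm_diff_le hτ hST hθ hθ' hc hn hs
  have gt := H.wnorm_diff_le hτ hST hθ hθ' hc hn ht
  have gst := H.wnorm_diff_sub_le hτ hST hθ hθ' hc hs ht hst hts
  set F := waveInt w (z + θ)
  set F' := waveInt w (z + θ')
  have low : ∀ F : RSpace d → ℂ,
    wnorm (absMeasure h) (-(1 / 2)) F ≤ wnorm (absMeasure h) (1 / 2) F :=
    fun F => wnorm_mono (by norm_num)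
  have fin : ∀ {x : ℝ≥0∞} {y : ℝ}, x ≤ ENNReal.ofReal y → x < ∞ := fun h =>
    h.trans_lt ENNReal.ofReal_lt_top
  have e1 := pairing_self_sub_self H.meas ct' ct (fin ((low _).trans bt')) (fin bt')
    (fin ((low _).trans bt)) (fin bt)
  have e2 := pairing_self_sub_self H.meas cs' cs (fin ((low _).trans bs')) (fin bs')
    (fin ((low _).trans bs)) (fin bs)
  -- When the difference of the two integrals stands in the right slot, the weights are exchanged: σ
  -- = -1/2, and the left factor carries -σ = 1/2.
  have half : -(-(1 / 2 : ℝ)) = 1 / 2 := neg_neg _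
  have up : ∀ {F : RSpace d → ℂ} {x : ℝ≥0∞}, wnorm (absMeasure h) (1 / 2) F ≤ x →
    wnorm (absMeasure h) (-(-(1 / 2))) F ≤ x := fun h => by rwa [half]
  have i1 := integrable_pairing H.meas (ct.sub ct') cs (fin gt) (fin bs)
  have i1' := integrable_pairing H.meas (ct.sub ct') (ct.sub cs) (fin gt) (fin bst)
  have e3 := pairing_add_right i1 i1'
  have i2 := integrable_pairing H.meas (cs.sub cs') cs (fin gs) (fin bs)
  have i2' := integrable_pairing H.meas ((ct.sub ct').sub (cs.sub cs')) cs (fin gst) (fin bs)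
  have e4 := pairing_add_left i2 i2'
  have i3 := integrable_pairing (σ := -(1 / 2)) H.meas cs' (ct.sub ct')
    (fin (up bs')) (fin gt)
  have i3' := integrable_pairing (σ := -(1 / 2)) H.meas (ct'.sub cs') (ct.sub ct')
    (fin (up bst')) (fin gt)
  have e5 := pairing_add_left i3 i3'
  have i4 := integrable_pairing (σ := -(1 / 2)) H.meas cs' (cs.sub cs')
    (fin (up bs')) (fin gs)
  have i4' := integrable_pairing (σ := -(1 / 2)) H.meas cs' ((ct.sub ct').sub (cs.sub cs'))
    (fin (up bs')) (fin gst)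
  have e6 := pairing_add_right i4 i4'
  rw [add_sub_cancel] at e3 e4 e5 e6
  -- Each of the four terms contains exactly one difference between θ and θ', at exponent -1/2, and
  -- one factor without such a difference, at exponent 1/2. Exactly one of the two factors is an
  -- increment in time, which supplies (t - s)^γ.
  have key : (selfInt h w (z + θ) t - selfInt h w (z + θ') t) -
        (selfInt h w (z + θ) s - selfInt h w (z + θ') s) =
      (pairing h (F t - F' t) (F t - F s) + pairing h ((F t - F' t) - (F s - F' s)) (F s)) +
      (pairing h (F' t - F' s) (F t - F' t) +
        pairing h (F' s) ((F t - F' t) - (F s - F' s))) := by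
    simp only [selfInt]
    rw [e1, e2, e3, e4, e5, e6]; abel
  rw [key]
  have p1 := norm_pairing_le H.meas (ct.sub ct') (ct.sub cs) (by positivity) (by positivity) gt bst
  have p2 := norm_pairing_le H.meas ((ct.sub ct').sub (cs.sub cs')) cs (by positivity)
    (by positivity) gst bs
  have p3 := norm_pairing_le (σ := -(1 / 2)) H.meas (ct'.sub cs') (ct.sub ct') (by positivity)
    (by positivity) (up bst') gt
  have p4 := norm_pairing_le (σ := -(1 / 2)) H.meas cs' ((ct.sub ct').sub (cs.sub cs'))
    (by positivity) (by positivity) (up bs') gst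
  refine (norm_add_le _ _).trans ((add_le_add ((norm_add_le _ _).trans (add_le_add p1 p2))
    ((norm_add_le _ _).trans (add_le_add p3 p4))).trans (le_of_eq ?_))
  ring

end Driver

/-! ### The fixed point equation -/

section FixedPoint

variable {d : ℕ} {T S γ a m m' τ x D Y : ℝ} {w : ℝ → ℝ} {z θ θ' : ℝ → RSpace d}
  {h h' : RSpace d → CSpace d}

/-- The contraction factor of the fixed point equation at scale `τ`. -/
noncomputable def stepFactor (γ a m τ : ℝ) (n : ℕ) : ℝ :=
  4 * n * youngConst (γ * (1 + a)) ^ 2 * m ^ 2 * (τ ^ γ) ^ 2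

theorem stepFactor_nonneg (γ a m τ : ℝ) (n : ℕ) : 0 ≤ stepFactor γ a m τ n := by
  unfold stepFactor; positivity

/-- With n windows of length T/n the factor equals a constant times T (T/n)^{2γ-1}: the loss n from
concatenation is beaten by the two Hölder factors since γ > 1/2. -/
theorem exists_stepFactor_le {γ : ℝ} (hγ : 1 / 2 < γ) (a m : ℝ) {T τ₀ η : ℝ} (hT : 0 < T)
    (hτ₀ : 0 < τ₀) (hη : 0 < η) :
    ∃ n : ℕ, 0 < n ∧ T / n ≤ τ₀ ∧ stepFactor γ a m (T / n) n ≤ η := by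
  have h1 : Tendsto (fun n : ℕ => T / (n : ℝ)) atTop (𝓝 0) :=
    tendsto_const_div_atTop_nhds_zero_nat T
  have h2 : Tendsto (fun n : ℕ => 4 * youngConst (γ * (1 + a)) ^ 2 * m ^ 2 * T *
      (T / (n : ℝ)) ^ (2 * γ - 1)) atTop (𝓝 0) := by
    have h3 := (h1.rpow_const (p := 2 * γ - 1) (Or.inr (by linarith))).const_mul
      (4 * youngConst (γ * (1 + a)) ^ 2 * m ^ 2 * T)
    rwa [Real.zero_rpow (by linarith), mul_zero] at h3
  obtain ⟨n, ⟨hn, hn1⟩, hn2⟩ := ((eventually_gt_atTop 0).and (h1.eventually_le_const hτ₀)).and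
    (h2.eventually_le_const hη) |>.exists
  refine ⟨n, hn, hn1, le_trans (le_of_eq ?_) hn2⟩
  have hn' : (0 : ℝ) < n := by exact_mod_cast hn
  have hpos : 0 < T / n := by positivity
  have e : ((T / n) ^ γ) ^ 2 = (T / n) ^ (2 * γ - 1) * (T / n) := by
    rw [← Real.rpow_natCast, ← Real.rpow_mul hpos.le]
    nth_rewrite 3 [← Real.rpow_one (T / n)]
    rw [← Real.rpow_add hpos]
    congr 1; push_cast; ring
  rw [stepFactor, e]
  field_simp

theorem mul_rpow_eq_rescale (hτ : 0 < τ) {r : ℝ} (hr : 0 ≤ r) (c : ℝ) :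
    c * r ^ γ = c * τ ^ γ * (r / τ) ^ γ := by
  rw [Real.div_rpow hr hτ.le]
  have : τ ^ γ ≠ 0 := (Real.rpow_pos_of_pos hτ γ).ne'
  field_simp

theorem rescaled_rpow_nonneg (hτ : 0 < τ) {s t : ℝ} (hst : s ≤ t) : 0 ≤ ((t - s) / τ) ^ γ :=
  Real.rpow_nonneg (div_nonneg (by linarith) hτ.le) _

theorem rescaled_rpow_le_one (hτ : 0 < τ) (hγ : 0 ≤ γ) {s t : ℝ} (hst : s ≤ t) (hts : t - s ≤ τ) :
    ((t - s) / τ) ^ γ ≤ 1 :=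
  Real.rpow_le_one (div_nonneg (by linarith) hτ.le) ((div_le_one hτ).2 hts) hγ

theorem IsDriver.selfInt_sub_le (H : IsDriver T γ a m w z h) (hτ : 0 < τ)
    (hθ : HolderAtScale T γ τ θ) {n : ℕ} (hn : T ≤ n * τ)
    {s t : ℝ} (hs : s ∈ Icc 0 T) (ht : t ∈ Icc 0 T) (hst : s ≤ t) (hts : t - s ≤ τ) :
    ‖selfInt h w (z + θ) t - selfInt h w (z + θ) s‖ ≤
      stepFactor γ a m τ n * ((t - s) / τ) ^ γ := by
  refine (H.norm_selfInt_sub_le hτ hθ hn hs ht hst hts).trans ?_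
  rw [mul_rpow_eq_rescale hτ (by linarith : 0 ≤ t - s)]
  refine mul_le_mul_of_nonneg_right ?_ (rescaled_rpow_nonneg hτ hst)
  have : 0 ≤ (n : ℝ) * youngConst (γ * (1 + a)) ^ 2 * m ^ 2 * (τ ^ γ) ^ 2 := by positivity
  unfold stepFactor
  nlinarith

theorem IsDriver.selfInt_diff_sub_le (H : IsDriver T γ a m w z h) (hτ : 0 < τ) (hST : S ≤ T)
    (hθ : HolderAtScale T γ τ θ) (hθ' : HolderAtScale T γ τ θ')
    (hc : CloseAtScale S γ τ D Y θ θ') {n : ℕ} (hn : T ≤ n * τ)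
    {s t : ℝ} (hs : s ∈ Icc 0 S) (ht : t ∈ Icc 0 S) (hst : s ≤ t) (hts : t - s ≤ τ) :
    ‖(selfInt h w (z + θ) t - selfInt h w (z + θ') t) -
        (selfInt h w (z + θ) s - selfInt h w (z + θ') s)‖ ≤
      stepFactor γ a m τ n * (D + Y) * ((t - s) / τ) ^ γ := by
  refine (H.norm_selfInt_diff_sub_le hτ hST hθ hθ' hc hn hs ht hst hts).trans (le_of_eq ?_)
  rw [mul_rpow_eq_rescale hτ (by linarith : 0 ≤ t - s)]
  unfold stepFactor
  ring

/-- A bound on `[0,S]` extends to `[0,S']`, `S' ≤ S + τ`, through the increments. -/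
theorem norm_le_of_increment {Δ : ℝ → RSpace d} {S' : ℝ} (hτ : 0 < τ) (hγ : 0 ≤ γ) (hS : 0 ≤ S)
    (hS' : S' ≤ S + τ) (hY : 0 ≤ Y) (hD : ∀ t ∈ Icc 0 S, ‖Δ t‖ ≤ D)
    (hinc : ∀ s ∈ Icc 0 S', ∀ t ∈ Icc 0 S', s ≤ t → t - s ≤ τ →
      ‖Δ t - Δ s‖ ≤ Y * ((t - s) / τ) ^ γ) :
    ∀ t ∈ Icc 0 S', ‖Δ t‖ ≤ D + Y := by
  intro t ht
  rcases le_total t S with h | h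
  · linarith [hD t ⟨ht.1, h⟩]
  · have hts : t - S ≤ τ := by linarith [ht.2]
    have h1 := hinc S ⟨hS, h.trans ht.2⟩ t ht h hts
    have h2 := mul_le_mul_of_nonneg_left (rescaled_rpow_le_one hτ hγ h hts) hY
    have h3 := norm_add_le (Δ S) (Δ t - Δ S)
    rw [add_sub_cancel] at h3
    linarith [hD S ⟨hS, le_rfl⟩]

/-- `θ_t = x + ∫_0^t ∫_0^t w_{r₁} w_{r₂} b((z + θ)_{r₂} - (z + θ)_{r₁}) dr` on `[0,T]`, for the
distribution `b` with Fourier transform `h`. -/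
def IsFixedPath (T : ℝ) (w : ℝ → ℝ) (z : ℝ → RSpace d) (h : RSpace d → CSpace d) (x : RSpace d)
    (θ : ℝ → RSpace d) : Prop :=
  ∀ t ∈ Icc 0 T, θ t = x + selfInt h w (z + θ) t

/-- If every bound `Y` improves to `A + Y / 2`, then `2 A` is a bound. -/
theorem le_two_mul_of_improve {P : ℝ → Prop} {A Y₀ q c : ℝ} (h₀ : P Y₀)
    (himp : ∀ Y, P Y → P (A + Y / 2)) (hq : ∀ Y, P Y → q ≤ Y * c) : q ≤ 2 * A * c := by
  have h : ∀ n : ℕ, P (2 * A + (Y₀ - 2 * A) / 2 ^ n) := fun n => by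
    induction n with
    | zero => simpa using h₀
    | succ n ih =>
      convert himp _ ih using 1
      rw [pow_succ]; field_simp; ring
  have hlim : Tendsto (fun n : ℕ => (2 * A + (Y₀ - 2 * A) / 2 ^ n) * c) atTop
      (𝓝 ((2 * A + 0) * c)) :=
    ((tendsto_const_nhds.div_atTop (tendsto_pow_atTop_atTop_of_one_lt one_lt_two)).const_add
      _).mul_const c
  rw [add_zero] at hlim
  exact ge_of_tendsto' hlim fun n => hq _ (h n)

/-- Stability of the fixed point equation. -/
theorem IsDriver.closeAtScale (H : IsDriver T γ a m w z h) (H' : IsDriver T γ a m' w z (h - h'))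
    (Hh' : ∃ m, IsDriver T γ a m w z h')
    (hT : 0 ≤ T) (hτ : 0 < τ) {n : ℕ} (hn : T ≤ n * τ) (hε : stepFactor γ a m τ n ≤ 1 / 4)
    {x x' : RSpace d} (hθ : HolderAtScale T γ τ θ) (hθ' : HolderAtScale T γ τ θ')
    (hfix : IsFixedPath T w z h x θ) (hfix' : IsFixedPath T w z h' x' θ') :
    CloseAtScale T γ τ (2 ^ n * (‖x - x'‖ + 2 * stepFactor γ a m' τ n))
      (2 ^ n * (‖x - x'‖ + 2 * stepFactor γ a m' τ n)) θ θ' := by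
  obtain ⟨mh', Hh'⟩ := Hh'
  set ε := stepFactor γ a m τ n
  set e := stepFactor γ a m' τ n
  have hε0 : 0 ≤ ε := stepFactor_nonneg _ _ _ _ _
  have he0 : 0 ≤ e := stepFactor_nonneg _ _ _ _ _
  set D₀ := ‖x - x'‖ + 2 * e
  have hD₀ : 0 ≤ D₀ := add_nonneg (norm_nonneg _) (by linarith)
  have hγ := H.γ_pos
  have hker : ∀ t ∈ Icc 0 T, selfInt h w (z + θ') t - selfInt h' w (z + θ') t =
      selfInt (h - h') w (z + θ') t := fun t ht =>
    (pairing_sub_kernel (H.integrable_selfInt hτ hθ' hn ht ht)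
      (Hh'.integrable_selfInt hτ hθ' hn ht ht)).symm
  have hΔ : ∀ t ∈ Icc 0 T, θ t - θ' t = (x - x') +
      (selfInt h w (z + θ) t - selfInt h w (z + θ') t) + selfInt (h - h') w (z + θ') t :=
    fun t ht => by rw [← hker t ht, hfix t ht, hfix' t ht]; abel
  -- one improvement of the bound on the increments
  have himp : ∀ S ≤ T, ∀ D Y, CloseAtScale S γ τ D Y θ θ' → ∀ s ∈ Icc 0 S, ∀ t ∈ Icc 0 S,
      s ≤ t → t - s ≤ τ →
      ‖(θ t - θ' t) - (θ s - θ' s)‖ ≤ (ε * (D + Y) + e) * ((t - s) / τ) ^ γ := by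
    intro S hST D Y hc s hs t ht hst hts
    have hsT : s ∈ Icc 0 T := Icc_subset_Icc_right hST hs
    have htT : t ∈ Icc 0 T := Icc_subset_Icc_right hST ht
    have e1 : (θ t - θ' t) - (θ s - θ' s) =
        ((selfInt h w (z + θ) t - selfInt h w (z + θ') t) -
          (selfInt h w (z + θ) s - selfInt h w (z + θ') s)) +
        (selfInt (h - h') w (z + θ') t - selfInt (h - h') w (z + θ') s) := by
      rw [hΔ t htT, hΔ s hsT]; abel
    rw [e1, add_mul]
    exact (norm_add_le _ _).trans (add_le_add
      (H.selfInt_diff_sub_le hτ hST hθ hθ' hc hn hs ht hst hts)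
      (H'.selfInt_sub_le hτ hθ' hn hsT htT hst hts))
  -- The a priori bound from membership of both paths in the class at scale τ; it starts the
  -- iteration that absorbs Y.
  have hstart : ∀ s ∈ Icc 0 T, ∀ t ∈ Icc 0 T, s ≤ t → t - s ≤ τ →
      ‖(θ t - θ' t) - (θ s - θ' s)‖ ≤ 2 * ((t - s) / τ) ^ γ := by
    intro s hs t ht hst hts
    have := norm_sub_le (θ t - θ s) (θ' t - θ' s)
    rw [sub_sub_sub_comm]
    linarith [hθ s hs t ht hst hts, hθ' s hs t ht hst hts]
  -- The offset -2 e makes the induction close. At k = 0 the sup bound is ‖x - x'‖; if D_k is the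
  -- sup bound, the increment bound is D_k + 2 e = 2^k D₀, and their sum is 2^{k+1} D₀ - 2 e.
  have main : ∀ k : ℕ, CloseAtScale (min (k * τ) T) γ τ (2 ^ k * D₀ - 2 * e) (2 ^ k * D₀) θ θ' := by
    intro k
    induction k with
    | zero =>
      have e0 : min (((0 : ℕ) : ℝ) * τ) T = 0 := by simp [hT]
      rw [e0]
      have hz : ∀ t ∈ Icc (0 : ℝ) 0, t = 0 := fun t ht => le_antisymm ht.2 ht.1
      refine ⟨?_, by simpa using hD₀, fun t ht => ?_, fun s hs t ht hst hts => ?_⟩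
      · simp [D₀]
      · rw [hz t ht, hΔ 0 ⟨le_rfl, hT⟩]; simp [D₀]
      · rw [hz t ht, hz s hs]
        simp only [sub_self, norm_zero]
        exact mul_nonneg (by simpa using hD₀)
          (Real.rpow_nonneg (by simp) _)
    | succ k ih =>
      set Sk := min (k * τ) T
      set S' := min (((k + 1 : ℕ) : ℝ) * τ) T
      have hS'T : S' ≤ T := min_le_right _ _
      have hSk0 : 0 ≤ Sk := le_min (by positivity) hT
      have hS'S : S' ≤ Sk + τ := by
        rw [← min_add_add_right]
        refine min_le_min (by push_cast; linarith) (by linarith)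
      have hD1 := ih.D_nonneg
      set Dk := 2 ^ k * D₀ - 2 * e
      -- the admissible bounds on the increments
      set P : ℝ → Prop := fun Y => 0 ≤ Y ∧ ∀ s ∈ Icc 0 S', ∀ t ∈ Icc 0 S', s ≤ t → t - s ≤ τ →
        ‖(θ t - θ' t) - (θ s - θ' s)‖ ≤ Y * ((t - s) / τ) ^ γ with hP
      have hP2 : P 2 := ⟨by norm_num, fun s hs t ht => hstart s (Icc_subset_Icc_right hS'T hs) t
        (Icc_subset_Icc_right hS'T ht)⟩
      have hclose : ∀ Y, P Y → CloseAtScale S' γ τ (Dk + Y) Y θ θ' := fun Y hY =>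
        ⟨by linarith [hY.1], hY.1,
          norm_le_of_increment hτ hγ.le hSk0 hS'S hY.1 ih.norm_le hY.2, hY.2⟩
      -- On the enlarged interval the sup bound is D_k + Y, so the improved increment bound is ε
      -- (D_k + 2 Y) + e, and ε ≤ 1/4 makes the Y-part at most Y/2.
      have hPimp : ∀ Y, P Y → P ((ε * Dk + e) + Y / 2) := fun Y hY =>
        ⟨by have := hY.1; positivity, fun s hs t ht hst hts => by
          refine (himp S' hS'T _ _ (hclose Y hY) s hs t ht hst hts).trans ?_
          refine mul_le_mul_of_nonneg_right ?_ (rescaled_rpow_nonneg hτ hst)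
          nlinarith [hY.1]⟩
      have hbest : P (2 * (ε * Dk + e)) :=
        ⟨by positivity, fun s hs t ht hst hts => le_two_mul_of_improve hP2 hPimp
          fun Y hY => hY.2 s hs t ht hst hts⟩
      have hle : 2 * (ε * Dk + e) ≤ 2 ^ k * D₀ := by
        have : ε * Dk ≤ 1 / 4 * Dk := by gcongr
        simp only [Dk] at this hD1 ⊢
        nlinarith
      have hP' : P (2 ^ k * D₀) := ⟨by positivity, fun s hs t ht hst hts =>
        (hbest.2 s hs t ht hst hts).trans
          (mul_le_mul_of_nonneg_right hle (rescaled_rpow_nonneg hτ hst))⟩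
      have hc := hclose _ hP'
      have hpow : (2 : ℝ) ^ (k + 1) * D₀ = 2 ^ k * D₀ + 2 ^ k * D₀ := by ring
      refine ⟨by rw [hpow]; linarith [hc.D_nonneg], by positivity,
        fun t ht => (hc.norm_le t ht).trans (by rw [hpow]; simp only [Dk]; linarith),
        fun s hs t ht hst hts => (hc.norm_sub_le s hs t ht hst hts).trans ?_⟩
      refine mul_le_mul_of_nonneg_right ?_ (rescaled_rpow_nonneg hτ hst)
      rw [hpow]
      have : 0 ≤ 2 ^ k * D₀ := by positivity
      linarith
  have hfin := main n
  rw [min_eq_right hn] at hfin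
  exact ⟨by positivity, by positivity, fun t ht => (hfin.norm_le t ht).trans (by linarith),
    hfin.norm_sub_le⟩

/-- The Picard iterates of the fixed point equation. -/
noncomputable def picard (w : ℝ → ℝ) (z : ℝ → RSpace d) (h : RSpace d → CSpace d) (x : RSpace d) :
    ℕ → ℝ → RSpace d
  | 0 => fun _ => x
  | j + 1 => fun t => x + selfInt h w (z + picard w z h x j) t

/-- Converts an identity between increments over short intervals into an identity of paths; the
interaction estimates control only such increments. -/
theorem eq_zero_of_locally_const {ψ : ℝ → RSpace d} (hτ : 0 < τ) {n : ℕ} (hn : T ≤ n * τ)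
    (h0 : ψ 0 = 0) (hψ : ∀ s ∈ Icc 0 T, ∀ t ∈ Icc 0 T, s ≤ t → t - s ≤ τ → ψ t = ψ s) :
    ∀ t ∈ Icc 0 T, ψ t = 0 := by
  have key : ∀ k : ℕ, ∀ t ∈ Icc 0 T, t ≤ k * τ → ψ t = 0 := fun k => by
    induction k with
    | zero =>
      intro t ht htk
      rwa [le_antisymm (by simpa using htk) ht.1]
    | succ k ih =>
      intro t ht htk
      push_cast at htk
      have hst : max (t - τ) 0 ≤ t := max_le (by linarith) ht.1
      rw [hψ (max (t - τ) 0) ⟨le_max_right _ _, hst.trans ht.2⟩ t ht hst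
        (by linarith [le_max_left (t - τ) 0])]
      exact ih _ ⟨le_max_right _ _, hst.trans ht.2⟩ (max_le (by linarith) (by positivity))
  exact fun t ht => key n t ht (ht.2.trans hn)

/-- Existence for the fixed point equation. -/
theorem IsDriver.exists_isFixedPath (H : IsDriver T γ a m w z h) (hT : 0 ≤ T) (hτ : 0 < τ)
    {n : ℕ} (hn : T ≤ n * τ) (hε : stepFactor γ a m τ n ≤ 1 / 8) (x : RSpace d) :
    ∃ θ, HolderAtScale T γ τ θ ∧ IsFixedPath T w z h x θ := by
  set ε := stepFactor γ a m τ n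
  have hε0 : 0 ≤ ε := stepFactor_nonneg _ _ _ _ _
  have hγ := H.γ_pos
  set p := picard w z h x with hp
  have hp0 : ∀ j, p j 0 = x := fun j => by cases j <;> simp [hp, picard]
  have hps : ∀ j t, p (j + 1) t = x + selfInt h w (z + p j) t := fun j t => rfl
  have hold : ∀ j, HolderAtScale T γ τ (p j) := fun j => by
    induction j with
    | zero =>
      intro s hs t ht hst hts
      simpa [hp, picard] using rescaled_rpow_nonneg hτ hst
    | succ j ih =>
      intro s hs t ht hst hts
      rw [hps, hps, add_sub_add_left_eq_sub]
      refine (H.selfInt_sub_le hτ ih hn hs ht hst hts).trans ?_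
      exact mul_le_of_le_one_left (rescaled_rpow_nonneg hτ hst) (by linarith)
  -- Geometric decay in the iteration index j, with growth allowed in the window index k. With A =
  -- (1/2)^j 4^k the next iterate has increments at most 3 ε A ≤ A/2, and passing to the next window
  -- gives sup bound 2 A + 4 A ≤ 2 (4 A). The second estimate is `bound`.
  have hclose : ∀ j k : ℕ, CloseAtScale (min (k * τ) T) γ τ (2 * ((1 / 2) ^ j * 4 ^ k))
      ((1 / 2) ^ j * 4 ^ k) (p (j + 1)) (p j) := by
    have bound : ∀ j, (∀ k : ℕ, ∀ s ∈ Icc 0 (min (k * τ) T), ∀ t ∈ Icc 0 (min (k * τ) T),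
        s ≤ t → t - s ≤ τ → ‖(p (j + 1) t - p j t) - (p (j + 1) s - p j s)‖ ≤
          ((1 / 2) ^ j * 4 ^ k) * ((t - s) / τ) ^ γ) →
        ∀ k : ℕ, CloseAtScale (min (k * τ) T) γ τ (2 * ((1 / 2) ^ j * 4 ^ k))
          ((1 / 2) ^ j * 4 ^ k) (p (j + 1)) (p j) := by
      intro j hj k
      refine ⟨by positivity, by positivity, ?_, hj k⟩
      induction k with
      | zero =>
        intro t ht
        have : t = 0 := le_antisymm (ht.2.trans ((min_le_left _ _).trans (by simp))) ht.1
        rw [this, hp0, hp0, sub_self, norm_zero]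
        positivity
      | succ k ih =>
        intro t ht
        refine (norm_le_of_increment (Δ := fun t => p (j + 1) t - p j t) hτ hγ.le
          (le_min (by positivity) hT) ?_ (by positivity) ih (hj (k + 1)) t ht).trans ?_
        · rw [← min_add_add_right]
          exact min_le_min (by push_cast; linarith) (by linarith)
        · have : 0 ≤ (1 / 2 : ℝ) ^ j * 4 ^ k := by positivity
          rw [pow_succ]; nlinarith
    intro j
    induction j with
    | zero =>
      refine bound 0 fun k s hs t ht hst hts => ?_
      have hsT := Icc_subset_Icc_right (min_le_right (k * τ) T) hs
      have htT := Icc_subset_Icc_right (min_le_right (k * τ) T) ht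
      have e0 : (p (0 + 1) t - p 0 t) - (p (0 + 1) s - p 0 s) = p 1 t - p 1 s := by
        have : p 0 t = p 0 s := rfl
        rw [this]; abel
      rw [e0]
      refine (hold 1 s hsT t htT hst hts).trans
        (le_mul_of_one_le_left (rescaled_rpow_nonneg hτ hst) ?_)
      rw [pow_zero, one_mul]
      exact one_le_pow₀ (by norm_num)
    | succ j ih =>
      refine bound (j + 1) fun k s hs t ht hst hts => ?_
      have e1 : (p (j + 1 + 1) t - p (j + 1) t) - (p (j + 1 + 1) s - p (j + 1) s) =
          (selfInt h w (z + p (j + 1)) t - selfInt h w (z + p j) t) -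
          (selfInt h w (z + p (j + 1)) s - selfInt h w (z + p j) s) := by
        simp only [hps _ t, hps _ s]; abel
      rw [e1]
      refine (H.selfInt_diff_sub_le hτ (min_le_right _ _) (hold _) (hold _) (ih k) hn hs ht hst
        hts).trans (mul_le_mul_of_nonneg_right ?_ (rescaled_rpow_nonneg hτ hst))
      have hA : 0 ≤ (1 / 2 : ℝ) ^ j * 4 ^ k := by positivity
      rw [pow_succ]
      nlinarith
  set C : ℝ := 2 * 4 ^ n with hC
  have hstep : ∀ t ∈ Icc 0 T, ∀ j, dist (p j t) (p (j + 1) t) ≤ C * (1 / 2) ^ j := by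
    intro t ht j
    have hc := hclose j n
    rw [min_eq_right hn] at hc
    rw [dist_comm, dist_eq_norm]
    refine (hc.norm_le t ht).trans (le_of_eq ?_)
    rw [hC]; ring
  have hlim : ∀ t, ∃ y, t ∈ Icc 0 T → Tendsto (fun j => p j t) atTop (𝓝 y) := fun t => by
    by_cases ht : t ∈ Icc 0 T
    · obtain ⟨y, hy⟩ := cauchySeq_tendsto_of_complete
        (cauchySeq_of_le_geometric (1 / 2) C (by norm_num) (hstep t ht))
      exact ⟨y, fun _ => hy⟩
    · exact ⟨0, fun h => absurd h ht⟩
  choose θ hθlim using hlim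
  have hθ : HolderAtScale T γ τ θ := fun s hs t ht hst hts =>
    le_of_tendsto' ((hθlim t ht).sub (hθlim s hs)).norm fun j => hold j s hs t ht hst hts
  have hcl : ∀ j, CloseAtScale T γ τ (C * (1 / 2) ^ j / (1 - 1 / 2))
      (C * (1 / 2) ^ j / (1 - 1 / 2)) θ (p j) := by
    intro j
    have hnn : 0 ≤ C * (1 / 2) ^ j / (1 - 1 / 2) := by rw [hC]; positivity
    refine ⟨hnn, hnn, fun t ht => ?_, fun s hs t ht hst hts => ?_⟩
    · rw [← dist_eq_norm, dist_comm]
      exact dist_le_of_le_geometric_of_tendsto (1 / 2) C (by norm_num) (hstep t ht)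
        (hθlim t ht) j
    · set r := ((t - s) / τ) ^ γ with hr
      have hr0 : 0 ≤ r := rescaled_rpow_nonneg hτ hst
      have hd : ∀ j, dist (p j t - p j s) (p (j + 1) t - p (j + 1) s) ≤ C * r * (1 / 2) ^ j := by
        intro j
        have hc := hclose j n
        rw [min_eq_right hn] at hc
        rw [dist_comm, dist_eq_norm, sub_sub_sub_comm]
        refine (hc.norm_sub_le s hs t ht hst hts).trans ?_
        have : 0 ≤ (1 / 2 : ℝ) ^ j * 4 ^ n * r := by positivity
        rw [hC]; nlinarith
      have := dist_le_of_le_geometric_of_tendsto (1 / 2) (C * r) (by norm_num) hd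
        ((hθlim t ht).sub (hθlim s hs)) j
      rw [dist_comm, dist_eq_norm, sub_sub_sub_comm] at this
      refine this.trans (le_of_eq ?_)
      ring
  refine ⟨θ, hθ, ?_⟩
  -- The defect of the limit in the fixed point equation vanishes at 0. Its short increments vanish
  -- as well, because those of the interaction terms of the iterates converge both to those of θ and
  -- to those of the interaction term of θ.
  have hzero := eq_zero_of_locally_const (ψ := fun t => θ t - (x + selfInt h w (z + θ) t)) hτ hn
    ?_ ?_
  · exact fun t ht => sub_eq_zero.1 (hzero t ht)
  · have : θ 0 = x := tendsto_nhds_unique (hθlim 0 ⟨le_rfl, hT⟩)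
      (by simp only [hp0]; exact tendsto_const_nhds)
    simp [this]
  · intro s hs t ht hst hts
    set I := fun θ : ℝ → RSpace d => selfInt h w (z + θ) t - selfInt h w (z + θ) s with hI
    have l1 : Tendsto (fun j => I (p j)) atTop (𝓝 (θ t - θ s)) := by
      have := ((hθlim t ht).sub (hθlim s hs)).comp (tendsto_add_atTop_nat 1)
      refine this.congr fun j => ?_
      simp only [Function.comp, hps, hI]; abel
    have l2 : Tendsto (fun j => I (p j)) atTop (𝓝 (I θ)) := by
      rw [tendsto_iff_norm_sub_tendsto_zero]
      have hb : ∀ j, ‖I (p j) - I θ‖ ≤ ε * (C * (1 / 2) ^ j / (1 - 1 / 2) +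
          C * (1 / 2) ^ j / (1 - 1 / 2)) * ((t - s) / τ) ^ γ := fun j => by
        have := H.selfInt_diff_sub_le hτ le_rfl hθ (hold j) (hcl j) hn hs ht hst hts
        rw [norm_sub_rev]
        refine le_trans (le_of_eq ?_) this
        congr 1; simp only [hI]; abel
      refine squeeze_zero (fun _ => norm_nonneg _) hb ?_
      have h0 : Tendsto (fun j : ℕ => C * (1 / 2 : ℝ) ^ j / (1 - 1 / 2)) atTop (𝓝 0) := by
        have := ((tendsto_pow_atTop_nhds_zero_of_lt_one (r := (1 / 2 : ℝ)) (by norm_num)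
          (by norm_num)).const_mul C).div_const (1 - 1 / 2)
        simpa using this
      have := ((h0.add h0).const_mul ε).mul_const (((t - s) / τ) ^ γ)
      simpa using this
    have := tendsto_nhds_unique l1 l2
    simp only [hI] at this
    have h3 : θ t = θ s + (selfInt h w (z + θ) t - selfInt h w (z + θ) s) := by
      rw [← this]; abel
    simp only [h3]; abel

end FixedPoint

/-! ### Young integrals of averaged fields -/

section YoungIntegral

variable {d : ℕ}

/-- The continuous functions that are square integrable with weight `⟨ξ⟩ |h|`. -/
def pairingDomain (h : RSpace d → CSpace d) : AddSubgroup (RSpace d → ℂ) where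
  carrier := {F | Continuous F ∧ wnorm (absMeasure h) (1 / 2) F < ∞}
  zero_mem' := ⟨continuous_const, by simp⟩
  add_mem' := fun hF hG => ⟨hF.1.add hG.1,
    (wnorm_add_le hF.1 hG.1 _).trans_lt (ENNReal.add_lt_top.2 ⟨hF.2, hG.2⟩)⟩
  neg_mem' := fun {F} hF => ⟨hF.1.neg, by
    have := wnorm_sub_le (ν := absMeasure h) (continuous_const (y := (0 : ℂ))) hF.1 (1 / 2)
    have h2 : wnorm (absMeasure h) (1 / 2) ((fun _ => 0) - F) < ∞ :=
      this.trans_lt (ENNReal.add_lt_top.2 ⟨by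
        change wnorm (absMeasure h) (1 / 2) 0 < ∞
        simp, hF.2⟩)
    rwa [show ((fun _ => 0) - F) = -F by ext; simp] at h2⟩

variable {h : RSpace d → CSpace d} {F F' G G' : RSpace d → ℂ}

theorem integrable_pairing_of_mem (hh : AEStronglyMeasurable h) (hF : F ∈ pairingDomain h)
    (hG : G ∈ pairingDomain h) :
    Integrable fun ξ => (starRingEnd ℂ (F ξ) * G ξ) • h ξ :=
  integrable_pairing hh hF.1 hG.1 ((wnorm_mono (by norm_num)).trans_lt hF.2) hG.2

theorem pairing_sum_left (hh : AEStronglyMeasurable h) {ι : Type*} (s : Finset ι)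
    {F : ι → RSpace d → ℂ} (hF : ∀ i ∈ s, F i ∈ pairingDomain h) (hG : G ∈ pairingDomain h) :
    pairing h (∑ i ∈ s, F i) G = ∑ i ∈ s, pairing h (F i) G := by
  classical
  induction s using Finset.induction_on with
  | empty => simp [pairing]
  | insert i s hi ih =>
    have hs : ∀ j ∈ s, F j ∈ pairingDomain h := fun j hj => hF j (Finset.mem_insert_of_mem hj)
    rw [Finset.sum_insert hi, Finset.sum_insert hi, pairing_add_left
      (integrable_pairing_of_mem hh (hF i (Finset.mem_insert_self i s)) hG)
      (integrable_pairing_of_mem hh (sum_mem hs) hG), ih hs]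

theorem pairing_sum_right (hh : AEStronglyMeasurable h) {ι : Type*} (s : Finset ι)
    {G : ι → RSpace d → ℂ} (hF : F ∈ pairingDomain h) (hG : ∀ i ∈ s, G i ∈ pairingDomain h) :
    pairing h F (∑ i ∈ s, G i) = ∑ i ∈ s, pairing h F (G i) := by
  classical
  induction s using Finset.induction_on with
  | empty => simp [pairing]
  | insert i s hi ih =>
    have hs : ∀ j ∈ s, G j ∈ pairingDomain h := fun j hj => hG j (Finset.mem_insert_of_mem hj)
    rw [Finset.sum_insert hi, Finset.sum_insert hi, pairing_add_right
      (integrable_pairing_of_mem hh hF (hG i (Finset.mem_insert_self i s)))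
      (integrable_pairing_of_mem hh hF (sum_mem hs)), ih hs]

theorem pairing_sub_left (hh : AEStronglyMeasurable h) (hF : F ∈ pairingDomain h)
    (hF' : F' ∈ pairingDomain h) (hG : G ∈ pairingDomain h) :
    pairing h (F - F') G = pairing h F G - pairing h F' G := by
  have := pairing_add_left (integrable_pairing_of_mem hh (sub_mem hF hF') hG)
    (integrable_pairing_of_mem hh hF' hG)
  rw [sub_add_cancel] at this
  rw [this, add_sub_cancel_right]

theorem pairing_sub_right (hh : AEStronglyMeasurable h) (hF : F ∈ pairingDomain h)
    (hG : G ∈ pairingDomain h) (hG' : G' ∈ pairingDomain h) :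
    pairing h F (G - G') = pairing h F G - pairing h F G' := by
  have := pairing_add_right (integrable_pairing_of_mem hh hF (sub_mem hG hG'))
    (integrable_pairing_of_mem hh hF hG')
  rw [sub_add_cancel] at this
  rw [this, add_sub_cancel_right]

theorem wave_mul_mem_pairingDomain (hF : F ∈ pairingDomain h) (x : RSpace d) :
    (fun ξ => wave ξ x) * F ∈ pairingDomain h := by
  refine ⟨(continuous_wave.comp (continuous_id.prodMk continuous_const)).mul hF.1, ?_⟩
  have : wnorm (absMeasure h) (1 / 2) ((fun ξ => wave ξ x) * F) ≤
      ENNReal.ofReal 1 * wnorm (absMeasure h) (1 / 2 + 0) F :=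
    wnorm_le_of_norm_le fun ξ => by simp
  simp only [ENNReal.ofReal_one, one_mul, add_zero] at this
  exact this.trans_lt hF.2

/-- The field `x ↦ Re ∫ exp(2πi⟨ξ, x⟩) conj(f_{t₁}) f_{t₂} h dξ`, where `f` is the oscillatory
integral along `z`. -/
noncomputable def waveField (h : RSpace d → CSpace d) (w : ℝ → ℝ) (z : ℝ → RSpace d) (t₁ t₂ : ℝ)
    (x : RSpace d) : RSpace d :=
  realPart (∫ ξ, (wave ξ x * (starRingEnd ℂ (waveInt w z t₁ ξ) * waveInt w z t₂ ξ)) • h ξ)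

/-- Evaluating at a difference y - x splits the wave into conj(wave ξ x) wave ξ y, one factor for
each time parameter. This is why the convolution structure suits self-interaction. -/
theorem waveField_sub (w : ℝ → ℝ) (z : ℝ → RSpace d) (t₁ t₂ : ℝ) (x y : RSpace d) :
    waveField h w z t₁ t₂ (y - x) =
      pairing h ((fun ξ => wave ξ x) * waveInt w z t₁) ((fun ξ => wave ξ y) * waveInt w z t₂) := by
  unfold waveField pairing
  congr 2; ext1 ξ
  rw [wave_sub, Pi.mul_apply, Pi.mul_apply, map_mul]
  congr 1; ring

variable {T γ a m τ : ℝ} {w : ℝ → ℝ} {z θ : ℝ → RSpace d}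

theorem IsDriver.waveInt_mem (H : IsDriver T γ a m w z h) {t : ℝ} (ht : t ∈ Icc 0 T) :
    waveInt w z t ∈ pairingDomain h := by
  refine ⟨continuous_waveInt H.int H.cont ht, ?_⟩
  have := H.bound 0 (zero_mem_Icc_of_mem ht) t ht ht.1
  rw [waveInt_zero, sub_zero] at this
  exact (wnorm_mono (by linarith [H.a_pos])).trans_lt (this.trans_lt ENNReal.ofReal_lt_top)

theorem IsDriver.waveInt_add_mem (H : IsDriver T γ a m w z h) (hτ : 0 < τ)
    (hθ : HolderAtScale T γ τ θ) {t : ℝ} (ht : t ∈ Icc 0 T) :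
    waveInt w (z + θ) t ∈ pairingDomain h := by
  refine ⟨continuous_waveInt H.int (H.continuousOn_add hτ hθ) ht, ?_⟩
  obtain ⟨n, hn⟩ := exists_nat_ge (T / τ)
  exact (H.wnorm_le hτ hθ ((div_le_iff₀ hτ).1 hn) ht).trans_lt ENNReal.ofReal_lt_top

theorem IsDriver.box_waveField (H : IsDriver T γ a m w z h) {s₁ t₁ s₂ t₂ : ℝ} (hs₁ : s₁ ∈ Icc 0 T)
    (ht₁ : t₁ ∈ Icc 0 T) (hs₂ : s₂ ∈ Icc 0 T) (ht₂ : t₂ ∈ Icc 0 T) (x y : RSpace d) :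
    box (waveField h w z) s₁ s₂ t₁ t₂ (y - x) =
      pairing h ((fun ξ => wave ξ x) * (waveInt w z t₁ - waveInt w z s₁))
        ((fun ξ => wave ξ y) * (waveInt w z t₂ - waveInt w z s₂)) := by
  have m1 := wave_mul_mem_pairingDomain (H.waveInt_mem hs₁) x
  have m2 := wave_mul_mem_pairingDomain (H.waveInt_mem ht₁) x
  have m3 := wave_mul_mem_pairingDomain (H.waveInt_mem hs₂) y
  have m4 := wave_mul_mem_pairingDomain (H.waveInt_mem ht₂) y
  rw [mul_sub, mul_sub, pairing_sub_left H.meas m2 m1 (sub_mem m4 m3),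
    pairing_sub_right H.meas m2 m4 m3, pairing_sub_right H.meas m1 m4 m3]
  simp only [box, Pi.add_apply, Pi.sub_apply, waveField_sub]
  abel

theorem IsPartition.mem_Icc {t : ℝ} {n : ℕ} {c : ℕ → ℝ} (hc : IsPartition t n c) {i : ℕ}
    (hi : i ≤ n) : c i ∈ Icc 0 t := by
  obtain ⟨h0, hn, hmono⟩ := hc
  have up : ∀ k i, i + k ≤ n → c i ≤ c (i + k) := fun k => by
    induction k with
    | zero => intro i _; simp
    | succ k ih => intro i hik; exact (ih i (by omega)).trans (hmono (i + k) (by omega))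
  constructor
  · have := up i 0 (by omega)
    rwa [zero_add, h0] at this
  · have := up (n - i) i (by omega)
    rwa [show i + (n - i) = n by omega, hn] at this

/-- The Riemann sums of the oscillatory integral along `z + θ` with respect to the one along `z`. -/
noncomputable def waveSum (w : ℝ → ℝ) (z θ : ℝ → RSpace d) (n : ℕ) (c : ℕ → ℝ) : RSpace d → ℂ :=
  ∑ i ∈ Finset.range n, (fun ξ => wave ξ (θ (c i))) * (waveInt w z (c (i + 1)) - waveInt w z (c i))

theorem IsDriver.waveSum_mem (H : IsDriver T γ a m w z h) {t : ℝ} (ht : t ∈ Icc 0 T) {n : ℕ}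
    {c : ℕ → ℝ} (hc : IsPartition t n c) : waveSum w z θ n c ∈ pairingDomain h := by
  have hsub : Icc 0 t ⊆ Icc 0 T := Icc_subset_Icc_right ht.2
  refine sum_mem fun i hi => ?_
  have hi := Finset.mem_range.1 hi
  exact wave_mul_mem_pairingDomain (sub_mem (H.waveInt_mem (hsub (hc.mem_Icc (by omega))))
    (H.waveInt_mem (hsub (hc.mem_Icc (by omega))))) _

/-- By `IsDriver.box_waveField` each cell is a pairing of one factor in i with one in j, so
bilinearity collapses the double sum to two one-parameter Riemann sums. -/
theorem IsDriver.riemannSum_eq (H : IsDriver T γ a m w z h) {t₁ t₂ : ℝ} (ht₁ : t₁ ∈ Icc 0 T)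
    (ht₂ : t₂ ∈ Icc 0 T) {n₁ n₂ : ℕ} {c₁ c₂ : ℕ → ℝ} (hc₁ : IsPartition t₁ n₁ c₁)
    (hc₂ : IsPartition t₂ n₂ c₂) :
    riemannSum (waveField h w z) θ n₁ n₂ c₁ c₂ =
      pairing h (waveSum w z θ n₁ c₁) (waveSum w z θ n₂ c₂) := by
  have hsub₁ : Icc 0 t₁ ⊆ Icc 0 T := Icc_subset_Icc_right ht₁.2
  have hsub₂ : Icc 0 t₂ ⊆ Icc 0 T := Icc_subset_Icc_right ht₂.2
  have m1 : ∀ i ∈ Finset.range n₁, c₁ i ∈ Icc 0 T ∧ c₁ (i + 1) ∈ Icc 0 T := fun i hi => by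
    have hi := Finset.mem_range.1 hi
    exact ⟨hsub₁ (hc₁.mem_Icc (by omega)), hsub₁ (hc₁.mem_Icc (by omega))⟩
  have m2 : ∀ i ∈ Finset.range n₂, c₂ i ∈ Icc 0 T ∧ c₂ (i + 1) ∈ Icc 0 T := fun i hi => by
    have hi := Finset.mem_range.1 hi
    exact ⟨hsub₂ (hc₂.mem_Icc (by omega)), hsub₂ (hc₂.mem_Icc (by omega))⟩
  have d2 := H.waveSum_mem (θ := θ) ht₂ hc₂
  conv_rhs => rw [waveSum]
  rw [pairing_sum_left H.meas _ (fun i hi => wave_mul_mem_pairingDomain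
    (sub_mem (H.waveInt_mem (m1 i hi).2) (H.waveInt_mem (m1 i hi).1)) _) d2, riemannSum]
  refine Finset.sum_congr rfl fun i hi => ?_
  rw [waveSum, pairing_sum_right H.meas _ (wave_mul_mem_pairingDomain
    (sub_mem (H.waveInt_mem (m1 i hi).2) (H.waveInt_mem (m1 i hi).1)) _)
    (fun j hj => wave_mul_mem_pairingDomain
      (sub_mem (H.waveInt_mem (m2 j hj).2) (H.waveInt_mem (m2 j hj).1)) _)]
  exact Finset.sum_congr rfl fun j hj =>
    H.box_waveField (m1 i hi).1 (m1 i hi).2 (m2 j hj).1 (m2 j hj).2 _ _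

/-- On each cell the remainder is at most C |cell|^β ≤ C η^{β-1} |cell|, and the lengths of the
cells add up to at most T. Since β > 1 this tends to 0 with the mesh, uniformly over partitions. -/
theorem IsDriver.wnorm_waveSum_sub_le (H : IsDriver T γ a m w z h) (hτ : 0 < τ)
    (hθ : HolderAtScale T γ τ θ) {t η : ℝ} (ht : t ∈ Icc 0 T) (hητ : η ≤ τ) {n : ℕ}
    {c : ℕ → ℝ} (hc : IsPartition t n c) (hmesh : ∀ i < n, c (i + 1) - c i < η) :
    wnorm (absMeasure h) (1 / 2) (waveInt w (z + θ) t - waveSum w z θ n c) ≤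
      ENNReal.ofReal (sewConst (γ * (1 + a)) * (4 * Real.pi ^ 2 * m / τ ^ (γ * a)) *
        η ^ (γ * (1 + a) - 1) * T) := by
  set β := γ * (1 + a)
  set C := sewConst β * (4 * Real.pi ^ 2 * m / τ ^ (γ * a))
  have hC : 0 ≤ C := by
    have := sewConst_pos H.β_gt
    have := H.m_nonneg
    positivity
  have hβ := H.β_gt
  have hsub : Icc 0 t ⊆ Icc 0 T := Icc_subset_Icc_right ht.2
  have hm : ∀ i < n, c i ∈ Icc 0 T ∧ c (i + 1) ∈ Icc 0 T := fun i hi =>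
    ⟨hsub (hc.mem_Icc (by omega)), hsub (hc.mem_Icc (by omega))⟩
  have e : waveInt w (z + θ) t - waveSum w z θ n c =
      ∑ i ∈ Finset.range n, (waveInt w (z + θ) (c (i + 1)) - waveInt w (z + θ) (c i) -
        (fun ξ => wave ξ (θ (c i))) * (waveInt w z (c (i + 1)) - waveInt w z (c i))) := by
    rw [Finset.sum_sub_distrib, Finset.sum_range_sub (fun i => waveInt w (z + θ) (c i)), hc.1,
      hc.2.1, waveInt_zero, sub_zero, waveSum]
  rw [e]
  refine (wnorm_sum_le _ (fun i hi => ?_) _).trans ?_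
  · have hi := Finset.mem_range.1 hi
    exact (((H.waveInt_add_mem hτ hθ (hm i hi).2).1.sub (H.waveInt_add_mem hτ hθ (hm i hi).1).1)).sub
      (wave_mul_mem_pairingDomain (sub_mem (H.waveInt_mem (hm i hi).2)
        (H.waveInt_mem (hm i hi).1)) _).1
  calc _ ≤ ∑ i ∈ Finset.range n, ENNReal.ofReal (C * η ^ (β - 1) * (c (i + 1) - c i)) := by
        refine Finset.sum_le_sum fun i hi => ?_
        have hi := Finset.mem_range.1 hi
        have hle := hc.2.2 i hi
        have hlt := hmesh i hi
        refine (H.wnorm_remainder_le hτ hθ (hm i hi).1 (hm i hi).2 hle (by linarith)).trans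
          (ENNReal.ofReal_le_ofReal ?_)
        rw [mul_assoc C]
        refine mul_le_mul_of_nonneg_left ?_ hC
        have h0 : 0 ≤ c (i + 1) - c i := by linarith
        rcases h0.eq_or_lt with h1 | h1
        · rw [← h1, Real.zero_rpow (by positivity), mul_zero]
        · calc (c (i + 1) - c i) ^ β = (c (i + 1) - c i) ^ (β - 1) * (c (i + 1) - c i) := by
                nth_rewrite 3 [← Real.rpow_one (c (i + 1) - c i)]
                rw [← Real.rpow_add h1, sub_add_cancel]
            _ ≤ _ := by
                refine mul_le_mul_of_nonneg_right ?_ h0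
                exact Real.rpow_le_rpow h0 hlt.le (by linarith)
    _ ≤ _ := by
        rcases Nat.eq_zero_or_pos n with rfl | hn
        · simp
        have hη : 0 ≤ η := by linarith [hmesh 0 hn, hc.2.2 0 hn]
        have h0 : 0 ≤ C * η ^ (β - 1) := by positivity
        rw [← ENNReal.ofReal_sum_of_nonneg fun i hi =>
          mul_nonneg h0 (by linarith [hc.2.2 i (Finset.mem_range.1 hi)]), ← Finset.mul_sum,
          Finset.sum_range_sub, hc.1, hc.2.1, sub_zero]
        exact ENNReal.ofReal_le_ofReal (mul_le_mul_of_nonneg_left ht.2 h0)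

theorem IsDriver.hasYoungIntegral (H : IsDriver T γ a m w z h) (hτ : 0 < τ)
    (hθ : HolderAtScale T γ τ θ) {t₁ t₂ : ℝ} (ht₁ : t₁ ∈ Icc 0 T) (ht₂ : t₂ ∈ Icc 0 T) :
    HasYoungIntegral (waveField h w z) θ t₁ t₂
      (pairing h (waveInt w (z + θ) t₁) (waveInt w (z + θ) t₂)) := by
  intro ε hε
  have hT : 0 ≤ T := ht₁.1.trans ht₁.2
  obtain ⟨N, hN⟩ := exists_nat_ge (T / τ)
  have hN := (div_le_iff₀ hτ).1 hN
  set B := N * (youngConst (γ * (1 + a)) * m * τ ^ γ)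
  have hB : 0 ≤ B := by
    have := youngConst_pos H.β_gt
    have := H.m_nonneg
    positivity
  set C := sewConst (γ * (1 + a)) * (4 * Real.pi ^ 2 * m / τ ^ (γ * a))
  have hC : 0 ≤ C := by
    have := sewConst_pos H.β_gt
    have := H.m_nonneg
    positivity
  have hβ := H.β_gt
  have hlim : Tendsto (fun η : ℝ => C * η ^ (γ * (1 + a) - 1) * T) (𝓝[>] 0) (𝓝 0) := by
    have hc : Continuous fun η : ℝ => C * η ^ (γ * (1 + a) - 1) * T :=
      (continuous_const.mul (Real.continuous_rpow_const (by linarith))).mul continuous_const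
    have := hc.tendsto 0
    rw [Real.zero_rpow (by linarith), mul_zero, zero_mul] at this
    exact this.mono_left nhdsWithin_le_nhds
  -- The total error is at most δ (B + δ) + B δ ≤ δ (2 B + 1) when δ ≤ 1; the 2 in the denominator
  -- leaves room for a strict inequality.
  have hsmall : 0 < min 1 (ε / (2 * B + 2)) := lt_min one_pos (by positivity)
  obtain ⟨η, hη1, hη0, hητ⟩ := ((hlim.eventually_le_const hsmall).and
    (Ioc_mem_nhdsGT hτ)).exists
  set δ := C * η ^ (γ * (1 + a) - 1) * T with hδ
  have hδ0 : 0 ≤ δ := by positivity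
  have hδ1 : δ ≤ 1 := hη1.trans (min_le_left _ _)
  have hδ2 : δ * (2 * B + 2) ≤ ε := (le_div_iff₀ (by positivity)).1 (hη1.trans (min_le_right _ _))
  refine ⟨η, hη0, fun n₁ n₂ c₁ c₂ hc₁ hc₂ hm₁ hm₂ => ?_⟩
  rw [H.riemannSum_eq ht₁ ht₂ hc₁ hc₂]
  have F1 := H.waveInt_add_mem hτ hθ ht₁
  have F2 := H.waveInt_add_mem hτ hθ ht₂
  have R1 := H.waveSum_mem (θ := θ) ht₁ hc₁
  have R2 := H.waveSum_mem (θ := θ) ht₂ hc₂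
  have b1 := H.wnorm_waveSum_sub_le hτ hθ ht₁ hητ hc₁ hm₁
  have b2 := H.wnorm_waveSum_sub_le hτ hθ ht₂ hητ hc₂ hm₂
  have f1 := H.wnorm_le hτ hθ hN ht₁
  have f2 := H.wnorm_le hτ hθ hN ht₂
  rw [← hδ] at b1 b2
  set Φ₁ := waveInt w (z + θ) t₁
  set Φ₂ := waveInt w (z + θ) t₂
  set R₁ := waveSum w z θ n₁ c₁
  set R₂ := waveSum w z θ n₂ c₂
  have r2 : wnorm (absMeasure h) (1 / 2) R₂ ≤ ENNReal.ofReal (B + δ) := by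
    calc _ = wnorm (absMeasure h) (1 / 2) (Φ₂ - (Φ₂ - R₂)) := by rw [sub_sub_cancel]
      _ ≤ _ := SelfInteraction.wnorm_sub_le F2.1 (sub_mem F2 R2).1 _
      _ ≤ ENNReal.ofReal B + ENNReal.ofReal δ := add_le_add f2 b2
      _ = _ := (ENNReal.ofReal_add hB hδ0).symm
  have low : ∀ F : RSpace d → ℂ,
    wnorm (absMeasure h) (-(1 / 2)) F ≤ wnorm (absMeasure h) (1 / 2) F :=
    fun F => wnorm_mono (by norm_num)
  have e : pairing h R₁ R₂ - pairing h Φ₁ Φ₂ =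
      -(pairing h (Φ₁ - R₁) R₂ + pairing h Φ₁ (Φ₂ - R₂)) := by
    rw [pairing_sub_left H.meas F1 R1 R2, pairing_sub_right H.meas F1 F2 R2]; abel
  have p1 := norm_pairing_le H.meas (sub_mem F1 R1).1 R2.1 hδ0 (by positivity)
    ((low _).trans b1) r2
  have p2 := norm_pairing_le H.meas F1.1 (sub_mem F2 R2).1 hB hδ0 ((low _).trans f1) b2
  rw [e, norm_neg]
  refine ((norm_add_le _ _).trans (add_le_add p1 p2)).trans_lt ?_
  rcases hδ0.eq_or_lt with h0 | h0
  · rw [← h0]; simpa using hε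
  · nlinarith

/-- Uniform grids provide partitions of arbitrarily small mesh, so the limit condition is not
vacuous. -/
theorem HasYoungIntegral.unique {A : ℝ → ℝ → RSpace d → RSpace d} {t₁ t₂ : ℝ} {I J : RSpace d}
    (ht₁ : 0 ≤ t₁) (ht₂ : 0 ≤ t₂) (hI : HasYoungIntegral A θ t₁ t₂ I)
    (hJ : HasYoungIntegral A θ t₁ t₂ J) : I = J := by
  by_contra hne
  have hpos : 0 < ‖I - J‖ / 2 := by
    have := norm_pos_iff.2 (sub_ne_zero.2 hne)
    positivity
  obtain ⟨η, hη, h1⟩ := hI _ hpos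
  obtain ⟨η', hη', h2⟩ := hJ _ hpos
  have part : ∀ t, 0 ≤ t → ∃ n, IsPartition t n (gridPoint 0 t n) ∧
      ∀ i < n, gridPoint 0 t n (i + 1) - gridPoint 0 t n i < min η η' := fun t ht => by
    obtain ⟨n, hn0, hn⟩ := ((eventually_gt_atTop 0).and
      ((tendsto_const_div_atTop_nhds_zero_nat t).eventually_lt_const (lt_min hη hη'))).exists
    refine ⟨n, ⟨gridPoint_zero _ _ _, gridPoint_self _ _ hn0,
      fun i _ => gridPoint_monotone ht n (Nat.le_succ i)⟩, fun i _ => ?_⟩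
    rw [gridPoint_succ_sub, sub_zero]
    exact hn
  obtain ⟨n₁, p₁, m₁⟩ := part t₁ ht₁
  obtain ⟨n₂, p₂, m₂⟩ := part t₂ ht₂
  have b1 := h1 n₁ n₂ _ _ p₁ p₂ (fun i hi => (m₁ i hi).trans_le (min_le_left _ _))
    (fun i hi => (m₂ i hi).trans_le (min_le_left _ _))
  have b2 := h2 n₁ n₂ _ _ p₁ p₂ (fun i hi => (m₁ i hi).trans_le (min_le_right _ _))
    (fun i hi => (m₂ i hi).trans_le (min_le_right _ _))
  have := norm_sub_le (riemannSum A θ n₁ n₂ (gridPoint 0 t₁ n₁) (gridPoint 0 t₂ n₂) - J)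
    (riemannSum A θ n₁ n₂ (gridPoint 0 t₁ n₁) (gridPoint 0 t₂ n₂) - I)
  rw [sub_sub_sub_cancel_left] at this
  linarith

end YoungIntegral

/-! ### Fourier functions of tempered distributions -/

section FourierFunction

variable {d : ℕ} {F : Type*} [NormedAddCommGroup F] [NormedSpace ℂ F]
  {f f' : 𝓢'(RSpace d, F)} {g g' : RSpace d → F}

/-- Testing with a smooth bump that equals 1 on a compact set turns integrability of φ g into
integrability of g on that set. -/
theorem HasFourierFunction.locallyIntegrable (hf : HasFourierFunction f g) :
    LocallyIntegrable g := by
  refine (locallyIntegrable_iff).2 fun K hK => ?_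
  obtain ⟨R, hR⟩ := hK.isBounded.subset_closedBall 0
  let φ : ContDiffBump (0 : RSpace d) := ⟨max R 1, max R 1 + 1, by positivity, by linarith⟩
  have hcs : HasCompactSupport fun x => ((φ x : ℝ) : ℂ) := by
    refine φ.hasCompactSupport.comp_left (g := fun r : ℝ => (r : ℂ)) (by simp)
  have hcd : ContDiff ℝ ((⊤ : ℕ∞) : WithTop ℕ∞) fun x => ((φ x : ℝ) : ℂ) :=
    Complex.ofRealCLM.contDiff.comp φ.contDiff
  have hi := (hf (hcs.toSchwartzMap hcd)).1
  refine (hi.integrableOn (s := K)).congr_fun (fun x hx => ?_) hK.measurableSet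
  have hx1 : φ x = 1 := φ.one_of_mem_closedBall
    (Metric.closedBall_subset_closedBall (le_max_left _ _) (hR hx))
  simp [hx1]

theorem HasFourierFunction.congr (hf : HasFourierFunction f g) (h : ∀ ξ, g ξ = g' ξ) :
    HasFourierFunction f g' :=
  (funext h : g = g') ▸ hf

theorem HasFourierFunction.aestronglyMeasurable (hf : HasFourierFunction f g) :
    AEStronglyMeasurable g :=
  hf.locallyIntegrable.aestronglyMeasurable

theorem HasFourierFunction.ae_eq [CompleteSpace F] (hf : HasFourierFunction f g)
    (hf' : HasFourierFunction f g') : g =ᵐ[volume] g' := by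
  let _ : NormedSpace ℝ F := NormedSpace.restrictScalars ℝ ℂ F
  refine ae_eq_of_integral_contDiff_smul_eq hf.locallyIntegrable hf'.locallyIntegrable
    fun φ hφ hφc => ?_
  have hcs : HasCompactSupport fun x => ((φ x : ℝ) : ℂ) :=
    hφc.comp_left (g := fun r : ℝ => (r : ℂ)) (by simp)
  have hcd : ContDiff ℝ ((⊤ : ℕ∞) : WithTop ℕ∞) fun x => ((φ x : ℝ) : ℂ) := Complex.ofRealCLM.contDiff.comp hφ
  have h1 := (hf (hcs.toSchwartzMap hcd)).2
  have h2 := (hf' (hcs.toSchwartzMap hcd)).2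
  have e : ∀ g : RSpace d → F, ∫ x, (hcs.toSchwartzMap hcd) x • g x = ∫ x, φ x • g x := fun g => by
    refine integral_congr_ae (Eventually.of_forall fun x => ?_)
    rfl
  rw [← e, ← e, ← h1, ← h2]

theorem hasFourierFunction_fourierFunction (h : ∃ g, HasFourierFunction f g) :
    HasFourierFunction f (fourierFunction f) := by
  unfold fourierFunction
  rw [dif_pos h]
  exact h.choose_spec

theorem HasFourierFunction.fourierFunction_ae_eq [CompleteSpace F] (hf : HasFourierFunction f g) :
    fourierFunction f =ᵐ[volume] g :=
  (hasFourierFunction_fourierFunction ⟨g, hf⟩).ae_eq hf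

theorem HasFourierFunction.sub (hf : HasFourierFunction f g) (hf' : HasFourierFunction f' g') :
    HasFourierFunction (f - f') (g - g') := by
  intro φ
  obtain ⟨i1, e1⟩ := hf φ
  obtain ⟨i2, e2⟩ := hf' φ
  have e : (fun ξ => φ ξ • (g - g') ξ) = fun ξ => φ ξ • g ξ - φ ξ • g' ξ := by
    ext1 ξ; rw [Pi.sub_apply, smul_sub]
  have h0 : 𝓕 (f - f') φ = 𝓕 f φ - 𝓕 f' φ := by
    simp only [TemperedDistribution.fourier_apply]
    rfl
  rw [e]
  exact ⟨i1.sub i2, by rw [h0, e1, e2, integral_sub i1 i2]⟩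

theorem HasFourierFunction.add (hf : HasFourierFunction f g) (hf' : HasFourierFunction f' g') :
    HasFourierFunction (f + f') (g + g') := by
  intro φ
  obtain ⟨i1, e1⟩ := hf φ
  obtain ⟨i2, e2⟩ := hf' φ
  have e : (fun ξ => φ ξ • (g + g') ξ) = fun ξ => φ ξ • g ξ + φ ξ • g' ξ := by
    ext1 ξ; rw [Pi.add_apply, smul_add]
  have h0 : 𝓕 (f + f') φ = 𝓕 f φ + 𝓕 f' φ := by
    simp only [TemperedDistribution.fourier_apply]
    rfl
  rw [e]
  exact ⟨i1.add i2, by rw [h0, e1, e2, integral_add i1 i2]⟩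

theorem HasFourierFunction.flNorm_eq [CompleteSpace F] (hf : HasFourierFunction f g) (p : ℝ≥0∞)
    (s : ℝ) : flNorm p s f = eLpNorm (fun ξ => japaneseBracket ξ ^ s • g ξ) p volume := by
  unfold flNorm
  rw [if_pos ⟨g, hf⟩]
  refine eLpNorm_congr_ae (hf.fourierFunction_ae_eq.mono fun ξ hξ => ?_)
  simp only [hξ]

theorem MemFL.hasFourierFunction {p : ℝ≥0∞} {s : ℝ} (hf : MemFL p s f) :
    HasFourierFunction f (fourierFunction f) := by
  refine hasFourierFunction_fourierFunction ?_
  by_contra h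
  unfold MemFL flNorm at hf
  rw [if_neg h] at hf
  exact lt_irrefl _ hf

end FourierFunction

/-! ### The Fourier transform of the self-intersection measure -/

section SelfIntersection

variable {d : ℕ}

/-- The Jordan parts of a push-forward need not be the push-forwards of the positive and negative
parts of ρ, since ψ can cause cancellation. The two decompositions nevertheless have the same
difference, which is expressed as an equality of sums of positive measures. -/
theorem integral_jordan_sub {α : Type*} [MeasurableSpace α] {m : Measure α} {ρ : α → ℝ}
    (hρ : Integrable ρ m) {ψ : α → RSpace d} (hψ : Measurable ψ) {φ : RSpace d → ℂ}
    (hφ : Continuous φ) {C : ℝ} (hC : ∀ x, ‖φ x‖ ≤ C) :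
    (∫ x, φ x ∂(SignedMeasure.toJordanDecomposition ((m.withDensityᵥ ρ).map ψ)).posPart) -
      (∫ x, φ x ∂(SignedMeasure.toJordanDecomposition ((m.withDensityᵥ ρ).map ψ)).negPart) =
      ∫ y, (ρ y : ℂ) * φ (ψ y) ∂m := by
  set j := SignedMeasure.toJordanDecomposition ((m.withDensityᵥ ρ).map ψ) with hj
  set P := m.withDensity fun x => ENNReal.ofReal (ρ x)
  set N := m.withDensity fun x => ENNReal.ofReal (-ρ x)
  have : IsFiniteMeasure P := isFiniteMeasure_withDensity_ofReal hρ.2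
  have : IsFiniteMeasure N := isFiniteMeasure_withDensity_ofReal hρ.neg.2
  have key : P.map ψ + j.negPart = N.map ψ + j.posPart := by
    ext A hA
    have h1 := SignedMeasure.apply_eq_posPart_real_sub_negPart_real ((m.withDensityᵥ ρ).map ψ) hA
    rw [← hj, VectorMeasure.map_apply _ hψ hA,
      withDensityᵥ_eq_withDensity_pos_part_sub_withDensity_neg_part hρ,
      Measure.toSignedMeasure_sub_apply (hψ hA)] at h1
    have h2 : (P.map ψ + j.negPart).real A = (N.map ψ + j.posPart).real A := by
      rw [measureReal_add_apply, measureReal_add_apply, map_measureReal_apply hψ hA,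
        map_measureReal_apply hψ hA]
      linarith
    exact (measureReal_eq_measureReal_iff).1 h2
  have hint : ∀ μ : Measure (RSpace d), IsFiniteMeasure μ → Integrable φ μ := fun μ _ =>
    Integrable.of_bound hφ.aestronglyMeasurable C (Eventually.of_forall hC)
  have h3 : ∫ x, φ x ∂(P.map ψ + j.negPart) = ∫ x, φ x ∂(N.map ψ + j.posPart) := by rw [key]
  rw [integral_add_measure (hint _ inferInstance) (hint _ inferInstance),
    integral_add_measure (hint _ inferInstance) (hint _ inferInstance),
    integral_map hψ.aemeasurable hφ.aestronglyMeasurable,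
    integral_map hψ.aemeasurable hφ.aestronglyMeasurable,
    integral_withDensity_eq_integral_toReal_smul₀ hρ.1.aemeasurable.ennreal_ofReal
      (Eventually.of_forall fun _ => ENNReal.ofReal_lt_top),
    integral_withDensity_eq_integral_toReal_smul₀ (f := fun x => ENNReal.ofReal (-ρ x))
      hρ.neg.1.aemeasurable.ennreal_ofReal
      (Eventually.of_forall fun _ => ENNReal.ofReal_lt_top)] at h3
  have hbd : ∀ {r : α → ℝ}, Integrable r m → Integrable (fun y => (r y) • φ (ψ y)) m := fun hr =>
    (hr.ofReal (𝕜 := ℂ)).mul_bdd (c := C)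
      ((hφ.measurable.comp hψ).aestronglyMeasurable) (Eventually.of_forall fun y => hC _) |>.congr
      (Eventually.of_forall fun y => by simp)
  have i1 : Integrable (fun y => (ENNReal.ofReal (ρ y)).toReal • φ (ψ y)) m := by
    refine hbd (hρ.pos_part.congr (Eventually.of_forall fun y => ?_))
    simp [ENNReal.toReal_ofReal']
  have i2 : Integrable (fun y => (ENNReal.ofReal (-ρ y)).toReal • φ (ψ y)) m := by
    refine hbd (hρ.neg_part.congr (Eventually.of_forall fun y => ?_))
    simp [ENNReal.toReal_ofReal']
  have h4 : ∫ y, (ρ y : ℂ) * φ (ψ y) ∂m = (∫ y, (ENNReal.ofReal (ρ y)).toReal • φ (ψ y) ∂m) -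
      ∫ y, (ENNReal.ofReal (-ρ y)).toReal • φ (ψ y) ∂m := by
    rw [← integral_sub i1 i2]
    refine integral_congr_ae (Eventually.of_forall fun y => ?_)
    simp only [ENNReal.toReal_ofReal', ← sub_smul]
    rw [show max (ρ y) 0 - max (-ρ y) 0 = ρ y by
      rcases le_total 0 (ρ y) with h | h
      · rw [max_eq_left h, max_eq_right (by linarith)]; ring
      · rw [max_eq_right h, max_eq_left (by linarith)]; ring]
    simp
  rw [h4]
  linear_combination -h3

/-- Fubini, after rewriting the action of the distribution on the transformed test function as an
integral over the parameter space. -/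
theorem hasFourierFunction_density {α : Type*} [MeasurableSpace α] {m : Measure α} [SFinite m]
    {ρ : α → ℝ} (hρ : Integrable ρ m) {ψ : α → RSpace d} (hψ : Measurable ψ) :
    HasFourierFunction (toDistribution ((m.withDensityᵥ ρ).map ψ))
      (fun ξ => ∫ y, (ρ y : ℂ) * wave ξ (-ψ y) ∂m) := by
  intro φ
  have hmeas : AEStronglyMeasurable (fun p : RSpace d × α => wave p.1 (-ψ p.2))
      (volume.prod m) :=
    (continuous_wave.measurable.comp
      (measurable_fst.prodMk (hψ.comp measurable_snd).neg)).aestronglyMeasurable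
  have hint : Integrable (fun p : RSpace d × α => φ p.1 * ((ρ p.2 : ℂ) * wave p.1 (-ψ p.2)))
      (volume.prod m) := by
    have h1 : Integrable (fun p : RSpace d × α => φ p.1 * (ρ p.2 : ℂ)) (volume.prod m) :=
      φ.integrable.mul_prod hρ.ofReal
    refine (h1.mul_bdd (c := 1) hmeas (Eventually.of_forall fun p => by simp)).congr
      (Eventually.of_forall fun p => by simp only; ring)
  have e : ∀ ξ, φ ξ • ∫ y, (ρ y : ℂ) * wave ξ (-ψ y) ∂m =
      ∫ y, φ ξ * ((ρ y : ℂ) * wave ξ (-ψ y)) ∂m := fun ξ => by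
    rw [smul_eq_mul, ← integral_const_mul]
  simp_rw [e]
  refine ⟨hint.integral_prod_left, ?_⟩
  have hF : Continuous (𝓕 φ : 𝓢(RSpace d, ℂ)) := (𝓕 φ).continuous
  obtain ⟨C, hC⟩ : ∃ C, ∀ x, ‖(𝓕 φ) x‖ ≤ C :=
    ⟨_, fun x => (𝓕 φ).norm_le_seminorm ℝ x⟩
  have h1 : 𝓕 (toDistribution ((m.withDensityᵥ ρ).map ψ)) φ =
      ∫ y, (ρ y : ℂ) * (𝓕 φ) (ψ y) ∂m := by
    rw [← integral_jordan_sub hρ hψ hF hC]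
    rfl
  rw [h1, integral_integral_swap hint]
  refine integral_congr_ae (Eventually.of_forall fun y => ?_)
  simp only
  rw [SchwartzMap.fourier_coe, Real.fourier_eq, ← integral_const_mul]
  refine integral_congr_ae (Eventually.of_forall fun ξ => ?_)
  simp only [wave, inner_neg_right, Circle.smul_def, smul_eq_mul]
  ring

variable {T : ℝ} {w : ℝ → ℝ} {z : ℝ → RSpace d}

theorem intervalIntegrable_of_memLp (hT : 0 ≤ T) (hw : MemLp w ∞ (volume.restrict (Icc 0 T))) :
    IntervalIntegrable w volume 0 T := by
  rw [intervalIntegrable_iff_integrableOn_Icc_of_le hT]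
  exact hw.integrable le_top

theorem clamp_of_mem {r : ℝ} (hr : r ∈ Icc 0 T) : clamp T r = r := by
  unfold clamp
  rw [min_eq_right hr.2, max_eq_right hr.1]

/-- The product weight and the difference z_{r₂} - z_{r₁} make the integrand a product of a function
of r₁ and one of r₂. The whole two-parameter theory reduces to one parameter here. -/
theorem integral_wave_prod (ξ : RSpace d) {t₁ t₂ : ℝ}
    (ht₁ : t₁ ∈ Icc 0 T) (ht₂ : t₂ ∈ Icc 0 T) :
    ∫ r : ℝ × ℝ, ((w r.1 * w r.2 : ℝ) : ℂ) * wave ξ (z (clamp T r.2) - z (clamp T r.1))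
      ∂(volume.restrict (Ioc 0 t₁ ×ˢ Ioc 0 t₂)) =
      starRingEnd ℂ (waveInt w z t₁ ξ) * waveInt w z t₂ ξ := by
  rw [Measure.volume_eq_prod, ← Measure.prod_restrict]
  have e : ∀ r : ℝ × ℝ, ((w r.1 * w r.2 : ℝ) : ℂ) * wave ξ (z (clamp T r.2) - z (clamp T r.1)) =
      starRingEnd ℂ ((w r.1 : ℂ) * wave ξ (z (clamp T r.1))) *
        ((w r.2 : ℂ) * wave ξ (z (clamp T r.2))) := fun r => by
    rw [wave_sub, map_mul, Complex.conj_ofReal]; push_cast; ring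
  have hcl : ∀ t ∈ Icc 0 T, ∫ r in Ioc 0 t, (w r : ℂ) * wave ξ (z (clamp T r)) =
      waveInt w z t ξ := fun t ht => by
    rw [waveInt, intervalIntegral.integral_of_le ht.1]
    refine setIntegral_congr_fun measurableSet_Ioc fun r hr => ?_
    rw [clamp_of_mem ⟨hr.1.le, hr.2.trans ht.2⟩]
  refine (integral_congr_ae (Eventually.of_forall e)).trans ?_
  rw [integral_prod_mul (fun r => starRingEnd ℂ ((w r : ℂ) * wave ξ (z (clamp T r))))
    (fun r => (w r : ℂ) * wave ξ (z (clamp T r))), integral_conj, hcl t₁ ht₁, hcl t₂ ht₂]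

theorem hasFourierFunction_selfIntersectionMeasure
    (hw : MemLp w ∞ (volume.restrict (Icc 0 T))) (hz : ContinuousOn z (Icc 0 T)) {t₁ t₂ : ℝ}
    (ht₁ : t₁ ∈ Icc 0 T) (ht₂ : t₂ ∈ Icc 0 T) :
    HasFourierFunction (toDistribution (selfIntersectionMeasure T w z t₁ t₂))
      (fun ξ => waveInt w z t₁ ξ * starRingEnd ℂ (waveInt w z t₂ ξ)) := by
  have hT := ht₁.1.trans ht₁.2
  have := hasFourierFunction_density (integrable_weight hw ht₁ ht₂) (measurable_clamped hT hz)
  refine this.congr fun ξ => ?_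
  have h2 := congrArg (starRingEnd ℂ)
    (integral_wave_prod (w := w) (z := z) ξ ht₁ ht₂)
  rw [map_mul, Complex.conj_conj, ← integral_conj] at h2
  rw [← h2]
  refine integral_congr_ae (Eventually.of_forall fun r => ?_)
  simp only [map_mul, Complex.conj_ofReal, wave_neg]

theorem hasFourierFunction_reflect
    (hw : MemLp w ∞ (volume.restrict (Icc 0 T))) (hz : ContinuousOn z (Icc 0 T)) {t₁ t₂ : ℝ}
    (ht₁ : t₁ ∈ Icc 0 T) (ht₂ : t₂ ∈ Icc 0 T) :
    HasFourierFunction (toDistribution (reflect (selfIntersectionMeasure T w z t₁ t₂)))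
      (fun ξ => starRingEnd ℂ (waveInt w z t₁ ξ) * waveInt w z t₂ ξ) := by
  have hT := ht₁.1.trans ht₁.2
  have hm := measurable_clamped hT hz
  have := hasFourierFunction_density (integrable_weight hw ht₁ ht₂) hm.neg
  have e : reflect (selfIntersectionMeasure T w z t₁ t₂) =
      ((volume.restrict (Ioc 0 t₁ ×ˢ Ioc 0 t₂)).withDensityᵥ fun r : ℝ × ℝ => w r.1 * w r.2).map
        (-fun r : ℝ × ℝ => z (clamp T r.2) - z (clamp T r.1)) := by
    refine VectorMeasure.ext fun A hA => ?_
    rw [reflect, selfIntersectionMeasure, VectorMeasure.map_apply _ measurable_neg hA,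
      VectorMeasure.map_apply _ hm (measurable_neg hA), VectorMeasure.map_apply _ hm.neg hA]
    rfl
  rw [e]
  refine this.congr fun ξ => ?_
  rw [← integral_wave_prod (w := w) (z := z) ξ ht₁ ht₂]
  simp

/-- The convolution uses a chosen representative of the Fourier transform of the reflected measure,
which agrees with the explicit one only almost everywhere; the integral does not see the difference.
The identity holds only for times in [0,T]. -/
theorem averagedField_eq_waveField
    (hw : MemLp w ∞ (volume.restrict (Icc 0 T))) (hz : ContinuousOn z (Icc 0 T))
    (b : 𝓢'(RSpace d, CSpace d)) {t₁ t₂ : ℝ} (ht₁ : t₁ ∈ Icc 0 T) (ht₂ : t₂ ∈ Icc 0 T) :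
    averagedField T w z b t₁ t₂ = waveField (fourierFunction b) w z t₁ t₂ := by
  ext1 x
  rw [averagedField, waveField, convolution, Real.fourierInv_eq]
  congr 1
  refine integral_congr_ae
    ((hasFourierFunction_reflect hw hz ht₁ ht₂).fourierFunction_ae_eq.mono fun ξ hξ => ?_)
  simp only [hξ, wave, Circle.smul_def, smul_smul]

end SelfIntersection

/-! ### Fourier-Lebesgue regularity yields a driver -/

section DriverOfFL

variable {d : ℕ} {T γ a δ κ : ℝ} {w : ℝ → ℝ} {z : ℝ → RSpace d} {q q' : ℝ≥0∞}

theorem wnorm_le_of_lintegral_le {h : RSpace d → CSpace d} (hh : AEStronglyMeasurable h)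
    {F : RSpace d → ℂ} (hF : Continuous F) {σ m : ℝ} (hm : 0 ≤ m)
    (hle : ∫⁻ ξ, ‖japaneseBracket ξ ^ (2 * σ) • (F ξ * starRingEnd ℂ (F ξ))‖ₑ * ‖h ξ‖ₑ ≤
      ENNReal.ofReal (m ^ 2)) : wnorm (absMeasure h) σ F ≤ ENNReal.ofReal m := by
  have e : ∫⁻ ξ, ‖japaneseBracket ξ ^ σ • F ξ‖ₑ ^ (2 : ℝ) ∂(absMeasure h) =
      ∫⁻ ξ, ‖japaneseBracket ξ ^ (2 * σ) • (F ξ * starRingEnd ℂ (F ξ))‖ₑ * ‖h ξ‖ₑ := by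
    rw [absMeasure, lintegral_withDensity_eq_lintegral_mul₀ hh.enorm
      ((continuous_weight_smul hF σ).enorm.measurable.pow_const _).aemeasurable]
    refine lintegral_congr fun ξ => ?_
    have hJ := japaneseBracket_pos ξ
    rw [Pi.mul_apply, mul_comm]
    congr 1
    rw [two_mul, Real.rpow_add hJ, show (2 : ℝ) = ((2 : ℕ) : ℝ) by norm_num, ENNReal.rpow_natCast,
      sq, ← enorm_mul]
    have : ∀ x y : ℂ, ‖x‖ = ‖y‖ → ‖x‖ₑ = ‖y‖ₑ := fun x y hxy => by
      rw [← ofReal_norm, ← ofReal_norm, hxy]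
    refine this _ _ ?_
    simp only [norm_mul, norm_smul, RCLike.norm_conj]
    ring
  rw [wnorm, eLpNorm_eq_lintegral_rpow_enorm_toReal (by norm_num) (by norm_num)]
  simp only [ENNReal.toReal_ofNat]
  rw [e]
  calc _ ≤ (ENNReal.ofReal (m ^ 2)) ^ (1 / (2 : ℝ)) := by gcongr
    _ = ENNReal.ofReal m := by
      rw [ENNReal.ofReal_rpow_of_nonneg (by positivity) (by norm_num), ← Real.sqrt_eq_rpow,
        Real.sqrt_sq hm]

/-- The part of the two-parameter regularity of the self-intersection measure that is used: the
increments over squares on the diagonal. -/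
theorem eLpNorm_waveInt_sub_sq_le (hw : MemLp w ∞ (volume.restrict (Icc 0 T)))
    (hz : ContinuousOn z (Icc 0 T)) {C : ℝ≥0}
    (hC : ∀ s₁ ∈ Icc 0 T, ∀ t₁ ∈ Icc 0 T, ∀ s₂ ∈ Icc 0 T, ∀ t₂ ∈ Icc 0 T,
      flNorm q κ (box (fun t₁ t₂ => toDistribution (selfIntersectionMeasure T w z t₁ t₂))
        s₁ s₂ t₁ t₂) ≤ C * ENNReal.ofReal (|t₁ - s₁| ^ γ * |t₂ - s₂| ^ γ))
    {s t : ℝ} (hs : s ∈ Icc 0 T) (ht : t ∈ Icc 0 T) :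
    eLpNorm (fun ξ => japaneseBracket ξ ^ κ • ((waveInt w z t - waveInt w z s) ξ *
      starRingEnd ℂ ((waveInt w z t - waveInt w z s) ξ))) q volume ≤
      C * ENNReal.ofReal (|t - s| ^ γ * |t - s| ^ γ) := by
  have h := hC s hs t ht s hs t ht
  have hf := (((hasFourierFunction_selfIntersectionMeasure hw hz ht ht).sub
    (hasFourierFunction_selfIntersectionMeasure hw hz ht hs)).sub
    (hasFourierFunction_selfIntersectionMeasure hw hz hs ht)).add
    (hasFourierFunction_selfIntersectionMeasure hw hz hs hs)
  rw [box, hf.flNorm_eq] at h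
  refine le_trans (le_of_eq ?_) h
  congr 1
  ext1 ξ
  congr 1
  simp only [Pi.add_apply, Pi.sub_apply, map_sub]
  ring

/-- The squared weighted norm of an increment of f is ∫ ⟨ξ⟩^{1+2a} |f_t - f_s|² |h|. Since 1 + 2a ≤
κ + δ, Hölder's inequality bounds it by the norm of the diagonal square increment of G times that of
b, that is, by C (t - s)^{2γ} M. -/
theorem isDriver_of_flNorm_le (hT : 0 ≤ T) (hw : MemLp w ∞ (volume.restrict (Icc 0 T)))
    (hz : ContinuousOn z (Icc 0 T)) (hqq' : 1 / q + 1 / q' = 1) (ha : 0 < a) (ha' : a ≤ 1)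
    (hγ : 0 < γ) (hβ : 1 < γ * (1 + a)) (haδκ : 1 + 2 * a ≤ δ + κ) {C : ℝ≥0}
    (hC : ∀ s₁ ∈ Icc 0 T, ∀ t₁ ∈ Icc 0 T, ∀ s₂ ∈ Icc 0 T, ∀ t₂ ∈ Icc 0 T,
      flNorm q κ (box (fun t₁ t₂ => toDistribution (selfIntersectionMeasure T w z t₁ t₂))
        s₁ s₂ t₁ t₂) ≤ C * ENNReal.ofReal (|t₁ - s₁| ^ γ * |t₂ - s₂| ^ γ))
    {b : 𝓢'(RSpace d, CSpace d)} {h : RSpace d → CSpace d} (hb : HasFourierFunction b h)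
    {M : ℝ} (hM : 0 ≤ M) (hbM : flNorm q' δ b ≤ ENNReal.ofReal M) :
    IsDriver T γ a (Real.sqrt (C * M)) w z h := by
  have hwi := intervalIntegrable_of_memLp hT hw
  refine ⟨hb.aestronglyMeasurable, hwi, hz, ha, ha', hγ, hβ, Real.sqrt_nonneg _,
    fun s hs t ht hst => ?_⟩
  have hts : 0 ≤ t - s := by linarith
  set F := waveInt w z t - waveInt w z s with hF
  have hFc : Continuous F := (continuous_waveInt hwi hz ht).sub (continuous_waveInt hwi hz hs)
  have h1 := eLpNorm_waveInt_sub_sq_le hw hz hC hs ht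
  rw [hb.flNorm_eq] at hbM
  have : ENNReal.HolderTriple q q' 1 := ⟨by simpa using hqq'⟩
  have hG : Continuous fun ξ => F ξ * starRingEnd ℂ (F ξ) :=
    hFc.mul (Complex.continuous_conj.comp hFc)
  have hh1 : AEStronglyMeasurable (fun ξ => japaneseBracket ξ ^ δ • h ξ) volume :=
    (continuous_japaneseBracket_rpow δ).aestronglyMeasurable.smul hb.aestronglyMeasurable
  have hold := eLpNorm_smul_le_mul_eLpNorm (μ := (volume : Measure (RSpace d))) (p := q) (q := q')
    (r := 1) hh1 (continuous_weight_smul hG κ).aestronglyMeasurable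
  rw [eLpNorm_one_eq_lintegral_enorm] at hold
  refine wnorm_le_of_lintegral_le hb.aestronglyMeasurable hFc (by positivity) ?_
  calc _ ≤ ∫⁻ ξ, ‖((fun ξ => japaneseBracket ξ ^ κ • (F ξ * starRingEnd ℂ (F ξ))) •
        (fun ξ => japaneseBracket ξ ^ δ • h ξ)) ξ‖ₑ := by
        refine lintegral_mono fun ξ => ?_
        have hJ := japaneseBracket_pos ξ
        simp only [Pi.smul_apply', enorm_smul]
        rw [show ∀ x y z v : ℝ≥0∞, x * y * (z * v) = (x * z) * y * v from fun x y z v => by ring,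
          ← enorm_mul, ← Real.rpow_add hJ]
        gcongr ?_ * _ * _
        rw [Real.enorm_of_nonneg (by positivity), Real.enorm_of_nonneg (by positivity)]
        exact ENNReal.ofReal_le_ofReal
          (Real.rpow_le_rpow_of_exponent_le (one_le_japaneseBracket ξ) (by linarith))
    _ ≤ _ := hold
    _ ≤ (C * ENNReal.ofReal (|t - s| ^ γ * |t - s| ^ γ)) * ENNReal.ofReal M := by gcongr
    _ = _ := by
      rw [← ENNReal.ofReal_coe_nnreal, ← ENNReal.ofReal_mul (by positivity),
        ← ENNReal.ofReal_mul (by positivity), abs_of_nonneg hts, mul_pow,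
        Real.sq_sqrt (by positivity)]
      congr 1; ring

end DriverOfFL

/-! ### Spatial regularity -/

section Spatial

variable {d : ℕ}

/-- The componentwise real part as a continuous linear map. -/
noncomputable def realPartL : CSpace d →L[ℝ] RSpace d :=
  LinearMap.mkContinuous
    { toFun := realPart
      map_add' := realPart_add
      map_smul' := fun c v => by ext i; simp [realPart] } 1
    fun v => by simpa using norm_realPart_le v

theorem realPartL_apply (v : CSpace d) : realPartL v = realPart v := rfl

theorem norm_realPartL_le : ‖(realPartL : CSpace d →L[ℝ] RSpace d)‖ ≤ 1 :=
  LinearMap.mkContinuous_norm_le _ zero_le_one _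

theorem integral_wave_smul_eq (k : RSpace d → CSpace d) (x : RSpace d) :
    ∫ ξ, wave ξ x • k ξ = 𝓕 k (-x) := by
  rw [Real.fourier_eq]
  refine integral_congr_ae (Eventually.of_forall fun ξ => ?_)
  simp only [inner_neg_right, neg_neg, wave, Circle.smul_def]

/-- The norm on `C_b^{1+a}` of the real part of `∫ exp(2πi⟨ξ, ·⟩) k(ξ) dξ`. -/
theorem spatialNorm_realPart_integral_le {a : ℝ} (ha : 0 < a) (ha' : a ≤ 1)
    {k : RSpace d → CSpace d} (hk : AEStronglyMeasurable k) {M : ℝ} (hM : 0 ≤ M)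
    (hkM : ∫⁻ ξ, ‖japaneseBracket ξ ^ (1 + a) • k ξ‖ₑ ≤ ENNReal.ofReal M) :
    spatialNorm a (fun x => realPart (∫ ξ, wave ξ x • k ξ)) ≤
      ENNReal.ofReal ((1 + 2 * Real.pi + 4 * Real.pi ^ 2) * M) := by
  have hw : Integrable fun ξ => japaneseBracket ξ ^ (1 + a) • k ξ :=
    ⟨(continuous_japaneseBracket_rpow _).aestronglyMeasurable.smul hk,
      hkM.trans_lt ENNReal.ofReal_lt_top⟩
  have hI : ∫ ξ, japaneseBracket ξ ^ (1 + a) * ‖k ξ‖ ≤ M := by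
    have e : ∀ ξ, japaneseBracket ξ ^ (1 + a) * ‖k ξ‖ = ‖japaneseBracket ξ ^ (1 + a) • k ξ‖ :=
      fun ξ => by
        rw [norm_smul, Real.norm_of_nonneg (Real.rpow_nonneg (japaneseBracket_pos ξ).le _)]
    simp_rw [e]
    rw [integral_norm_eq_lintegral_enorm hw.1]
    exact ENNReal.toReal_le_of_le_ofReal hM hkM
  have hwn : Integrable fun ξ => japaneseBracket ξ ^ (1 + a) * ‖k ξ‖ :=
    hw.norm.congr (Eventually.of_forall fun ξ => by
      simp only [norm_smul, Real.norm_of_nonneg (Real.rpow_nonneg (japaneseBracket_pos ξ).le _)])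
  have hpow : ∀ ξ : RSpace d, japaneseBracket ξ ^ (1 + a) =
      japaneseBracket ξ * japaneseBracket ξ ^ a := fun ξ => by
    rw [Real.rpow_add (japaneseBracket_pos ξ), Real.rpow_one]
  have hge : ∀ ξ : RSpace d, 1 ≤ japaneseBracket ξ ^ a := fun ξ =>
    Real.one_le_rpow (one_le_japaneseBracket ξ) ha.le
  have hge1 : ∀ ξ : RSpace d, ‖ξ‖ ≤ japaneseBracket ξ ^ (1 + a) := fun ξ => by
    rw [hpow]
    nlinarith [norm_le_japaneseBracket ξ, hge ξ, japaneseBracket_pos ξ]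
  have hge0 : ∀ ξ : RSpace d, 1 ≤ japaneseBracket ξ ^ (1 + a) := fun ξ =>
    Real.one_le_rpow (one_le_japaneseBracket ξ) (by linarith)
  have hki : Integrable k := by
    refine hwn.mono' hk (Eventually.of_forall fun ξ => ?_)
    exact le_mul_of_one_le_left (norm_nonneg _) (hge0 ξ)
  have hk1 : Integrable fun ξ => ‖ξ‖ * ‖k ξ‖ := by
    refine hwn.mono' (continuous_norm.aestronglyMeasurable.mul hk.norm)
      (Eventually.of_forall fun ξ => ?_)
    rw [Real.norm_of_nonneg (by positivity)]
    exact mul_le_mul_of_nonneg_right (hge1 ξ) (norm_nonneg _)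
  -- Differentiation under the integral multiplies by ξ; the Hölder bound on the derivative then
  -- spends the remaining ⟨ξ⟩^a on a difference of waves.
  set k' : RSpace d → RSpace d →L[ℝ] CSpace d :=
    VectorFourier.fourierSMulRight (innerSL ℝ) k with hk'
  have hk'n : ∀ ξ, ‖k' ξ‖ ≤ 2 * Real.pi * (‖ξ‖ * ‖k ξ‖) := fun ξ => by
    rw [hk', VectorFourier.norm_fourierSMulRight, innerSL_apply_norm]
    exact le_of_eq (by ring)
  have hk'm : AEStronglyMeasurable k' := hk.fourierSMulRight
  have hk'i : Integrable k' := (hk1.const_mul _).mono' hk'm (Eventually.of_forall hk'n)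
  have hV : (fun x => realPart (∫ ξ, wave ξ x • k ξ)) = fun x => realPartL (𝓕 k (-x)) := by
    ext1 x
    rw [integral_wave_smul_eq]; rfl
  have hC : ContDiff ℝ 1 fun x => realPartL (𝓕 k (-x)) := by
    refine realPartL.contDiff.comp ((Real.contDiff_fourier (N := 1) fun n hn => ?_).comp
      contDiff_neg)
    have hn' : n ≤ 1 := by exact_mod_cast hn
    interval_cases n
    · simpa using hki.norm
    · simpa using hk1
  have hD : ∀ x, fderiv ℝ (fun x => realPartL (𝓕 k (-x))) x =
      realPartL.comp (-(∫ ξ, wave ξ x • k' ξ)) := fun x => by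
    have h1 : HasFDerivAt (𝓕 k) (𝓕 k' (-x)) (-x) := Real.hasFDerivAt_fourier hki hk1 (-x)
    have h2 : HasFDerivAt (fun y : RSpace d => -y) (-ContinuousLinearMap.id ℝ (RSpace d)) x :=
      (hasFDerivAt_id x).neg
    have h3 := (realPartL.hasFDerivAt.comp x (h1.comp x h2)).fderiv
    refine h3.trans ?_
    congr 1
    have h4 : 𝓕 k' (-x) = ∫ ξ, wave ξ x • k' ξ := by
      rw [Real.fourier_eq]
      refine integral_congr_ae (Eventually.of_forall fun ξ => ?_)
      simp only [inner_neg_right, neg_neg, wave, Circle.smul_def]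
    rw [h4]
    ext v
    simp
  have hwi : ∀ x, Integrable fun ξ => wave ξ x • k' ξ := fun x =>
    hk'i.norm.mono' ((continuous_wave.comp (continuous_id.prodMk
      continuous_const)).aestronglyMeasurable.smul hk'm)
      (Eventually.of_forall fun ξ => by rw [norm_smul, norm_wave, one_mul])
  have hcomp : ∀ A : RSpace d →L[ℝ] CSpace d, ‖realPartL.comp A‖ ≤ ‖A‖ := fun A =>
    (ContinuousLinearMap.opNorm_comp_le _ _).trans
      (mul_le_of_le_one_left (norm_nonneg _) norm_realPartL_le)
  have b0 : ∀ x, ‖realPartL (𝓕 k (-x))‖ ≤ M := fun x => by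
    refine (norm_realPart_le _).trans ?_
    rw [← integral_wave_smul_eq]
    refine (norm_integral_le_of_norm_le hwn (Eventually.of_forall fun ξ => ?_)).trans hI
    rw [norm_smul, norm_wave]
    exact mul_le_mul_of_nonneg_right (hge0 ξ) (norm_nonneg _)
  have b1 : ∀ x, ‖fderiv ℝ (fun x => realPartL (𝓕 k (-x))) x‖ ≤ 2 * Real.pi * M := fun x => by
    rw [hD]
    refine (hcomp _).trans ?_
    rw [norm_neg]
    refine (norm_integral_le_of_norm_le (hwn.const_mul (2 * Real.pi))
      (Eventually.of_forall fun ξ => ?_)).trans ?_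
    · rw [norm_smul, norm_wave, one_mul]
      refine (hk'n ξ).trans ?_
      gcongr
      exact hge1 ξ
    · rw [integral_const_mul]; gcongr
  have b2 : ∀ x y, ‖fderiv ℝ (fun x => realPartL (𝓕 k (-x))) x -
      fderiv ℝ (fun x => realPartL (𝓕 k (-x))) y‖ ≤ 4 * Real.pi ^ 2 * M * ‖x - y‖ ^ a :=
    fun x y => by
    rw [hD, hD, ← ContinuousLinearMap.comp_sub]
    refine (hcomp _).trans ?_
    rw [show ∀ A B : RSpace d →L[ℝ] CSpace d, ‖-A - -B‖ = ‖A - B‖ from fun A B => by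
      rw [← norm_neg]; congr 1; abel, ← integral_sub (hwi x) (hwi y)]
    refine (norm_integral_le_of_norm_le (hwn.const_mul (4 * Real.pi ^ 2 * ‖x - y‖ ^ a))
      (Eventually.of_forall fun ξ => ?_)).trans ?_
    · rw [show wave ξ x • k' ξ - wave ξ y • k' ξ = (wave ξ x - wave ξ y) • k' ξ from
        ContinuousLinearMap.ext fun v => (sub_smul (wave ξ x) (wave ξ y) (k' ξ v)).symm,
        norm_smul, hpow]
      refine (mul_le_mul (norm_wave_sub_wave_le_rpow ha.le ha' ξ x y) (hk'n ξ) (norm_nonneg _)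
        (by have := japaneseBracket_pos ξ; positivity)).trans ?_
      have := japaneseBracket_pos ξ
      calc _ = 4 * Real.pi ^ 2 * ‖x - y‖ ^ a * (‖ξ‖ * japaneseBracket ξ ^ a * ‖k ξ‖) := by ring
        _ ≤ _ := by gcongr; exact norm_le_japaneseBracket ξ
    · rw [integral_const_mul]
      calc _ ≤ 4 * Real.pi ^ 2 * ‖x - y‖ ^ a * M := by gcongr
        _ = _ := by ring
  rw [hV, spatialNorm, if_pos hC]
  have hpi := Real.pi_pos
  have hsum : ENNReal.ofReal ((1 + 2 * Real.pi + 4 * Real.pi ^ 2) * M) =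
      ENNReal.ofReal M + ENNReal.ofReal (2 * Real.pi * M) +
        ENNReal.ofReal (4 * Real.pi ^ 2 * M) := by
    rw [← ENNReal.ofReal_add hM (by positivity), ← ENNReal.ofReal_add (by positivity)
      (by positivity)]
    congr 1; ring
  rw [hsum]
  refine add_le_add (add_le_add (iSup_le fun x => ?_) (iSup_le fun x => ?_))
    (iSup_le fun x => iSup_le fun y => iSup_le fun hxy => ?_)
  · rw [← ofReal_norm]; exact ENNReal.ofReal_le_ofReal (b0 x)
  · rw [← ofReal_norm]; exact ENNReal.ofReal_le_ofReal (b1 x)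
  · refine ENNReal.div_le_of_le_mul ?_
    rw [← ofReal_norm, ← ENNReal.ofReal_mul (by positivity)]
    exact ENNReal.ofReal_le_ofReal (b2 x y)

/-- The weight ⟨ξ⟩^{1+a} is at most ⟨ξ⟩^{1+2a}, which is shared equally between F and G. The
unperturbed field thus has spatial regularity 1 + a, as the notion of solution requires. -/
theorem spatialNorm_pairing_le {a : ℝ} (ha : 0 < a) (ha' : a ≤ 1) {h : RSpace d → CSpace d}
    (hh : AEStronglyMeasurable h) {F G : RSpace d → ℂ} (hF : Continuous F) (hG : Continuous G)
    {A B : ℝ} (hA : 0 ≤ A) (hB : 0 ≤ B)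
    (h1 : wnorm (absMeasure h) (1 / 2 + a) F ≤ ENNReal.ofReal A)
    (h2 : wnorm (absMeasure h) (1 / 2 + a) G ≤ ENNReal.ofReal B) :
    spatialNorm a (fun x => realPart (∫ ξ, (wave ξ x * (starRingEnd ℂ (F ξ) * G ξ)) • h ξ)) ≤
      ENNReal.ofReal ((1 + 2 * Real.pi + 4 * Real.pi ^ 2) * (A * B)) := by
  simp_rw [mul_smul (wave _ _)]
  refine spatialNorm_realPart_integral_le ha ha' (aestronglyMeasurable_pairing hh hF hG)
    (by positivity) ?_
  set s : ℝ := 1 / 2 + a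
  have hw0 : ∀ F : RSpace d → ℂ, wnorm (absMeasure h) 0 (fun ξ => japaneseBracket ξ ^ s • F ξ) =
      wnorm (absMeasure h) s F := fun F => by simp [wnorm]
  have key := lintegral_pairing_le hh (continuous_weight_smul hF s) (continuous_weight_smul hG s) 0
  rw [neg_zero, hw0, hw0] at key
  calc _ ≤ ∫⁻ ξ, ‖(starRingEnd ℂ (japaneseBracket ξ ^ s • F ξ) *
        (japaneseBracket ξ ^ s • G ξ)) • h ξ‖ₑ := by
        refine lintegral_mono fun ξ => ?_
        have hJ := japaneseBracket_pos ξ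
        rw [← ofReal_norm, ← ofReal_norm]
        refine ENNReal.ofReal_le_ofReal ?_
        simp only [norm_smul, norm_mul, RCLike.norm_conj]
        rw [Real.norm_of_nonneg (by positivity), Real.norm_of_nonneg (by positivity)]
        calc _ ≤ japaneseBracket ξ ^ (s + s) * (‖F ξ‖ * ‖G ξ‖ * ‖h ξ‖) := by
              have := Real.rpow_le_rpow_of_exponent_le (one_le_japaneseBracket ξ)
                (by simp only [s]; linarith : 1 + a ≤ s + s)
              gcongr
          _ = _ := by rw [Real.rpow_add hJ]; ring
    _ ≤ _ := key
    _ ≤ ENNReal.ofReal A * ENNReal.ofReal B := by gcongr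
    _ = _ := (ENNReal.ofReal_mul hA).symm

theorem IsDriver.twoParamHolder_waveField {T γ a m : ℝ} {w : ℝ → ℝ} {z : ℝ → RSpace d}
    {h : RSpace d → CSpace d} (H : IsDriver T γ a m w z h) :
    TwoParamHolder (spatialNorm a) T γ (waveField h w z) := by
  have hf0 : ∀ t ∈ Icc 0 T, wnorm (absMeasure h) (1 / 2 + a) (waveInt w z t) ≤
      ENNReal.ofReal (m * T ^ γ) := fun t ht => by
    have := H.bound 0 (zero_mem_Icc_of_mem ht) t ht ht.1
    rw [show waveInt w z 0 = 0 from funext fun ξ => by simp [waveInt], sub_zero, sub_zero] at this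
    refine this.trans (ENNReal.ofReal_le_ofReal ?_)
    have := H.m_nonneg
    have := H.γ_pos.le
    have := ht.1
    gcongr
    exact ht.2
  have hf1 : ∀ s ∈ Icc 0 T, ∀ t ∈ Icc 0 T,
      wnorm (absMeasure h) (1 / 2 + a) (waveInt w z t - waveInt w z s) ≤
        ENNReal.ofReal (m * |t - s| ^ γ) := fun s hs t ht => by
    rcases le_total s t with hst | hst
    · rw [abs_of_nonneg (by linarith)]
      exact H.bound s hs t ht hst
    · rw [abs_sub_comm, abs_of_nonneg (by linarith)]
      refine le_trans (le_of_eq ?_) (H.bound t ht s hs hst)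
      rw [wnorm, wnorm]
      refine eLpNorm_congr_norm_ae (Eventually.of_forall fun ξ => ?_)
      simp only [norm_smul, Pi.sub_apply, norm_sub_rev]
  have hc : ∀ t ∈ Icc 0 T, Continuous (waveInt w z t) := fun t ht =>
    continuous_waveInt H.int H.cont ht
  have hmem : ∀ t ∈ Icc 0 T, waveInt w z t ∈ pairingDomain h := fun t ht => H.waveInt_mem ht
  have hbil : ∀ F ∈ pairingDomain h, ∀ G ∈ pairingDomain h, ∀ x,
      Integrable fun ξ => (wave ξ x * (starRingEnd ℂ (F ξ) * G ξ)) • h ξ := fun F hF G hG x => by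
    have := integrable_pairing (σ := 1 / 2) H.meas (hF.1) (wave_mul_mem_pairingDomain hG x).1
      ((wnorm_mono (by norm_num)).trans_lt hF.2) (wave_mul_mem_pairingDomain hG x).2
    refine this.congr (Eventually.of_forall fun ξ => ?_)
    simp only [Pi.mul_apply]
    congr 1; ring
  set V : (RSpace d → ℂ) → (RSpace d → ℂ) → RSpace d → RSpace d := fun F G x =>
    realPart (∫ ξ, (wave ξ x * (starRingEnd ℂ (F ξ) * G ξ)) • h ξ) with hV
  have hVw : ∀ t₁ t₂, waveField h w z t₁ t₂ = V (waveInt w z t₁) (waveInt w z t₂) :=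
    fun _ _ => rfl
  have hVl : ∀ F ∈ pairingDomain h, ∀ F' ∈ pairingDomain h, ∀ G ∈ pairingDomain h,
      V F G - V F' G = V (F - F') G := fun F hF F' hF' G hG => by
    ext1 x
    simp only [hV, Pi.sub_apply]
    rw [← realPart_sub, ← integral_sub (hbil F hF G hG x) (hbil F' hF' G hG x)]
    congr 1
    refine integral_congr_ae (Eventually.of_forall fun ξ => ?_)
    simp only [← sub_smul, map_sub]
    congr 1; ring
  have hVr : ∀ F ∈ pairingDomain h, ∀ G ∈ pairingDomain h, ∀ G' ∈ pairingDomain h,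
      V F G - V F G' = V F (G - G') := fun F hF G hG G' hG' => by
    ext1 x
    simp only [hV, Pi.sub_apply]
    rw [← realPart_sub, ← integral_sub (hbil F hF G hG x) (hbil F hF G' hG' x)]
    congr 1
    refine integral_congr_ae (Eventually.of_forall fun ξ => ?_)
    simp only [← sub_smul]
    congr 1; ring
  have hpi := Real.pi_pos
  have hm := H.m_nonneg
  set K : ℝ := (1 + 2 * Real.pi + 4 * Real.pi ^ 2) * m ^ 2 with hK
  have hK0 : 0 ≤ K := by positivity
  -- The values of f are bounded by m T^γ and its increments by m |t - s|^γ, so a single constant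
  -- with S² covers all four conditions.
  set S : ℝ := 1 + T ^ γ with hS
  refine ⟨(K * S ^ 2).toNNReal, fun s₁ hs₁ t₁ ht₁ s₂ hs₂ t₂ ht₂ => ?_⟩
  have hT : 0 ≤ T ^ γ := Real.rpow_nonneg (hs₁.1.trans hs₁.2) _
  have hcoe : ((K * S ^ 2).toNNReal : ℝ≥0∞) = ENNReal.ofReal (K * S ^ 2) := rfl
  rw [hcoe]
  have fin : ∀ {F G : RSpace d → ℂ} {A B c : ℝ}, Continuous F → Continuous G → 0 ≤ A → 0 ≤ B →
      0 ≤ c → wnorm (absMeasure h) (1 / 2 + a) F ≤ ENNReal.ofReal (m * A) →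
      wnorm (absMeasure h) (1 / 2 + a) G ≤ ENNReal.ofReal (m * B) → A * B ≤ S ^ 2 * c →
      spatialNorm a (V F G) ≤ ENNReal.ofReal (K * S ^ 2) * ENNReal.ofReal c := by
    intro F G A B c hF hG hA hB hc' h1 h2 h3
    refine (spatialNorm_pairing_le H.a_pos H.a_le H.meas hF hG (by positivity) (by positivity)
      h1 h2).trans ?_
    rw [← ENNReal.ofReal_mul (by positivity)]
    refine ENNReal.ofReal_le_ofReal ?_
    calc _ = K * (A * B) := by rw [hK]; ring
      _ ≤ K * (S ^ 2 * c) := by gcongr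
      _ = _ := by ring
  have p1 : 0 ≤ |t₁ - s₁| ^ γ := by positivity
  have p2 : 0 ≤ |t₂ - s₂| ^ γ := by positivity
  refine ⟨?_, ?_, ?_, ?_⟩
  · have := fin (c := 1) (hc s₁ hs₁) (hc s₂ hs₂) hT hT zero_le_one (hf0 s₁ hs₁) (hf0 s₂ hs₂)
      (by nlinarith)
    simpa [hVw] using this
  · rw [hVw, hVw, hVl _ (hmem t₁ ht₁) _ (hmem s₁ hs₁) _ (hmem s₂ hs₂)]
    exact fin ((hc t₁ ht₁).sub (hc s₁ hs₁)) (hc s₂ hs₂) p1 hT p1 (hf1 s₁ hs₁ t₁ ht₁)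
      (hf0 s₂ hs₂) (by rw [mul_comm]; gcongr; nlinarith)
  · rw [hVw, hVw, hVr _ (hmem s₁ hs₁) _ (hmem t₂ ht₂) _ (hmem s₂ hs₂)]
    exact fin (hc s₁ hs₁) ((hc t₂ ht₂).sub (hc s₂ hs₂)) hT p2 p2 (hf0 s₁ hs₁)
      (hf1 s₂ hs₂ t₂ ht₂) (by gcongr; nlinarith)
  · have e : box (waveField h w z) s₁ s₂ t₁ t₂ =
        V (waveInt w z t₁ - waveInt w z s₁) (waveInt w z t₂ - waveInt w z s₂) := by
      rw [← hVl _ (hmem t₁ ht₁) _ (hmem s₁ hs₁) _ (sub_mem (hmem t₂ ht₂) (hmem s₂ hs₂)),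
        ← hVr _ (hmem t₁ ht₁) _ (hmem t₂ ht₂) _ (hmem s₂ hs₂),
        ← hVr _ (hmem s₁ hs₁) _ (hmem t₂ ht₂) _ (hmem s₂ hs₂)]
      simp only [box, hVw]
      abel
    rw [e]
    exact fin ((hc t₁ ht₁).sub (hc s₁ hs₁)) ((hc t₂ ht₂).sub (hc s₂ hs₂)) p1 p2
      (mul_nonneg p1 p2) (hf1 s₁ hs₁ t₁ ht₁) (hf1 s₂ hs₂ t₂ ht₂)
      (le_mul_of_one_le_left (mul_nonneg p1 p2) (by nlinarith))

end Spatial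

/-! ### Lipschitz drifts -/

section Lipschitz

variable {d : ℕ}

/-- The inclusion `ℝ^d ⊆ ℂ^d` as a linear isometry. -/
noncomputable def toComplexL : RSpace d →ₗᵢ[ℝ] CSpace d where
  toFun := toComplex
  map_add' x y := by ext i; simp [toComplex]
  map_smul' c x := by ext i; simp [toComplex]
  norm_map' x := by simp [EuclideanSpace.norm_eq, toComplex]

/-- Translates of a test function become multiplication by waves; this moves the shift by `ψ r` from
the field W to its Fourier transform. -/
theorem fourierInv_translate (φ : 𝓢(RSpace d, ℂ)) (y ξ : RSpace d) :
    (𝓕⁻ (φ.compSubConstCLM ℂ y) : 𝓢(RSpace d, ℂ)) ξ = wave ξ y * (𝓕⁻ φ : 𝓢(RSpace d, ℂ)) ξ := by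
  rw [SchwartzMap.fourierInv_coe, SchwartzMap.fourierInv_coe, Real.fourierInv_eq,
    Real.fourierInv_eq, ← integral_add_right_eq_self _ y, ← integral_const_mul]
  refine integral_congr_ae (Eventually.of_forall fun x => ?_)
  simp only [SchwartzMap.compSubConstCLM_apply, add_sub_cancel_right, Circle.smul_def,
    inner_add_left, AddChar.map_add_eq_mul, Circle.coe_mul, smul_eq_mul, wave,
    real_inner_comm ξ y]
  ring

theorem integral_smul_fourierInv (φ : 𝓢(RSpace d, ℂ)) {k : RSpace d → CSpace d}
    (hk : Integrable k) :
    ∫ ξ, (𝓕⁻ φ : 𝓢(RSpace d, ℂ)) ξ • k ξ = ∫ x, φ x • ∫ ξ, wave ξ x • k ξ := by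
  have hmeas : AEStronglyMeasurable (fun p : RSpace d × RSpace d => wave p.1 p.2)
      (volume.prod volume) := continuous_wave.aestronglyMeasurable
  have hint : Integrable (fun p : RSpace d × RSpace d => wave p.1 p.2 • φ p.2 • k p.1)
      (volume.prod volume) := by
    have h1 : Integrable (fun p : RSpace d × RSpace d => φ p.2 • k p.1) (volume.prod volume) :=
      (φ.integrable.smul_prod hk).swap
    exact h1.bdd_smul 1 hmeas (Eventually.of_forall fun p => by simp)
  have e1 : ∀ ξ, (𝓕⁻ φ : 𝓢(RSpace d, ℂ)) ξ • k ξ = ∫ x, wave ξ x • φ x • k ξ := fun ξ => by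
    rw [SchwartzMap.fourierInv_coe, Real.fourierInv_eq, ← integral_smul_const]
    refine integral_congr_ae (Eventually.of_forall fun x => ?_)
    simp only [wave, Circle.smul_def, real_inner_comm ξ x, smul_assoc]
  have e2 : ∀ x, φ x • ∫ ξ, wave ξ x • k ξ = ∫ ξ, wave ξ x • φ x • k ξ := fun x => by
    rw [← integral_smul]
    refine integral_congr_ae (Eventually.of_forall fun ξ => ?_)
    simp only [smul_comm (φ x)]
  simp_rw [e1, e2]
  exact integral_integral_swap hint

variable {α : Type*} [MeasurableSpace α] {m : Measure α} {ρ : α → ℝ}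
  {ψ : α → RSpace d} {W : RSpace d → CSpace d} {K : ℝ≥0}

theorem integrable_smul_lipschitz (hρ : Integrable ρ m) (hψ : Measurable ψ) {R : ℝ}
    (hR : ∀ r, ‖ψ r‖ ≤ R) (hW : LipschitzWith K W) (x : RSpace d) :
    Integrable (fun r => (ρ r : ℂ) • W (x + ψ r)) m := by
  refine (hρ.ofReal (𝕜 := ℂ)).smul_bdd (‖W x‖ + K * R) ?_ (Eventually.of_forall fun r => ?_)
  · exact (hW.continuous.measurable.comp (hψ.const_add x)).aestronglyMeasurable
  · have h1 := hW.dist_le_mul (x + ψ r) x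
    rw [dist_eq_norm, dist_eq_norm, add_sub_cancel_left] at h1
    have h2 : (K : ℝ) * ‖ψ r‖ ≤ K * R := by gcongr; exact hR r
    linarith [norm_le_norm_add_norm_sub' (W (x + ψ r)) (W x)]

/-- For a Lipschitz field `W` with Fourier transform `h`, the average of the translates of `W`
along `ψ` is the synthesis of `h` with the averaged plane waves. -/
theorem integral_smul_lipschitz_eq [SFinite m] (hρ : Integrable ρ m) (hψ : Measurable ψ) {R : ℝ}
    (hR : ∀ r, ‖ψ r‖ ≤ R) (hW : LipschitzWith K W) {B : 𝓢'(RSpace d, CSpace d)}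
    (hB : ∀ φ : 𝓢(RSpace d, ℂ), B φ = ∫ x, φ x • W x) {h : RSpace d → CSpace d}
    (hh : HasFourierFunction B h)
    (hg : Integrable fun ξ => (∫ r, (ρ r : ℂ) * wave ξ (ψ r) ∂m) • h ξ) :
    ∫ r, (ρ r : ℂ) • W (ψ r) ∂m = ∫ ξ, (∫ r, (ρ r : ℂ) * wave ξ (ψ r) ∂m) • h ξ := by
  set k : RSpace d → CSpace d := fun ξ => (∫ r, (ρ r : ℂ) * wave ξ (ψ r) ∂m) • h ξ with hk
  set V : RSpace d → CSpace d := fun x => ∫ r, (ρ r : ℂ) • W (x + ψ r) ∂m with hV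
  set V' : RSpace d → CSpace d := fun x => ∫ ξ, wave ξ x • k ξ with hV'
  have hVc : Continuous V := by
    have : LipschitzWith ((∫ r, ‖ρ r‖ ∂m).toNNReal * K) V := by
      refine LipschitzWith.of_dist_le_mul fun x y => ?_
      rw [dist_eq_norm, dist_eq_norm, hV]
      simp only
      rw [← integral_sub (integrable_smul_lipschitz hρ hψ hR hW x)
        (integrable_smul_lipschitz hρ hψ hR hW y)]
      refine (norm_integral_le_of_norm_le (hρ.norm.mul_const (K * ‖x - y‖))
        (Eventually.of_forall fun r => ?_)).trans (le_of_eq ?_)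
      · rw [← smul_sub, norm_smul, Complex.norm_real]
        gcongr
        have h1 := hW.dist_le_mul (x + ψ r) (y + ψ r)
        rwa [dist_eq_norm, dist_eq_norm, add_sub_add_right_eq_sub] at h1
      · rw [integral_mul_const, NNReal.coe_mul,
          Real.coe_toNNReal _ (integral_nonneg fun _ => norm_nonneg _), mul_assoc]
    exact this.continuous
  have hV'c : Continuous V' := by
    have : V' = fun x => 𝓕 k (-x) := funext fun x => integral_wave_smul_eq k x
    rw [this]
    exact (VectorFourier.fourierIntegral_continuous Real.continuous_fourierChar
      (by exact continuous_inner) hg).comp continuous_neg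
  -- W may grow linearly and `h` need not be integrable, so Fourier inversion cannot be applied
  -- pointwise to W. The averaged fields are compared as distributions, where both growths are
  -- absorbed by φ and its inverse transform.
  have htest : ∀ φ : 𝓢(RSpace d, ℂ), ∫ x, φ x • V x = ∫ x, φ x • V' x := fun φ => by
    have hφW : Integrable (fun p : RSpace d × α => φ p.1 • (ρ p.2 : ℂ) • W (p.1 + ψ p.2))
        (volume.prod m) := by
      have hφ1 : Integrable fun x => ‖φ x‖ * (‖W 0‖ + K * R + K * ‖x‖) := by
        have h1 := φ.integrable_pow_mul volume 1
        have h2 := (φ.integrable (μ := volume)).norm.mul_const (‖W 0‖ + K * R)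
        refine (h2.add (h1.const_mul (K : ℝ))).congr (Eventually.of_forall fun x => ?_)
        simp only [Pi.add_apply, pow_one]
        ring
      refine (hφ1.mul_prod hρ.norm).mono' ?_ (Eventually.of_forall fun p => ?_)
      · have m1 : AEStronglyMeasurable (fun p : RSpace d × α => φ p.1) (volume.prod m) :=
          (φ.continuous.measurable.comp measurable_fst).aestronglyMeasurable
        have m2 : AEStronglyMeasurable (fun p : RSpace d × α => (ρ p.2 : ℂ)) (volume.prod m) :=
          (hρ.ofReal (𝕜 := ℂ)).1.comp_snd
        have m3 : AEStronglyMeasurable (fun p : RSpace d × α => W (p.1 + ψ p.2))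
            (volume.prod m) :=
          (hW.continuous.measurable.comp
            (measurable_fst.add (hψ.comp measurable_snd))).aestronglyMeasurable
        exact m1.smul (m2.smul m3)
      · rw [norm_smul, norm_smul, Complex.norm_real, mul_assoc, mul_comm (‖W 0‖ + _ + _)]
        gcongr
        have h1 := hW.dist_le_mul (p.1 + ψ p.2) 0
        rw [dist_eq_norm, dist_eq_norm, sub_zero] at h1
        have h2 : (K : ℝ) * ‖p.1 + ψ p.2‖ ≤ K * (‖p.1‖ + R) := by
          gcongr
          exact (norm_add_le _ _).trans (by gcongr; exact hR _)
        linarith [norm_le_norm_add_norm_sub' (W (p.1 + ψ p.2)) (W 0)]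
    have hφh := (hh (𝓕⁻ φ)).1
    have hwh : Integrable (fun p : RSpace d × α =>
        wave p.1 (ψ p.2) • (ρ p.2 : ℂ) • (𝓕⁻ φ : 𝓢(RSpace d, ℂ)) p.1 • h p.1)
        (volume.prod m) := by
      have h1 : Integrable (fun p : RSpace d × α =>
          (ρ p.2 : ℂ) • (𝓕⁻ φ : 𝓢(RSpace d, ℂ)) p.1 • h p.1) (volume.prod m) :=
        ((hρ.ofReal (𝕜 := ℂ)).smul_prod hφh).swap
      exact h1.bdd_smul 1 (continuous_wave.measurable.comp
        (measurable_fst.prodMk (hψ.comp measurable_snd))).aestronglyMeasurable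
        (Eventually.of_forall fun p => by simp)
    calc ∫ x, φ x • V x = ∫ x, ∫ r, φ x • (ρ r : ℂ) • W (x + ψ r) ∂m := by
          simp_rw [hV, ← integral_smul]
      _ = ∫ r, (∫ x, φ x • (ρ r : ℂ) • W (x + ψ r)) ∂m := integral_integral_swap hφW
      _ = ∫ r, (∫ ξ, wave ξ (ψ r) • (ρ r : ℂ) • (𝓕⁻ φ : 𝓢(RSpace d, ℂ)) ξ • h ξ) ∂m := by
          refine integral_congr_ae (Eventually.of_forall fun r => ?_)
          have h1 : B (φ.compSubConstCLM ℂ (ψ r)) =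
              ∫ ξ, (𝓕⁻ (φ.compSubConstCLM ℂ (ψ r)) : 𝓢(RSpace d, ℂ)) ξ • h ξ := by
            rw [← (hh _).2, TemperedDistribution.fourier_apply, FourierTransform.fourier_fourierInv_eq]
          rw [hB, ← integral_add_right_eq_self _ (ψ r)] at h1
          simp only [fourierInv_translate, SchwartzMap.compSubConstCLM_apply,
            add_sub_cancel_right] at h1
          calc _ = (ρ r : ℂ) • ∫ x, φ x • W (x + ψ r) := by
                rw [← integral_smul]; simp_rw [smul_comm (ρ r : ℂ)]
            _ = _ := by
                rw [h1, ← integral_smul]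
                refine integral_congr_ae (Eventually.of_forall fun ξ => ?_)
                simp only [smul_smul]
                congr 1; ring
      _ = ∫ ξ, ∫ r, wave ξ (ψ r) • (ρ r : ℂ) • (𝓕⁻ φ : 𝓢(RSpace d, ℂ)) ξ • h ξ ∂m :=
          (integral_integral_swap hwh).symm
      _ = ∫ ξ, (𝓕⁻ φ : 𝓢(RSpace d, ℂ)) ξ • k ξ := by
          refine integral_congr_ae (Eventually.of_forall fun ξ => ?_)
          simp only [hk]
          rw [smul_comm, ← integral_smul_const]
          refine integral_congr_ae (Eventually.of_forall fun r => ?_)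
          simp only [smul_smul]
          congr 1; ring
      _ = ∫ x, φ x • V' x := integral_smul_fourierInv φ hg
  -- Equality of distributions gives equality almost everywhere, and continuity of both sides makes
  -- it hold at the origin, which is the desired identity.
  have hae : V =ᵐ[volume] V' := by
    refine ae_eq_of_integral_contDiff_smul_eq hVc.locallyIntegrable hV'c.locallyIntegrable
      fun φ hφ hφc => ?_
    have hcs : HasCompactSupport fun x => ((φ x : ℝ) : ℂ) :=
      hφc.comp_left (g := fun r : ℝ => (r : ℂ)) (by simp)
    have hcd : ContDiff ℝ ((⊤ : ℕ∞) : WithTop ℕ∞) fun x => ((φ x : ℝ) : ℂ) :=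
      Complex.ofRealCLM.contDiff.comp hφ
    have := htest (hcs.toSchwartzMap hcd)
    simpa using this
  have h0 := congrFun ((Continuous.ae_eq_iff_eq volume hVc hV'c).1 hae) 0
  simpa [hV, hV'] using h0

variable {T : ℝ} {w : ℝ → ℝ} {u : ℝ → RSpace d} {v : RSpace d → RSpace d}

theorem integral_integral_eq_setIntegral_prod (hw : MemLp w ∞ (volume.restrict (Icc 0 T)))
    (hu : ContinuousOn u (Icc 0 T)) (hv : Continuous v) {t : ℝ} (ht : t ∈ Icc 0 T) :
    IntegrableOn (fun r : ℝ × ℝ => (w r.1 * w r.2) • v (u (clamp T r.2) - u (clamp T r.1)))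
      (Ioc 0 t ×ˢ Ioc 0 t) ∧
    ∫ s in (0 : ℝ)..t, ∫ r in (0 : ℝ)..t, (w s * w r) • v (u s - u r) =
      ∫ r in Ioc 0 t ×ˢ Ioc 0 t, (w r.1 * w r.2) • v (u (clamp T r.2) - u (clamp T r.1)) := by
  have hT : 0 ≤ T := ht.1.trans ht.2
  obtain ⟨R, hR⟩ : ∃ R, ∀ p ∈ Icc 0 T ×ˢ Icc 0 T, ‖v (u p.2 - u p.1)‖ ≤ R :=
    (isCompact_Icc.prod isCompact_Icc).exists_bound_of_continuousOn
      (hv.comp_continuousOn ((hu.comp continuousOn_snd fun _ hp => hp.2).sub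
        (hu.comp continuousOn_fst fun _ hp => hp.1)))
  have hcl : ∀ r, clamp T r ∈ Icc 0 T := fun r => ⟨le_max_left _ _, max_le hT (min_le_left _ _)⟩
  have hi : IntegrableOn
      (fun r : ℝ × ℝ => (w r.1 * w r.2) • v (u (clamp T r.2) - u (clamp T r.1)))
      (Ioc 0 t ×ˢ Ioc 0 t) :=
    (integrable_weight hw ht ht).smul_bdd R
      (hv.measurable.comp (measurable_clamped hT hu)).aestronglyMeasurable
      (Eventually.of_forall fun r => hR (clamp T r.1, clamp T r.2) ⟨hcl _, hcl _⟩)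
  refine ⟨hi, ?_⟩
  rw [IntegrableOn, Measure.volume_eq_prod, ← Measure.prod_restrict] at hi
  rw [Measure.volume_eq_prod, ← Measure.prod_restrict, integral_prod_symm _ hi,
    intervalIntegral.integral_of_le ht.1]
  refine setIntegral_congr_fun measurableSet_Ioc fun s hs => ?_
  rw [intervalIntegral.integral_of_le ht.1]
  refine setIntegral_congr_fun measurableSet_Ioc fun r hr => ?_
  rw [clamp_of_mem ⟨hs.1.le, hs.2.trans ht.2⟩, clamp_of_mem ⟨hr.1.le, hr.2.trans ht.2⟩,
    mul_comm (w s)]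

/-- The self-interaction term of a Lipschitz drift `v` with Fourier transform `h`. -/
theorem integral_lipschitz_eq_selfInt (hw : MemLp w ∞ (volume.restrict (Icc 0 T)))
    (hu : ContinuousOn u (Icc 0 T)) (hv : LipschitzWith K v) {B : 𝓢'(RSpace d, CSpace d)}
    (hB : IsGivenBy B v) {h : RSpace d → CSpace d} (hh : HasFourierFunction B h) {t : ℝ}
    (ht : t ∈ Icc 0 T)
    (hg : Integrable fun ξ => (starRingEnd ℂ (waveInt w u t ξ) * waveInt w u t ξ) • h ξ) :
    ∫ s in (0 : ℝ)..t, ∫ r in (0 : ℝ)..t, (w s * w r) • v (u s - u r) = selfInt h w u t := by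
  have hT : 0 ≤ T := ht.1.trans ht.2
  have hψ := measurable_clamped hT hu
  have hρ := integrable_weight hw ht ht
  obtain ⟨R, hR⟩ : ∃ R, ∀ r ∈ Icc 0 T, ‖u r‖ ≤ R := isCompact_Icc.exists_bound_of_continuousOn hu
  have hcl : ∀ r, clamp T r ∈ Icc 0 T := fun r => ⟨le_max_left _ _, max_le hT (min_le_left _ _)⟩
  have hW : LipschitzWith K (toComplex ∘ v) := by
    have := (toComplexL (d := d)).lipschitz.comp hv
    rwa [one_mul] at this
  have key := integral_smul_lipschitz_eq hρ hψ (R := R + R)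
    (fun r => (norm_sub_le _ _).trans (add_le_add (hR _ (hcl _)) (hR _ (hcl _)))) hW hB hh
    (by simp_rw [integral_wave_prod _ ht ht]; exact hg)
  simp_rw [integral_wave_prod _ ht ht] at key
  have hi := integrable_smul_lipschitz hρ hψ (R := R + R)
    (fun r => (norm_sub_le _ _).trans (add_le_add (hR _ (hcl _)) (hR _ (hcl _)))) hW 0
  simp only [zero_add] at hi
  rw [selfInt, pairing, ← key, ← realPartL_apply, ← realPartL.integral_comp_comm hi]
  have e : ∀ r : ℝ × ℝ, realPartL (((w r.1 * w r.2 : ℝ) : ℂ) •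
      (toComplex ∘ v) (u (clamp T r.2) - u (clamp T r.1))) =
      (w r.1 * w r.2) • v (u (clamp T r.2) - u (clamp T r.1)) := fun r => by
    rw [show ∀ (c : ℝ) (x : CSpace d), (c : ℂ) • x = c • x from fun c x =>
      (RCLike.real_smul_eq_coe_smul (K := ℂ) c x).symm, map_smul, realPartL_apply,
      Function.comp_apply, realPart_toComplex]
  have hi' := realPartL.integrable_comp hi
  simp_rw [e] at hi' ⊢
  exact (integral_integral_eq_setIntegral_prod hw hu hv.continuous ht).2

/-- The self-interaction term of a continuous drift is Lipschitz continuous in time. -/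
theorem exists_norm_integral_sub_le (hw : MemLp w ∞ (volume.restrict (Icc 0 T)))
    (hu : ContinuousOn u (Icc 0 T)) (hv : Continuous v) (hT : 0 ≤ T) :
    ∃ N : ℝ, 0 ≤ N ∧ ∀ s ∈ Icc 0 T, ∀ t ∈ Icc 0 T, s ≤ t →
      ‖(∫ s in (0 : ℝ)..t, ∫ r in (0 : ℝ)..t, (w s * w r) • v (u s - u r)) -
        ∫ s' in (0 : ℝ)..s, ∫ r in (0 : ℝ)..s, (w s' * w r) • v (u s' - u r)‖ ≤ N * (t - s) := by
  obtain ⟨R, hR⟩ : ∃ R, ∀ p ∈ Icc 0 T ×ˢ Icc 0 T, ‖v (u p.2 - u p.1)‖ ≤ R :=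
    (isCompact_Icc.prod isCompact_Icc).exists_bound_of_continuousOn
      (hv.comp_continuousOn ((hu.comp continuousOn_snd fun _ hp => hp.2).sub
        (hu.comp continuousOn_fst fun _ hp => hp.1)))
  have hR0 : 0 ≤ R := (norm_nonneg _).trans (hR (0, 0) ⟨⟨le_rfl, hT⟩, ⟨le_rfl, hT⟩⟩)
  have hcl : ∀ r, clamp T r ∈ Icc 0 T := fun r => ⟨le_max_left _ _, max_le hT (min_le_left _ _)⟩
  set M : ℝ := (eLpNorm w ∞ (volume.restrict (Icc 0 T))).toReal
  have hM : ∀ᵐ r ∂(volume.restrict (Icc 0 T)), ‖w r‖ ≤ M := by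
    have := ae_le_eLpNormEssSup (f := w) (μ := volume.restrict (Icc 0 T))
    filter_upwards [this] with r hr
    rw [← eLpNorm_exponent_top] at hr
    have := ENNReal.toReal_mono hw.2.ne hr
    simpa [M] using this
  refine ⟨2 * T * (M ^ 2 * R), by positivity, fun s hs t ht hst => ?_⟩
  obtain ⟨hi, et⟩ := integral_integral_eq_setIntegral_prod hw hu hv ht
  obtain ⟨-, es⟩ := integral_integral_eq_setIntegral_prod hw hu hv hs
  have hsub : Ioc 0 s ×ˢ Ioc 0 s ⊆ Ioc 0 t ×ˢ Ioc 0 t :=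
    prod_mono (Ioc_subset_Ioc_right hst) (Ioc_subset_Ioc_right hst)
  have hms : MeasurableSet (Ioc (0 : ℝ) s ×ˢ Ioc (0 : ℝ) s) :=
    measurableSet_Ioc.prod measurableSet_Ioc
  have hmt : MeasurableSet (Ioc (0 : ℝ) t ×ˢ Ioc (0 : ℝ) t) :=
    measurableSet_Ioc.prod measurableSet_Ioc
  have hvol : ∀ t, 0 ≤ t → volume.real (Ioc (0 : ℝ) t ×ˢ Ioc (0 : ℝ) t) = t * t := fun t ht => by
    rw [Measure.volume_eq_prod, measureReal_prod_prod]
    simp [ht]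
  have hbd : ∀ᵐ r : ℝ × ℝ ∂volume, r ∈ (Ioc 0 t ×ˢ Ioc 0 t) \ (Ioc 0 s ×ˢ Ioc 0 s) →
      ‖(w r.1 * w r.2) • v (u (clamp T r.2) - u (clamp T r.1))‖ ≤ M ^ 2 * R := by
    rw [ae_restrict_iff' measurableSet_Icc] at hM
    have h1 : ∀ᵐ r : ℝ × ℝ ∂volume, r.1 ∈ Icc 0 T → ‖w r.1‖ ≤ M :=
      Measure.quasiMeasurePreserving_fst.ae hM
    have h2 : ∀ᵐ r : ℝ × ℝ ∂volume, r.2 ∈ Icc 0 T → ‖w r.2‖ ≤ M :=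
      Measure.quasiMeasurePreserving_snd.ae hM
    filter_upwards [h1, h2] with r h1 h2 hr
    have hr1 : r.1 ∈ Icc 0 T := ⟨hr.1.1.1.le, hr.1.1.2.trans ht.2⟩
    have hr2 : r.2 ∈ Icc 0 T := ⟨hr.1.2.1.le, hr.1.2.2.trans ht.2⟩
    rw [norm_smul, norm_mul, sq]
    have := hR (clamp T r.1, clamp T r.2) ⟨hcl _, hcl _⟩
    have := h1 hr1
    have := h2 hr2
    gcongr
  have hfin : volume ((Ioc (0 : ℝ) t ×ˢ Ioc (0 : ℝ) t) \ (Ioc (0 : ℝ) s ×ˢ Ioc (0 : ℝ) s)) < ∞ := by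
    refine (measure_mono sdiff_subset).trans_lt ?_
    rw [Measure.volume_eq_prod, Measure.prod_prod]
    exact ENNReal.mul_lt_top measure_Ioc_lt_top measure_Ioc_lt_top
  -- The increment is the integral over the L-shaped region between two squares, whose area t² - s²
  -- is at most 2 T (t - s).
  rw [et, es, ← setIntegral_sdiff hms hi hsub]
  refine (norm_setIntegral_le_of_norm_le_const_ae' hfin hbd).trans ?_
  rw [measureReal_sdiff hsub hms ?_, hvol t ht.1, hvol s hs.1]
  · have : t * t - s * s ≤ 2 * T * (t - s) := by nlinarith [hs.1, hs.2, ht.1, ht.2]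
    calc _ ≤ M ^ 2 * R * (2 * T * (t - s)) := by gcongr
      _ = _ := by ring
  · rw [Measure.volume_eq_prod, Measure.prod_prod]
    exact (ENNReal.mul_lt_top measure_Ioc_lt_top measure_Ioc_lt_top).ne

end Lipschitz

/-! ### Hölder norms at a fixed scale -/

section Scale

variable {d : ℕ} {T γ τ : ℝ} {f θ θ' : ℝ → RSpace d}

/-- Passing to a smaller scale weakens the condition, because the admissible Hölder constant τ^{-γ}
grows. Two paths can therefore always be compared at a common scale. -/
theorem HolderAtScale.mono_scale {τ' : ℝ} (h : HolderAtScale T γ τ θ) (hτ' : 0 < τ')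
    (hτ : τ' ≤ τ) (hγ : 0 ≤ γ) : HolderAtScale T γ τ' θ := fun s hs t ht hst hts => by
  refine (h s hs t ht hst (hts.trans hτ)).trans ?_
  have : 0 ≤ t - s := by linarith
  have : 0 < τ := hτ'.trans_le hτ
  gcongr

/-- The scale is chosen with τ^{-γ} = K + 1, so that τ is defined also for K = 0. -/
theorem exists_holderAtScale (hγ : 0 < γ) {K : ℝ} (hK : 0 ≤ K)
    (h : ∀ s ∈ Icc 0 T, ∀ t ∈ Icc 0 T, s ≤ t → ‖θ t - θ s‖ ≤ K * (t - s) ^ γ) :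
    ∃ τ > 0, HolderAtScale T γ τ θ := by
  have hp : 0 < (1 / (K + 1)) ^ (1 / γ) := by positivity
  refine ⟨_, hp, fun s hs t ht hst _ => (h s hs t ht hst).trans ?_⟩
  have h0 : 0 ≤ t - s := by linarith
  rw [Real.div_rpow h0 hp.le, ← Real.rpow_mul (by positivity), one_div_mul_cancel hγ.ne',
    Real.rpow_one, div_div_eq_mul_div, div_one, mul_comm]
  gcongr
  linarith

theorem exists_holderAtScale_of_holderNorm (hγ : 0 < γ) (h : holderNorm T γ θ < ∞) :
    ∃ τ > 0, HolderAtScale T γ τ θ := by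
  set S := ⨆ s ∈ Icc 0 T, ⨆ t ∈ Icc 0 T, ⨆ _ : s ≠ t,
    ‖θ t - θ s‖ₑ / ENNReal.ofReal (|t - s| ^ γ) with hS
  have hSfin : S ≠ ∞ := (lt_of_le_of_lt (self_le_add_left _ _) h).ne
  refine exists_holderAtScale hγ (K := S.toReal) ENNReal.toReal_nonneg fun s hs t ht hst => ?_
  rcases hst.eq_or_lt with rfl | hlt
  · simp only [sub_self, norm_zero]
    exact mul_nonneg ENNReal.toReal_nonneg (Real.rpow_nonneg le_rfl _)
  have h0 : 0 < t - s := by linarith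
  have h1 : ‖θ t - θ s‖ₑ / ENNReal.ofReal (|t - s| ^ γ) ≤ S :=
    le_iSup₂_of_le s hs (le_iSup₂_of_le t ht (le_iSup_of_le hlt.ne le_rfl))
  rw [abs_of_pos h0, ENNReal.div_le_iff (ENNReal.ofReal_pos.2 (Real.rpow_pos_of_pos h0 _)).ne'
    ENNReal.ofReal_ne_top] at h1
  have h2 := ENNReal.toReal_mono (ENNReal.mul_ne_top hSfin ENNReal.ofReal_ne_top) h1
  rwa [toReal_enorm, ENNReal.toReal_mul, ENNReal.toReal_ofReal (by positivity)] at h2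

/-- Increments over more than τ are at most 2 D, and there ((t - s)/τ)^γ ≥ 1, so short increments
and the sup bound control the global seminorm. -/
theorem holderNorm_le_of_scale (hτ : 0 < τ) {D Y : ℝ} (hγ : 0 ≤ γ) (hD : 0 ≤ D) (hY : 0 ≤ Y)
    (h0 : ∀ t ∈ Icc 0 T, ‖f t‖ ≤ D)
    (h1 : ∀ s ∈ Icc 0 T, ∀ t ∈ Icc 0 T, s ≤ t → t - s ≤ τ →
      ‖f t - f s‖ ≤ Y * ((t - s) / τ) ^ γ) :
    holderNorm T γ f ≤ ENNReal.ofReal (D + (2 * D + Y) / τ ^ γ) := by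
  have hτγ : 0 < τ ^ γ := Real.rpow_pos_of_pos hτ _
  have key : ∀ s ∈ Icc 0 T, ∀ t ∈ Icc 0 T, s ≤ t →
      ‖f t - f s‖ ≤ (2 * D + Y) / τ ^ γ * (t - s) ^ γ := fun s hs t ht hst => by
    have hts : 0 ≤ t - s := by linarith
    rw [div_mul_eq_mul_div, mul_div_assoc, ← Real.div_rpow hts hτ.le]
    rcases le_total (t - s) τ with hle | hle
    · refine (h1 s hs t ht hst hle).trans ?_
      gcongr
      linarith
    · have hge : 1 ≤ ((t - s) / τ) ^ γ := Real.one_le_rpow ((one_le_div hτ).2 hle) hγ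
      have := (norm_sub_le (f t) (f s)).trans (add_le_add (h0 t ht) (h0 s hs))
      nlinarith
  rw [ENNReal.ofReal_add hD (by positivity), holderNorm]
  refine add_le_add (iSup₂_le fun t ht => ?_)
    (iSup₂_le fun s hs => iSup₂_le fun t ht => iSup_le fun hst => ?_)
  · rw [← ofReal_norm]
    exact ENNReal.ofReal_le_ofReal (h0 t ht)
  · refine ENNReal.div_le_of_le_mul ?_
    rw [← ENNReal.ofReal_mul (by positivity), ← ofReal_norm]
    refine ENNReal.ofReal_le_ofReal ?_
    rcases le_total s t with h | h
    · rw [abs_of_nonneg (by linarith)]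
      exact key s hs t ht h
    · rw [abs_sub_comm, abs_of_nonneg (by linarith), norm_sub_rev]
      exact key t ht s hs h

theorem HolderAtScale.holderNorm_lt_top (h : HolderAtScale T γ τ θ) (hτ : 0 < τ) (hγ : 0 < γ) :
    holderNorm T γ θ < ∞ := by
  obtain ⟨D, hD⟩ := isCompact_Icc.exists_bound_of_continuousOn (h.continuousOn hτ hγ)
  refine (holderNorm_le_of_scale hτ hγ.le (le_max_right D 0) zero_le_one
    (fun t ht => (hD t ht).trans (le_max_left _ _)) fun s hs t ht hst hts => ?_).trans_lt
    ENNReal.ofReal_lt_top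
  rw [one_mul]
  exact h s hs t ht hst hts

theorem CloseAtScale.holderNorm_le {K : ℝ} (h : CloseAtScale T γ τ K K θ θ') (hτ : 0 < τ)
    (hγ : 0 ≤ γ) : holderNorm T γ (θ - θ') ≤ ENNReal.ofReal ((1 + 3 / τ ^ γ) * K) := by
  refine (holderNorm_le_of_scale hτ hγ h.D_nonneg h.Y_nonneg h.norm_le
    h.norm_sub_le).trans (le_of_eq ?_)
  congr 1; ring

end Scale

/-! ### Solutions as fixed points -/

section Solutions

variable {d : ℕ} {T γ a m τ : ℝ} {w : ℝ → ℝ} {z θ θ' : ℝ → RSpace d}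
  {h : RSpace d → CSpace d} {x : RSpace d}

theorem IsDriver.zero (H : IsDriver T γ a m w z h) : IsDriver T γ a 0 w z (h - h) := by
  refine ⟨H.meas.sub H.meas, H.int, H.cont, H.a_pos, H.a_le, H.γ_pos, H.β_gt, le_rfl,
    fun s _ t _ _ => ?_⟩
  have : absMeasure (h - h) = 0 := by simp [absMeasure]
  rw [this, wnorm, eLpNorm_measure_zero]
  exact zero_le

/-- Stability with identical kernel and initial value: the driver of h - h has constant 0 by
`IsDriver.zero`, so the bound vanishes. The number of windows is chosen after both paths, which
removes any smallness condition on them. -/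
theorem IsDriver.eqOn_of_isFixedPath (hγ : 1 / 2 < γ) (hT : 0 < T)
    (H : IsDriver T γ a m w z h) (hτ : 0 < τ) {τ' : ℝ} (hτ' : 0 < τ')
    (hθ : HolderAtScale T γ τ θ) (hθ' : HolderAtScale T γ τ' θ')
    (hfix : IsFixedPath T w z h x θ) (hfix' : IsFixedPath T w z h x θ') :
    EqOn θ θ' (Icc 0 T) := by
  obtain ⟨n, hn, hnτ, hε⟩ := exists_stepFactor_le hγ a m hT (lt_min hτ hτ')
    (by norm_num : (0 : ℝ) < 1 / 4)
  have hn' : (0 : ℝ) < n := by exact_mod_cast hn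
  have hTn : 0 < T / n := by positivity
  have hc := H.closeAtScale H.zero ⟨m, H⟩ hT.le hTn (mul_div_cancel₀ _ hn'.ne').ge hε
    (hθ.mono_scale hTn (hnτ.trans (min_le_left _ _)) H.γ_pos.le)
    (hθ'.mono_scale hTn (hnτ.trans (min_le_right _ _)) H.γ_pos.le) hfix hfix'
  intro t ht
  have := hc.norm_le t ht
  rw [show stepFactor γ a 0 (T / n) n = 0 by simp [stepFactor], sub_self, norm_zero, mul_zero,
    add_zero, mul_zero] at this
  exact sub_eq_zero.1 (norm_le_zero_iff.1 this)

theorem HasYoungIntegral.congr {A A' : ℝ → ℝ → RSpace d → RSpace d}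
    (hA : ∀ s ∈ Icc 0 T, ∀ t ∈ Icc 0 T, A s t = A' s t) {t₁ t₂ : ℝ} (ht₁ : t₁ ∈ Icc 0 T)
    (ht₂ : t₂ ∈ Icc 0 T) {I : RSpace d} (hI : HasYoungIntegral A θ t₁ t₂ I) :
    HasYoungIntegral A' θ t₁ t₂ I := by
  intro ε hε
  obtain ⟨η, hη, H⟩ := hI ε hε
  refine ⟨η, hη, fun m n p c hp hc h1 h2 => ?_⟩
  have e : riemannSum A' θ m n p c = riemannSum A θ m n p c := by
    refine Finset.sum_congr rfl fun i hi => Finset.sum_congr rfl fun j hj => ?_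
    rw [Finset.mem_range] at hi hj
    have i1 := Icc_subset_Icc_right ht₁.2 (hp.mem_Icc hi.le)
    have i2 := Icc_subset_Icc_right ht₁.2 (hp.mem_Icc (Nat.succ_le_of_lt hi))
    have j1 := Icc_subset_Icc_right ht₂.2 (hc.mem_Icc hj.le)
    have j2 := Icc_subset_Icc_right ht₂.2 (hc.mem_Icc (Nat.succ_le_of_lt hj))
    simp only [box, hA _ i1 _ j1, hA _ i1 _ j2, hA _ i2 _ j1, hA _ i2 _ j2]
  rw [e]
  exact H m n p c hp hc h1 h2

theorem TwoParamHolder.congr {V : Type*} [AddCommGroup V] {N : V → ℝ≥0∞} {f f' : ℝ → ℝ → V}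
    (hf : TwoParamHolder N T γ f) (e : ∀ s ∈ Icc 0 T, ∀ t ∈ Icc 0 T, f s t = f' s t) :
    TwoParamHolder N T γ f' := by
  obtain ⟨C, hC⟩ := hf
  refine ⟨C, fun s₁ hs₁ t₁ ht₁ s₂ hs₂ t₂ ht₂ => ?_⟩
  have := hC s₁ hs₁ t₁ ht₁ s₂ hs₂ t₂ ht₂
  simpa only [box, e s₁ hs₁ s₂ hs₂, e s₁ hs₁ t₂ ht₂, e t₁ ht₁ s₂ hs₂, e t₁ ht₁ t₂ ht₂] using this

variable {b : 𝓢'(RSpace d, CSpace d)}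

theorem IsDriver.isSolution (hw : MemLp w ∞ (volume.restrict (Icc 0 T))) (ha : a < 1)
    (H : IsDriver T γ a m w z (fourierFunction b)) (hτ : 0 < τ) (hθ : HolderAtScale T γ τ θ)
    (hfix : IsFixedPath T w z (fourierFunction b) x θ) : IsSolution T γ w z b x (z + θ) := by
  have e : ∀ s ∈ Icc 0 T, ∀ t ∈ Icc 0 T,
      waveField (fourierFunction b) w z s t = averagedField T w z b s t := fun s hs t ht =>
    (averagedField_eq_waveField hw H.cont b hs ht).symm
  refine ⟨⟨a, H.a_pos, ha, H.β_gt, H.twoParamHolder_waveField.congr e⟩, ?_, fun t ht => ?_⟩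
  · rw [add_sub_cancel_left]
    exact hθ.holderNorm_lt_top hτ H.γ_pos
  · rw [add_sub_cancel_left, Pi.add_apply, add_sub_cancel_left, hfix t ht, add_sub_cancel_left]
    exact (H.hasYoungIntegral hτ hθ ht ht).congr e ht ht

/-- The Hölder condition in the notion of solution places u - z in the class at some scale, where
the Young integral is computed; uniqueness of its value then gives the fixed point equation. -/
theorem IsDriver.isFixedPath_of_isSolution (hw : MemLp w ∞ (volume.restrict (Icc 0 T)))
    (H : IsDriver T γ a m w z (fourierFunction b)) {u : ℝ → RSpace d}
    (hu : IsSolution T γ w z b x u) :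
    ∃ τ > 0, HolderAtScale T γ τ (u - z) ∧ IsFixedPath T w z (fourierFunction b) x (u - z) := by
  obtain ⟨τ, hτ, hθ⟩ := exists_holderAtScale_of_holderNorm H.γ_pos hu.holder
  refine ⟨τ, hτ, hθ, fun t ht => ?_⟩
  have h1 := (hu.equation t ht).congr (fun s hs t ht =>
    averagedField_eq_waveField hw H.cont b hs ht) ht ht
  have h2 := h1.unique ht.1 ht.1 (H.hasYoungIntegral hτ hθ ht ht)
  rw [selfInt, ← h2, Pi.sub_apply]
  abel

variable {v : RSpace d → RSpace d} {K : ℝ≥0}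

theorem IsDriver.isClassicalSolution (hw : MemLp w ∞ (volume.restrict (Icc 0 T)))
    (H : IsDriver T γ a m w z h) (hv : LipschitzWith K v) (hb : IsGivenBy b v)
    (hh : HasFourierFunction b h) (hτ : 0 < τ) (hθ : HolderAtScale T γ τ θ)
    (hfix : IsFixedPath T w z h x θ) : IsClassicalSolution T w z v x (z + θ) := by
  have hc := H.continuousOn_add hτ hθ
  obtain ⟨n, hn⟩ := exists_nat_ge (T / τ)
  refine ⟨hc, fun t ht => ?_⟩
  rw [integral_lipschitz_eq_selfInt hw hc hv hb hh ht
    (H.integrable_selfInt hτ hθ ((div_le_iff₀ hτ).1 hn) ht ht), ← hfix t ht, Pi.add_apply,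
    add_comm]

/-- A merely continuous solution has a Lipschitz perturbation u - z, because the interaction term is
Lipschitz in time; as γ < 1 it is γ-Hölder with constant N T^{1-γ} and thus falls under the
uniqueness theory. -/
theorem IsDriver.isFixedPath_of_isClassicalSolution (hγ' : γ < 1)
    (hw : MemLp w ∞ (volume.restrict (Icc 0 T)))
    (hT : 0 ≤ T) (H : IsDriver T γ a m w z h) (hv : LipschitzWith K v) (hb : IsGivenBy b v)
    (hh : HasFourierFunction b h) {u : ℝ → RSpace d} (hu : IsClassicalSolution T w z v x u) :
    ∃ τ > 0, HolderAtScale T γ τ (u - z) ∧ IsFixedPath T w z h x (u - z) := by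
  have heq : ∀ t ∈ Icc 0 T, (u - z) t =
      x + ∫ s in (0 : ℝ)..t, ∫ r in (0 : ℝ)..t, (w s * w r) • v (u s - u r) := fun t ht => by
    rw [Pi.sub_apply, hu.equation t ht, add_sub_cancel_right]
  obtain ⟨N, hN, hle⟩ := exists_norm_integral_sub_le hw hu.continuousOn hv.continuous hT
  obtain ⟨τ, hτ, hθ⟩ : ∃ τ > 0, HolderAtScale T γ τ (u - z) := by
    refine exists_holderAtScale H.γ_pos (K := N * T ^ (1 - γ)) (by positivity)
      fun s hs t ht hst => ?_
    rw [heq t ht, heq s hs, add_sub_add_left_eq_sub]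
    refine (hle s hs t ht hst).trans ?_
    have h0 : 0 ≤ t - s := by linarith
    rw [mul_assoc]
    gcongr
    calc t - s = (t - s) ^ (1 - γ) * (t - s) ^ γ := by
          rw [← Real.rpow_add' h0 (by norm_num), sub_add_cancel, Real.rpow_one]
      _ ≤ _ := by
          gcongr
          linarith [hs.1, ht.2]
  obtain ⟨n, hn⟩ := exists_nat_ge (T / τ)
  refine ⟨τ, hτ, hθ, fun t ht => ?_⟩
  have hg := H.integrable_selfInt hτ hθ ((div_le_iff₀ hτ).1 hn) ht ht
  rw [add_sub_cancel] at hg ⊢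
  rw [heq t ht, integral_lipschitz_eq_selfInt hw hu.continuousOn hv hb hh ht hg]

end Solutions

/-! ### Triangle inequalities for the Fourier-Lebesgue norm -/

section Approximation

variable {d : ℕ} {f g : 𝓢'(RSpace d, CSpace d)} {p : ℝ≥0∞} {s : ℝ}

theorem MemFL.flNorm_sub_le (hp : 1 ≤ p) (hf : MemFL p s f) (hg : MemFL p s g) :
    flNorm p s (f - g) ≤ flNorm p s f + flNorm p s g := by
  have hF := hf.hasFourierFunction
  have hG := hg.hasFourierFunction
  rw [(hF.sub hG).flNorm_eq, hF.flNorm_eq, hG.flNorm_eq]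
  have hc : AEStronglyMeasurable (fun ξ : RSpace d => japaneseBracket ξ ^ s) :=
    (continuous_japaneseBracket_rpow s).aestronglyMeasurable
  have := eLpNorm_sub_le (p := p) (hc.smul hF.aestronglyMeasurable)
    (hc.smul hG.aestronglyMeasurable) hp
  refine le_trans (le_of_eq ?_) this
  congr 1
  ext1 ξ
  simp only [Pi.sub_apply, Pi.smul_apply', smul_sub]

theorem MemFL.flNorm_le_add_sub (hp : 1 ≤ p) (hf : MemFL p s f) (hg : MemFL p s g) :
    flNorm p s f ≤ flNorm p s (f - g) + flNorm p s g := by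
  have hF := hf.hasFourierFunction
  have hG := hg.hasFourierFunction
  rw [(hF.sub hG).flNorm_eq, hF.flNorm_eq, hG.flNorm_eq]
  have hc : AEStronglyMeasurable (fun ξ : RSpace d => japaneseBracket ξ ^ s) :=
    (continuous_japaneseBracket_rpow s).aestronglyMeasurable
  have := eLpNorm_add_le (p := p) (hc.smul (hF.sub hG).aestronglyMeasurable)
    (hc.smul hG.aestronglyMeasurable) hp
  refine le_trans (le_of_eq ?_) this
  congr 1
  ext1 ξ
  simp only [Pi.add_apply, Pi.sub_apply, Pi.smul_apply', smul_sub, sub_add_cancel]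

end Approximation

end SelfInteraction

/-! ### Existence, uniqueness and stability -/

theorem theorem5p4 {d : ℕ} (T : ℝ) (hT : 0 < T)
    (w : ℝ → ℝ) (hw : MemLp w ∞ (volume.restrict (Icc 0 T)))
    (z : ℝ → RSpace d) (hz : ContinuousOn z (Icc 0 T))
    (γ δ κ : ℝ) (q q' : ℝ≥0∞) (hγ : 1 / 2 < γ) (hγ' : γ < 1)
    (hq : 1 ≤ q) (hq' : 1 ≤ q') (hqq' : 1 / q + 1 / q' = 1) (hδκ : 1 + 1 / γ < δ + κ)
    (b : 𝓢'(RSpace d, CSpace d))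
    (hb_real : IsRealDistribution b) (hb : MemFL q' δ b)
    (hG : TwoParamHolder (flNorm q κ) T γ fun t₁ t₂ =>
      toDistribution (selfIntersectionMeasure T w z t₁ t₂))
    (u₀ : RSpace d) :
    ∃ u : ℝ → RSpace d,
      IsSolution T γ w z b u₀ u ∧
      (∀ v, IsSolution T γ w z b u₀ v → EqOn v u (Icc 0 T)) ∧
      ∀ (B : ℕ → 𝓢'(RSpace d, CSpace d))
        (bn : ℕ → RSpace d → RSpace d)
        (u₀n : ℕ → RSpace d),
        (∀ n, MemFL q' δ (B n)) →
        (∀ n, ∃ K : ℝ≥0, LipschitzWith K (bn n)) →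
        (∀ n, IsGivenBy (B n) (bn n)) →
        Tendsto (fun n => flNorm q' δ (B n - b)) atTop (𝓝 0) →
        Tendsto u₀n atTop (𝓝 u₀) →
        ∃ un : ℕ → ℝ → RSpace d,
          (∀ n, IsClassicalSolution T w z (bn n) (u₀n n) (un n) ∧
            ∀ v, IsClassicalSolution T w z (bn n) (u₀n n) v →
              EqOn v (un n) (Icc 0 T)) ∧
          ∃ C : ℝ≥0, ∀ n,
            holderNorm T γ (un n - u) ≤
              C * (flNorm q' δ (B n - b) + ‖u₀n n - u₀‖ₑ) := by
  have hγ0 : 0 < γ := by linarith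
  obtain ⟨C, hC⟩ := hG
  have hbox : ∀ s₁ ∈ Icc 0 T, ∀ t₁ ∈ Icc 0 T, ∀ s₂ ∈ Icc 0 T, ∀ t₂ ∈ Icc 0 T,
      flNorm q κ (box (fun t₁ t₂ => toDistribution (selfIntersectionMeasure T w z t₁ t₂))
        s₁ s₂ t₁ t₂) ≤ C * ENNReal.ofReal (|t₁ - s₁| ^ γ * |t₂ - s₂| ^ γ) :=
    fun s₁ hs₁ t₁ ht₁ s₂ hs₂ t₂ ht₂ => (hC s₁ hs₁ t₁ ht₁ s₂ hs₂ t₂ ht₂).2.2.2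
  have hinv : 1 / γ < 2 := by rw [div_lt_iff₀ hγ0]; linarith
  have hinv' : 1 < 1 / γ := by rw [lt_div_iff₀ hγ0]; linarith
  -- The lower bound gives γ(1 + a) > 1 and the upper one 1 + 2 a ≤ δ + κ. The interval is nonempty
  -- since γ > 1/2 gives 1/γ - 1 < 1 and also 1/γ - 1 < 1/(2γ) < (δ + κ - 1)/2.
  obtain ⟨a, ha1, ha2⟩ : ∃ a, 1 / γ - 1 < a ∧ a < min 1 ((δ + κ - 1) / 2) :=
    exists_between (lt_min (by linarith) (by linarith))
  have ha : 0 < a := by linarith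
  have ha' : a < 1 := ha2.trans_le (min_le_left _ _)
  have haδκ : 1 + 2 * a ≤ δ + κ := by linarith [ha2.trans_le (min_le_right _ _)]
  have hβ : 1 < γ * (1 + a) := by
    have := mul_lt_mul_of_pos_left (show 1 / γ < 1 + a by linarith) hγ0
    rwa [mul_one_div_cancel hγ0.ne'] at this
  have hdrv : ∀ {f : 𝓢'(RSpace d, CSpace d)} {h : RSpace d → CSpace d}, HasFourierFunction f h →
      ∀ {M : ℝ}, 0 ≤ M → flNorm q' δ f ≤ ENNReal.ofReal M →
      IsDriver T γ a (Real.sqrt (C * M)) w z h := fun hf _ hM hfM =>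
    isDriver_of_flNorm_le hT.le hw hz hqq' ha ha'.le hγ0 hβ haδκ hbox hf hM hfM
  have hbh := hb.hasFourierFunction
  set h := fourierFunction b with hh
  have H := hdrv hbh ENNReal.toReal_nonneg (ENNReal.ofReal_toReal hb.ne).ge
  obtain ⟨n₀, hn₀, -, hε₀⟩ := exists_stepFactor_le hγ a
    (Real.sqrt (C * (flNorm q' δ b).toReal)) hT one_pos (by norm_num : (0 : ℝ) < 1 / 8)
  have hτ₀ : 0 < T / n₀ := by positivity
  obtain ⟨θ, hθ, hfix⟩ := H.exists_isFixedPath hT.le hτ₀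
    (mul_div_cancel₀ _ (by positivity : (n₀ : ℝ) ≠ 0)).ge hε₀ u₀
  refine ⟨z + θ, H.isSolution hw ha' hτ₀ hθ hfix, fun v hv => ?_, ?_⟩
  · obtain ⟨τ, hτ, hθ', hfix'⟩ := H.isFixedPath_of_isSolution hw hv
    intro t ht
    have := H.eqOn_of_isFixedPath hγ hT hτ hτ₀ hθ' hθ hfix' hfix ht
    rw [Pi.add_apply, ← this, Pi.sub_apply, add_sub_cancel]
  intro B bn u₀n hBmem hlip hgiven hBlim _
  have he : ∀ n, flNorm q' δ (B n - b) ≠ ∞ := fun n =>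
    (((hBmem n).flNorm_sub_le hq' hb).trans_lt (ENNReal.add_lt_top.2 ⟨hBmem n, hb⟩)).ne
  set e : ℕ → ℝ := fun n => (flNorm q' δ (B n - b)).toReal with hedef
  have helim : Tendsto e atTop (𝓝 0) := (ENNReal.tendsto_toReal ENNReal.zero_ne_top).comp hBlim
  -- A convergent sequence is bounded, so all b_n satisfy the driver estimates with the common
  -- constant M; scale and final constant can then be independent of n.
  obtain ⟨E, hE⟩ := helim.bddAbove_range
  have heE : ∀ n, e n ≤ E := fun n => hE (mem_range_self n)
  have hE0 : 0 ≤ E := ENNReal.toReal_nonneg.trans (heE 0)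
  set M : ℝ := E + (flNorm q' δ b).toReal with hM
  have hM0 : 0 ≤ M := add_nonneg hE0 ENNReal.toReal_nonneg
  have hBn := fun n => (hBmem n).hasFourierFunction
  have Hn : ∀ n, IsDriver T γ a (Real.sqrt (C * M)) w z (fourierFunction (B n)) := fun n => by
    refine hdrv (hBn n) hM0 (((hBmem n).flNorm_le_add_sub hq' hb).trans ?_)
    rw [hM, ENNReal.ofReal_add hE0 ENNReal.toReal_nonneg, ENNReal.ofReal_toReal hb.ne]
    gcongr
    exact (ENNReal.le_ofReal_iff_toReal_le (he n) hE0).2 (heE n)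
  have Hd : ∀ n, IsDriver T γ a (Real.sqrt (C * e n)) w z (fourierFunction (B n) - h) := fun n =>
    hdrv ((hBn n).sub hbh) ENNReal.toReal_nonneg (ENNReal.ofReal_toReal (he n)).ge
  -- The scale must also be at most τ₀, so that the limit θ belongs to the class at the scale used
  -- for all n.
  obtain ⟨N, hN, hNτ, hε⟩ := exists_stepFactor_le hγ a (Real.sqrt (C * M)) hT hτ₀
    (by norm_num : (0 : ℝ) < 1 / 8)
  set τ : ℝ := T / N with hτdef
  have hτ : 0 < τ := by positivity
  have hNT : T ≤ N * τ := (mul_div_cancel₀ _ (by positivity : (N : ℝ) ≠ 0)).ge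
  choose θn hθn hfixn using fun n => (Hn n).exists_isFixedPath hT.le hτ hNT hε (u₀n n)
  have hclose := fun n => (Hn n).closeAtScale (Hd n) ⟨_, H⟩ hT.le hτ hNT
    (hε.trans (by norm_num)) (hθn n) (hθ.mono_scale hτ hNτ hγ0.le) (hfixn n) hfix
  refine ⟨fun n => z + θn n, fun n => ?_, ?_⟩
  · obtain ⟨K, hK⟩ := hlip n
    refine ⟨(Hn n).isClassicalSolution hw hK (hgiven n) (hBn n) hτ (hθn n) (hfixn n),
      fun v hv => ?_⟩
    obtain ⟨τ', hτ', hθ', hfix'⟩ := (Hn n).isFixedPath_of_isClassicalSolution hγ' hw hT.le hK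
      (hgiven n) (hBn n) hv
    intro t ht
    have := (Hn n).eqOn_of_isFixedPath hγ hT hτ' hτ hθ' (hθn n) hfix' (hfixn n) ht
    change v t = (z + θn n) t
    rw [Pi.add_apply, ← this, Pi.sub_apply, add_sub_cancel]
  -- Q e_n is twice the step factor of the difference kernel. It is linear in e_n because the factor
  -- is quadratic in the driver constant, whose square is C e_n; this yields the linear rate in the
  -- norm of b_n - b.
  set Q : ℝ := 8 * N * youngConst (γ * (1 + a)) ^ 2 * C * (τ ^ γ) ^ 2 with hQ
  have hQ0 : 0 ≤ Q := by positivity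
  have hK0 : 0 ≤ (1 + 3 / τ ^ γ) * 2 ^ N * (1 + Q) := by positivity
  refine ⟨((1 + 3 / τ ^ γ) * 2 ^ N * (1 + Q)).toNNReal, fun n => ?_⟩
  have hen : 0 ≤ e n := ENNReal.toReal_nonneg
  rw [add_sub_add_left_eq_sub]
  refine ((hclose n).holderNorm_le hτ hγ0.le).trans ?_
  rw [← ENNReal.ofReal_toReal (he n), ← ofReal_norm, ← ENNReal.ofReal_add hen (norm_nonneg _),
    ← ENNReal.ofReal_coe_nnreal, ← ENNReal.ofReal_mul NNReal.zero_le_coe,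
    Real.coe_toNNReal _ hK0]
  refine ENNReal.ofReal_le_ofReal ?_
  have hstep : 2 * stepFactor γ a (Real.sqrt (C * e n)) τ N = Q * e n := by
    rw [stepFactor, Real.sq_sqrt (by positivity), hQ]
    ring
  rw [hstep, ← mul_assoc, mul_assoc _ (1 + Q)]
  gcongr
  nlinarith [norm_nonneg (u₀n n - u₀)]
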